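/- **Setting.** On $\mathfrak H=L^2(\mathbb R,dx)$ let $(Q\psi)(x)=x\psi(x)$, $P=-i\,d/dx$ and, for $z=(q+ip)/\sqrt2\in\mathbb C$, let $D(z)=e^{i(pQ-qP)}$, i.e. $(D(z)\psi)(x)=e^{ip(x-q/2)}\psi(x-q)$. Put $q(z)=\sqrt2\,\mathrm{Re}\,z$, $p(z)=\sqrt2\,\mathrm{Im}\,z$. Operator integrals are weak, on the dense space $\mathcal S=\mathcal S(\mathbb R)\subset\mathfrak H$ of Schwartz vectors: a bounded operator $\mathsf M$ is defined by a weight $\varpi:\mathbb C\to\mathbb C$, written $\mathsf M=\int_{\mathbb C}\varpi(z)D(z)\frac{d^2z}{\pi}$, if for all $\varphi,\psi\in\mathcal S$ the function $\varpi(z)\langle\varphi,D(z)\psi\rangle$ is integrable and $\langle\varphi,\mathsf M\psi\rangle=\int\varpi(z)\langle\varphi,D(z)\psi\rangle\frac{d^2z}{\pi}$. Put $\mathsf M(z)=D(z)\mathsf M D(z)^\dagger$. For $f:\mathbb C\to\mathbb C$ let $B_f(\varphi,\psi)=\int_{\mathbb C}\langle\varphi,\mathsf M(z)\psi\rangle f(z)\frac{d^2z}{\pi}$,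 and let $A_f=\int_{\mathbb C}\mathsf M(z)f(z)\frac{d^2z}{\pi}$ be the operator of this form: its domain consists of those $\psi\in\mathcal S$ for which $B_f(\varphi,\psi)$ converges absolutely for every $\varphi\in\mathcal S$ and there is a vector $A_f\psi\in\mathfrak H$ with $B_f(\varphi,\psi)=\langle\varphi,A_f\psi\rangle$ for every $\varphi\in\mathcal S$. For $f:\mathbb R\to\mathbb C$ measurable, $f(Q)$ is multiplication by $f(x)$ and $f(P)=\mathcal F^{-1}f(2\pi\xi)\mathcal F$, on their maximal domains, where $(\mathcal F\psi)(\xi)=\int e^{-2\pi ix\xi}\psi(x)\,dx$. We write $A_{f(q)}$, $A_{f(p)}$ for the quantizations of $z\mapsto f(q(z))$, $z\mapsto f(p(z))$. **Theorem.** (a) Let $m:\mathbb R\to\mathbb R$ be measurable and continuous at $0$ with $m(0)=1$, and suppose that $\varpi(z)=m(\mathrm{Im}(z^2))$ defines a bounded operator $\mathsf M$ as above. Then $A_{f(q)}=f(Q)$ and $A_{f(p)}=f(P)$, in the following sense. 1. For every measurable $f:\mathbb R\to\mathbb C$ and $\varphi,\psi\in\mathcal S$: if the integral $B_{f(q)}(\varphi,\psi)$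 converges absolutely, then so does $\int\overline{\varphi(x)}f(x)\psi(x)\,dx$ and the two are equal; if $B_{f(p)}(\varphi,\psi)$ converges absolutely, then so does $\int\overline{\mathcal F\varphi(\xi)}f(2\pi\xi)\mathcal F\psi(\xi)\,d\xi$ and the two are equal. 2. For every measurable $f$, $A_{f(q)}\subseteq f(Q)$ and $A_{f(p)}\subseteq f(P)$; if $A_{f(q)}$ (respectively $A_{f(p)}$) is defined on all of $\mathcal S$, then its closure is equal to $f(Q)$ (respectively $f(P)$). 3. If $f(x)=\int e^{itx}d\nu(t)$ for a finite complex measure $\nu$, then, without any convergence assumption, for all $\varphi,\psi\in\mathcal S$, $$\lim_{\varepsilon\to0^+}\int_{\mathbb C}e^{-\varepsilon|z|^2}\langle\varphi,\mathsf M(z)\psi\rangle f(q(z))\frac{d^2z}{\pi}=\int\overline{\varphi(x)}f(x)\psi(x)\,dx,$$ $$\lim_{\varepsilon\to0^+}\int_{\mathbb C}e^{-\varepsilon|z|^2}\langle\varphi,\mathsf M(z)\psi\rangle f(p(z))\frac{d^2z}{\pi}=\int\overline{\mathcal F\varphi(\xi)}f(2\pi\xi)\mathcal F\psi(\xi)\,d\xi,$$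 where the integrals on the left converge absolutely for each $\varepsilon>0$. 4. If $m$ is $C^\infty$ and $m$ and all its derivatives grow at most polynomially, then for every measurable $f$ of at most polynomial growth $A_{f(q)}$ and $A_{f(p)}$ have domain $\mathcal S$, and their closures are $f(Q)$ and $f(P)$. (b) Weyl–Wigner quantization, given by $\mathsf M=2\mathsf P$ with $(\mathsf P\psi)(x)=\psi(-x)$, is the case $m\equiv1$, and it has the property in the conclusion of 4. (c) It is not the only one: there are a $C^\infty$ function $m$ with $m(0)=1$, polynomially bounded with all its derivatives, and a bounded operator $\mathsf M$ defined by the weight $m(\mathrm{Im}(z^2))$, such that the corresponding quantization has the property in the conclusion of 4 but is different from Weyl–Wigner quantization: for some $F:\mathbb C\to\mathbb C$ both quantizations of $F$ have domain $\mathcal S$, and they are different operators. -/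

import Mathlib

open MeasureTheory SchwartzMap

open scoped FourierTransform InnerProductSpace

noncomputable section

namespace WeylHeisenberg

/-- The Hilbert space `L²(ℝ, dx)` of the Schrödinger representation. -/
abbrev StateSpace : Type := Lp ℂ 2 (volume : Measure ℝ)

/-- The coordinate `q` of the phase space point `z = (q + i p) / √2`. -/
def position (z : ℂ) : ℝ := √2 * z.re

/-- The coordinate `p` of the phase space point `z = (q + i p) / √2`. -/
def momentum (z : ℂ) : ℝ := √2 * z.im

/-- `x ↦ exp (i p (x - q / 2)) φ (x - q)`, where `z = (q + i p) / √2`. -/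
def displacementFun (z : ℂ) (φ : ℝ → ℂ) (x : ℝ) : ℂ :=
  Complex.exp (((momentum z * (x - position z / 2) : ℝ) : ℂ) * Complex.I) * φ (x - position z)

theorem aestronglyMeasurable_displacementFun (z : ℂ) {φ : ℝ → ℂ}
    (hφ : AEStronglyMeasurable φ (volume : Measure ℝ)) :
    AEStronglyMeasurable (displacementFun z φ) (volume : Measure ℝ) := by
  refine AEStronglyMeasurable.mul ?_ ?_
  · exact Continuous.aestronglyMeasurable (by fun_prop)
  · exact hφ.comp_measurePreserving (measurePreserving_sub_right volume (position z))

theorem eLpNorm_displacementFun (z : ℂ) {φ : ℝ → ℂ}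
    (hφ : AEStronglyMeasurable φ (volume : Measure ℝ)) :
    eLpNorm (displacementFun z φ) 2 volume = eLpNorm φ 2 volume := by
  rw [← eLpNorm_comp_measurePreserving hφ (measurePreserving_sub_right volume (position z))]
  refine eLpNorm_congr_norm_ae (Filter.Eventually.of_forall fun x => ?_)
  simp only [displacementFun, norm_mul, Complex.norm_exp_ofReal_mul_I, one_mul, Function.comp]

theorem memLp_displacementFun (z : ℂ) {φ : ℝ → ℂ} (hφ : MemLp φ 2 (volume : Measure ℝ)) :
    MemLp (displacementFun z φ) 2 (volume : Measure ℝ) :=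
  ⟨aestronglyMeasurable_displacementFun z hφ.1, by
    rw [eLpNorm_displacementFun z hφ.1]; exact hφ.2⟩

theorem displacementFun_congr (z : ℂ) {φ ψ : ℝ → ℂ} (h : φ =ᵐ[volume] ψ) :
    displacementFun z φ =ᵐ[volume] displacementFun z ψ := by
  have := (measurePreserving_sub_right (volume : Measure ℝ)
    (position z)).quasiMeasurePreserving.ae_eq_comp h
  filter_upwards [this] with x hx
  simp only [Function.comp] at hx
  simp only [displacementFun, hx]

/-- The displacement operator `D(z) = exp (z a† - z̄ a) = exp (i (p Q - q P))` on `L²(ℝ)`. -/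
def displacement (z : ℂ) : StateSpace →ₗᵢ[ℂ] StateSpace where
  toFun φ := (memLp_displacementFun z (Lp.memLp φ)).toLp (displacementFun z φ)
  map_add' φ ψ := by
    rw [← MemLp.toLp_add]
    refine MemLp.toLp_congr _ _ ((displacementFun_congr z (Lp.coeFn_add φ ψ)).trans ?_)
    exact Filter.Eventually.of_forall fun x => by
      simp only [displacementFun, Pi.add_apply, mul_add]
  map_smul' c φ := by
    rw [RingHom.id_apply, ← MemLp.toLp_const_smul]
    refine MemLp.toLp_congr _ _ ((displacementFun_congr z (Lp.coeFn_smul c φ)).trans ?_)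
    exact Filter.Eventually.of_forall fun x => by
      simp only [displacementFun, Pi.smul_apply, smul_eq_mul, mul_left_comm]
  norm_map' φ := by
    change ‖(memLp_displacementFun z (Lp.memLp φ)).toLp (displacementFun z φ)‖ = ‖φ‖
    rw [Lp.norm_toLp, eLpNorm_displacementFun z (Lp.memLp φ).1, Lp.norm_def]

/-- A Schwartz function as a vector of `L²(ℝ)`. -/
def vec (φ : 𝓢(ℝ, ℂ)) : StateSpace := SchwartzMap.toLpCLM ℂ ℂ 2 volume φ

/-- The dense subspace of Schwartz vectors, on which the weak integrals are tested. -/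
def schwartzDomain : Submodule ℂ StateSpace :=
  LinearMap.range (SchwartzMap.toLpCLM ℂ ℂ 2 (volume : Measure ℝ)).toLinearMap

theorem dense_schwartzDomain : Dense (schwartzDomain : Set StateSpace) := by
  have h : DenseRange (SchwartzMap.toLpCLM ℝ (E := ℝ) ℂ 2 (volume : Measure ℝ)) :=
    SchwartzMap.denseRange_toLpCLM ENNReal.ofNat_ne_top
  have e : (schwartzDomain : Set StateSpace)
      = Set.range (SchwartzMap.toLpCLM ℝ (E := ℝ) ℂ 2 (volume : Measure ℝ)) := by
    ext x
    simp only [schwartzDomain, LinearMap.coe_range, Set.mem_range]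
    rfl
  rw [e]
  exact h

/-- `M = ∫ ϖ(z) D(z) d²z / π` as a bounded operator, the integral being weak, on Schwartz
vectors. -/
def IsOperatorOfWeight (ϖ : ℂ → ℂ) (M : StateSpace →L[ℂ] StateSpace) : Prop :=
  ∀ φ ψ : 𝓢(ℝ, ℂ),
    Integrable (fun z : ℂ => ϖ z * ⟪vec φ, displacement z (vec ψ)⟫_ℂ) ∧
    ⟪vec φ, M (vec ψ)⟫_ℂ =
      (Real.pi : ℂ)⁻¹ * ∫ z : ℂ, ϖ z * ⟪vec φ, displacement z (vec ψ)⟫_ℂ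

/-- The displaced operator `M(z) = D(z) M D(z)†`. -/
def displaced (M : StateSpace →L[ℂ] StateSpace) (z : ℂ) : StateSpace →L[ℂ] StateSpace :=
  (displacement z).toContinuousLinearMap ∘L M ∘L
    (displacement z).toContinuousLinearMap.adjoint

/-- The integrand `⟨φ, M(z) ψ⟩ f(z)` of the form of `A_f`. -/
def formIntegrand (M : StateSpace →L[ℂ] StateSpace) (f : ℂ → ℂ) (φ ψ : StateSpace) (z : ℂ) : ℂ :=
  f z * ⟪φ, displaced M z ψ⟫_ℂ

/-- The sesquilinear form `B_f(φ, ψ) = ∫ ⟨φ, M(z) ψ⟩ f(z) d²z / π`. -/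
def quantForm (M : StateSpace →L[ℂ] StateSpace) (f : ℂ → ℂ) (φ ψ : StateSpace) : ℂ :=
  (Real.pi : ℂ)⁻¹ * ∫ z : ℂ, formIntegrand M f φ ψ z

/-- The form `B_f(φ, ψ)`, its integral being Gaussian summable only, has the value `b`:
`∫ exp (-ε |z|²) ⟨φ, M(z) ψ⟩ f(z) d²z / π → b` as `ε → 0+`. -/
def QuantFormTendsto (M : StateSpace →L[ℂ] StateSpace) (f : ℂ → ℂ) (φ ψ : StateSpace)
    (b : ℂ) : Prop :=
  (∀ ε : ℝ, 0 < ε →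
    Integrable fun z : ℂ => (Real.exp (-ε * ‖z‖ ^ 2) : ℂ) * formIntegrand M f φ ψ z) ∧
  Filter.Tendsto
    (fun ε : ℝ => (Real.pi : ℂ)⁻¹ *
      ∫ z : ℂ, (Real.exp (-ε * ‖z‖ ^ 2) : ℂ) * formIntegrand M f φ ψ z)
    (nhdsWithin 0 (Set.Ioi 0)) (nhds b)

/-- The pairs `(ψ, η)` with `ψ` a Schwartz vector such that, for all Schwartz vectors `φ`, the
integral of `B_f(φ, ψ)` converges and `B_f(φ, ψ) = ⟨φ, η⟩`. -/
def quantGraph (M : StateSpace →L[ℂ] StateSpace) (f : ℂ → ℂ) :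
    Submodule ℂ (StateSpace × StateSpace) where
  carrier := {x | x.1 ∈ schwartzDomain ∧ ∀ φ ∈ schwartzDomain,
    Integrable (formIntegrand M f φ x.1) ∧ quantForm M f φ x.1 = ⟪φ, x.2⟫_ℂ}
  zero_mem' := by
    refine ⟨Submodule.zero_mem _, fun φ _ => ?_⟩
    have h : formIntegrand M f φ (0 : StateSpace × StateSpace).1 = fun _ => 0 := by
      funext z
      simp [formIntegrand]
    rw [quantForm, h]
    simp
  add_mem' := by
    rintro x y ⟨hx, hx'⟩ ⟨hy, hy'⟩
    refine ⟨Submodule.add_mem _ hx hy, fun φ hφ => ?_⟩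
    obtain ⟨ix, ex⟩ := hx' φ hφ
    obtain ⟨iy, ey⟩ := hy' φ hφ
    have h : formIntegrand M f φ (x + y).1
        = fun z => formIntegrand M f φ x.1 z + formIntegrand M f φ y.1 z := by
      funext z
      simp [formIntegrand, inner_add_right, mul_add]
    refine ⟨h ▸ ix.add iy, ?_⟩
    rw [quantForm, h, integral_add ix iy, mul_add, Prod.snd_add, inner_add_right, ← ex, ← ey]
    rfl
  smul_mem' := by
    rintro c x ⟨hx, hx'⟩
    refine ⟨Submodule.smul_mem _ c hx, fun φ hφ => ?_⟩
    obtain ⟨ix, ex⟩ := hx' φ hφ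
    have h : formIntegrand M f φ (c • x).1 = fun z => c * formIntegrand M f φ x.1 z := by
      funext z
      simp [formIntegrand, inner_smul_right, mul_left_comm]
    refine ⟨h ▸ ix.const_mul c, ?_⟩
    rw [quantForm, h, integral_const_mul, Prod.smul_snd, inner_smul_right, ← ex, quantForm,
      mul_left_comm]

/-- The operator `A_f = ∫ M(z) f(z) d²z / π`: the operator of the form `B_f` on Schwartz vectors.
Its domain consists of the Schwartz vectors `ψ` for which `B_f(φ, ψ)` converges for all Schwartz
vectors `φ` and is represented by a vector `A_f ψ` of the Hilbert space. -/
def quantize (M : StateSpace →L[ℂ] StateSpace) (f : ℂ → ℂ) : StateSpace →ₗ.[ℂ] StateSpace :=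
  (quantGraph M f).toLinearPMap

theorem graph_quantize (M : StateSpace →L[ℂ] StateSpace) (f : ℂ → ℂ) :
    (quantize M f).graph = quantGraph M f := by
  refine Submodule.toLinearPMap_graph_eq _ ?_
  rintro ⟨ψ, η⟩ ⟨-, h⟩ (h0 : ψ = 0)
  subst h0
  refine dense_schwartzDomain.eq_zero_of_inner_right (𝕜 := ℂ) fun φ hφ => ?_
  obtain ⟨-, e⟩ := h φ hφ
  have h1 : formIntegrand M f φ (0 : StateSpace) = fun _ => 0 := by
    funext z
    simp [formIntegrand]
  change quantForm M f φ 0 = _ at e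
  rw [quantForm, h1] at e
  simpa using e.symm

/-- The pairs `(ψ, η)` in `L²(ℝ)` with `η = g ψ` almost everywhere. -/
def multiplicationGraph (g : ℝ → ℂ) : Submodule ℂ (StateSpace × StateSpace) where
  carrier := {x | (x.2 : ℝ → ℂ) =ᵐ[volume] fun t => g t * x.1 t}
  zero_mem' := by
    filter_upwards [Lp.coeFn_zero ℂ 2 (volume : Measure ℝ)] with t
    simp
  add_mem' := by
    rintro x y hx hy
    change _ =ᵐ[volume] _ at hx hy ⊢
    filter_upwards [hx, hy, Lp.coeFn_add x.1 y.1, Lp.coeFn_add x.2 y.2] with t h1 h2 h3 h4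
    simp only [Prod.fst_add, Prod.snd_add, h3, h4, Pi.add_apply, h1, h2, mul_add]
  smul_mem' := by
    rintro c x hx
    change _ =ᵐ[volume] _ at hx ⊢
    filter_upwards [hx, Lp.coeFn_smul c x.1, Lp.coeFn_smul c x.2] with t h1 h3 h4
    simp only [Prod.smul_fst, Prod.smul_snd, h3, h4, Pi.smul_apply, h1, smul_eq_mul,
      mul_left_comm]

/-- `f(Q)`, for the position operator `(Q ψ)(x) = x ψ(x)`: multiplication by `f(x)` on its maximal
domain `{ψ ∈ L² | f ψ ∈ L²}`. -/
def functionOfQ (f : ℝ → ℂ) : StateSpace →ₗ.[ℂ] StateSpace :=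
  (multiplicationGraph f).toLinearPMap

/-- `f(P)`, for the momentum operator `P = -i d/dx`: as the transform `𝓕` with kernel
`exp (-2πi x ξ)` turns `P` into multiplication by `2πξ`, it is `𝓕⁻¹ ∘ f(2πξ) ∘ 𝓕` on its maximal
domain `{ψ ∈ L² | f(2πξ) (𝓕 ψ)(ξ) ∈ L²}`. -/
def functionOfP (f : ℝ → ℂ) : StateSpace →ₗ.[ℂ] StateSpace :=
  ((multiplicationGraph fun ξ => f (2 * Real.pi * ξ)).comap
    ((Lp.fourierTransformₗᵢ ℝ ℂ).toLinearEquiv.toLinearMap.prodMap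
      (Lp.fourierTransformₗᵢ ℝ ℂ).toLinearEquiv.toLinearMap)).toLinearPMap

theorem multiplicationGraph_functional (g : ℝ → ℂ) (x : StateSpace × StateSpace)
    (hx : x ∈ multiplicationGraph g) (h0 : x.1 = 0) : x.2 = 0 := by
  change _ =ᵐ[volume] _ at hx
  refine Lp.ext ?_
  filter_upwards [hx, Lp.coeFn_zero ℂ 2 (volume : Measure ℝ)] with t h1 h2
  rw [h1, h0, h2]
  simp

theorem mem_graph_functionOfQ (f : ℝ → ℂ) (ψ η : StateSpace) :
    (ψ, η) ∈ (functionOfQ f).graph ↔ (η : ℝ → ℂ) =ᵐ[volume] fun x => f x * ψ x := by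
  rw [functionOfQ, Submodule.toLinearPMap_graph_eq _ (multiplicationGraph_functional f)]
  rfl

theorem mem_graph_functionOfP (f : ℝ → ℂ) (ψ η : StateSpace) :
    (ψ, η) ∈ (functionOfP f).graph ↔
      ((𝓕 η : StateSpace) : ℝ → ℂ) =ᵐ[volume]
        fun ξ => f (2 * Real.pi * ξ) * (𝓕 ψ : StateSpace) ξ := by
  rw [functionOfP, Submodule.toLinearPMap_graph_eq]
  · rfl
  · intro x hx h0
    have := multiplicationGraph_functional _ _ hx
      (show Lp.fourierTransformₗᵢ ℝ ℂ x.1 = 0 by rw [h0, map_zero])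
    exact (Lp.fourierTransformₗᵢ ℝ ℂ).map_eq_zero_iff.mp this

/-- The weight `ϖ(z) = m(Im z²)`. -/
def hyperbolicWeight (m : ℝ → ℝ) (z : ℂ) : ℂ := (m (z ^ 2).im : ℂ)

/-- The parity operator `(Π ψ)(x) = ψ(-x)`. -/
def parity : StateSpace →L[ℂ] StateSpace :=
  (Lp.compMeasurePreservingₗᵢ ℂ (fun x : ℝ => -x)
    (Measure.measurePreserving_neg volume)).toContinuousLinearMap

/-- The operator `M = 2Π` of Weyl–Wigner quantization. -/
def weylWigner : StateSpace →L[ℂ] StateSpace := (2 : ℂ) • parity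

/-- Measurable functions of at most polynomial growth. -/
def IsSlowlyIncreasing (f : ℝ → ℂ) : Prop :=
  Measurable f ∧ ∃ (C : ℝ) (k : ℕ), ∀ x, ‖f x‖ ≤ C * (1 + |x|) ^ k

/-- Fourier transforms `f(x) = ∫ exp (i t x) g(t) dμ(t)` of finite complex measures `g μ`; for
instance constants, `exp (i t x)`, and Schwartz functions. -/
def IsFourierStieltjes (f : ℝ → ℂ) : Prop :=
  ∃ (μ : Measure ℝ) (g : ℝ → ℂ), IsFiniteMeasure μ ∧ Integrable g μ ∧
    ∀ x, f x = ∫ t, Complex.exp (((t * x : ℝ) : ℂ) * Complex.I) * g t ∂μ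

/-- `A_{f(q)} = f(Q)` and `A_{f(p)} = f(P)` for all slowly increasing `f`: the left-hand sides
are defined on all Schwartz vectors, and their closures are the right-hand sides. -/
def IsCanonicalOnQAndP (M : StateSpace →L[ℂ] StateSpace) : Prop :=
  ∀ f : ℝ → ℂ, IsSlowlyIncreasing f →
    ((quantize M fun z => f (position z)).domain = schwartzDomain ∧
      (quantize M fun z => f (position z)).closure = functionOfQ f) ∧
    ((quantize M fun z => f (momentum z)).domain = schwartzDomain ∧
      (quantize M fun z => f (momentum z)).closure = functionOfP f)

end WeylHeisenberg

end

noncomputable section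

namespace WeylHeisenberg

/-! By the Weyl commutation relation, `w ↦ ⟨φ, M(w) ψ⟩` is, up to constants, the Fourier transform
of `W(z) = ϖ(z) ⟨φ, D(z) ψ⟩` in a rotated and rescaled variable (`inner_displaced_eq_fourier`). A
symbol `f(q)` is constant in `p`, so integrating over `p` first is a Fourier inversion in one
variable, and it evaluates `W` on the line `Re z = 0`. There `Im z² = 2 Re z Im z` vanishes and the
weight is `m 0 = 1`. What remains is the one-dimensional transform of `⟨φ, D(i b) ψ⟩`, which is
`conj φ · ψ` up to scale (`fourier_ambiguity_im`). For `f(p)` the other axis plays this role. Only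
the value of `m` at `0` enters.

The analytic difficulty is that `m` is only continuous at `0`, while inversion needs continuity of a
partial transform of `W`. The weight is split as `m₁ + m₂`, with `m₁` bounded and `m₂ = 0` near `0`.
Where `m₂` is not zero, `|Re z| |Im z|` is bounded below, so the `m₂` part of `W` is at most `|Re
z|` times a constant multiple of `|Im z| |W|`. That function is integrable because multiplying `⟨φ,
D(z) ψ⟩` by a coordinate yields matrix elements between other Schwartz vectors, to which the
hypothesis on `ϖ` applies as well. A summand of this kind does not disturb inversion at `0`
(`integral_fourier_add_eq`). The Gaussian summable version uses the same splitting, with a bound of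
the heat kernel averages on the axes by a second moment of `W` (`exists_bound_heatKernel_smul`).

Equality of forms gives inclusion in `f(Q)` or `f(P)` by testing with Schwartz functions. A
Hahn–Banach argument shows that an operator contained in a multiplication operator and defined on
all Schwartz vectors has that operator as its closure (`topologicalClosure_eq_multiplicationGraph`).
If `m` is smooth of temperate growth, `W` and its transform are Schwartz functions and every
integral converges.

For non-uniqueness, the weights `exp (i λ Im z²)` give explicit operators: parity for `λ = 0`, a
dilation and its adjoint for `λ = ±3/2`. The mean of the last two has the weight `cos (3 Im z² /
2)`. It differs from Weyl–Wigner quantization because quantizing a character yields `ϖ(z) D(z)`,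
which reveals the weight. -/

/-! ### Displacement operators and the Weyl relation -/

theorem hasTemperateGrowth_cexp_ofReal_mul_I :
    (fun t : ℝ => Complex.exp ((t : ℂ) * Complex.I)).HasTemperateGrowth := by
  have h : ∀ n : ℕ, iteratedDeriv n (fun t : ℝ => Complex.exp ((t : ℂ) * Complex.I))
      = fun t : ℝ => Complex.I ^ n * Complex.exp ((t : ℂ) * Complex.I) := by
    intro n
    induction n with
    | zero => simp
    | succ n ih =>
      rw [iteratedDeriv_succ, ih]
      funext t
      have h1 : HasDerivAt (fun t : ℝ => Complex.I ^ n * Complex.exp ((t : ℂ) * Complex.I))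
          (Complex.I ^ n * (Complex.exp ((t : ℂ) * Complex.I) * (1 * Complex.I))) t :=
        (((Complex.ofRealCLM.hasDerivAt (x := t)).mul_const Complex.I).cexp).const_mul _
      rw [h1.deriv]
      ring
  refine ⟨?_, fun n => ⟨0, 1, fun x => ?_⟩⟩
  · exact ((Complex.ofRealCLM.contDiff).mul contDiff_const).cexp
  · rw [norm_iteratedFDeriv_eq_norm_iteratedDeriv, h]
    simp [Complex.norm_exp_ofReal_mul_I]

theorem hasTemperateGrowth_phase (p c : ℝ) :
    (fun x : ℝ => Complex.exp (((p * (x - c) : ℝ) : ℂ) * Complex.I)).HasTemperateGrowth :=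
  hasTemperateGrowth_cexp_ofReal_mul_I.comp (g := fun t : ℝ => Complex.exp ((t : ℂ) * Complex.I))
    (f := fun x : ℝ => p * (x - c)) (by fun_prop)

/-- The displacement of a Schwartz function. -/
def schwartzDisplacement (z : ℂ) (φ : 𝓢(ℝ, ℂ)) : 𝓢(ℝ, ℂ) :=
  smulLeftCLM ℂ
    (fun x : ℝ => Complex.exp (((momentum z * (x - position z / 2) : ℝ) : ℂ) * Complex.I))
    (compSubConstCLM ℂ (position z) φ)

theorem schwartzDisplacement_apply (z : ℂ) (φ : 𝓢(ℝ, ℂ)) (x : ℝ) :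
    schwartzDisplacement z φ x = displacementFun z φ x := by
  rw [schwartzDisplacement, smulLeftCLM_apply_apply (hasTemperateGrowth_phase _ _)]
  rfl

theorem coeFn_vec (φ : 𝓢(ℝ, ℂ)) : (vec φ : ℝ → ℂ) =ᵐ[volume] φ :=
  SchwartzMap.coeFn_toLp φ 2 volume

theorem coeFn_displacement (z : ℂ) (ψ : StateSpace) :
    (displacement z ψ : ℝ → ℂ) =ᵐ[volume] displacementFun z ψ :=
  MemLp.coeFn_toLp (memLp_displacementFun z (Lp.memLp ψ))

theorem displacement_vec (z : ℂ) (ψ : 𝓢(ℝ, ℂ)) :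
    displacement z (vec ψ) = vec (schwartzDisplacement z ψ) := by
  refine Lp.ext ?_
  filter_upwards [coeFn_displacement z (vec ψ), displacementFun_congr z (coeFn_vec ψ),
    coeFn_vec (schwartzDisplacement z ψ)] with x h1 h2 h3
  rw [h1, h2, h3, schwartzDisplacement_apply]

theorem inner_vec (φ ψ : 𝓢(ℝ, ℂ)) : ⟪vec φ, vec ψ⟫_ℂ = ∫ x : ℝ, star (φ x) * ψ x := by
  rw [L2.inner_def]
  refine integral_congr_ae ?_
  filter_upwards [coeFn_vec φ, coeFn_vec ψ] with x h1 h2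
  rw [h1, h2]
  simp [mul_comm]

theorem position_neg (z : ℂ) : position (-z) = -position z := by simp [position]

theorem momentum_neg (z : ℂ) : momentum (-z) = -momentum z := by simp [momentum]

theorem displacementFun_neg_displacementFun (z : ℂ) (φ : ℝ → ℂ) :
    displacementFun z (displacementFun (-z) φ) = φ := by
  funext x
  simp only [displacementFun, position_neg, momentum_neg]
  rw [← mul_assoc, ← Complex.exp_add]
  have : ((momentum z * (x - position z / 2) : ℝ) : ℂ) * Complex.I
      + ((-momentum z * (x - position z - -position z / 2) : ℝ) : ℂ) * Complex.I = 0 := by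
    push_cast; ring
  rw [this, Complex.exp_zero, one_mul]
  congr 1
  ring

theorem displacement_neg_displacement (z : ℂ) (ψ : StateSpace) :
    displacement z (displacement (-z) ψ) = ψ := by
  refine Lp.ext ?_
  filter_upwards [coeFn_displacement z (displacement (-z) ψ),
    displacementFun_congr z (coeFn_displacement (-z) ψ)] with x h1 h2
  rw [h1, h2, displacementFun_neg_displacementFun]

theorem adjoint_displacement (z : ℂ) (ψ : StateSpace) :
    (displacement z).toContinuousLinearMap.adjoint ψ = displacement (-z) ψ := by
  refine ext_inner_left ℂ fun φ => ?_
  rw [ContinuousLinearMap.adjoint_inner_right]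
  conv_lhs => rw [← displacement_neg_displacement z ψ]
  exact (displacement z).inner_map_map _ _

theorem inner_displaced (M : StateSpace →L[ℂ] StateSpace) (z : ℂ) (φ ψ : StateSpace) :
    ⟪φ, displaced M z ψ⟫_ℂ = ⟪displacement (-z) φ, M (displacement (-z) ψ)⟫_ℂ := by
  rw [← adjoint_displacement, ← adjoint_displacement, ContinuousLinearMap.adjoint_inner_left]
  rfl

/-- The Weyl relation: moving `D(z)` past `D(-w)` costs a phase given by the symplectic form. This
phase is the kernel that makes matrix elements of `M(w)` a Fourier transform in `w`. -/
theorem displacement_covariance (w z : ℂ) (φ ψ : StateSpace) :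
    ⟪displacement (-w) φ, displacement z (displacement (-w) ψ)⟫_ℂ
      = Complex.exp (((2 * (w * star z).im : ℝ) : ℂ) * Complex.I) * ⟪φ, displacement z ψ⟫_ℂ := by
  have h : displacement z (displacement (-w) ψ)
      = Complex.exp (((2 * (w * star z).im : ℝ) : ℂ) * Complex.I) •
        displacement (-w) (displacement z ψ) := by
    refine Lp.ext ?_
    filter_upwards [coeFn_displacement z (displacement (-w) ψ),
      displacementFun_congr z (coeFn_displacement (-w) ψ),
      coeFn_displacement (-w) (displacement z ψ),
      displacementFun_congr (-w) (coeFn_displacement z ψ),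
      Lp.coeFn_smul (Complex.exp (((2 * (w * star z).im : ℝ) : ℂ) * Complex.I))
        (displacement (-w) (displacement z ψ))] with x h1 h2 h3 h4 h5
    rw [h1, h2, h5, Pi.smul_apply, h3, h4]
    simp only [displacementFun, position_neg, momentum_neg, smul_eq_mul]
    rw [← mul_assoc, ← mul_assoc, ← mul_assoc, ← Complex.exp_add, ← Complex.exp_add,
      ← Complex.exp_add, show x - position z - -position w = x - -position w - position z by ring]
    congr 2
    rw [← add_mul, ← add_mul, ← add_mul, ← Complex.ofReal_add, ← Complex.ofReal_add,
      ← Complex.ofReal_add]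
    congr 2
    have h2 : √2 * √2 = (2 : ℝ) := Real.mul_self_sqrt (by norm_num)
    simp only [position, momentum, Complex.mul_im, Complex.star_def, Complex.conj_re,
      Complex.conj_im]
    linear_combination (w.im * z.re - w.re * z.im) * h2
  rw [h, inner_smul_right]
  congr 1
  exact (displacement (-w)).inner_map_map _ _

/-- The matrix elements of `M(w)` are the symplectic Fourier transform of `ϖ(z) ⟨φ, D(z) ψ⟩`. -/
theorem inner_displaced_eq_fourier {ϖ : ℂ → ℂ} {M : StateSpace →L[ℂ] StateSpace}
    (hM : IsOperatorOfWeight ϖ M) (φ ψ : 𝓢(ℝ, ℂ)) (w : ℂ) :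
    ⟪vec φ, displaced M w (vec ψ)⟫_ℂ = (Real.pi : ℂ)⁻¹ *
      𝓕 (fun z : ℂ => ϖ z * ⟪vec φ, displacement z (vec ψ)⟫_ℂ) ((Real.pi : ℂ)⁻¹ * Complex.I * w) := by
  rw [inner_displaced, displacement_vec, displacement_vec, (hM _ _).2, Real.fourier_eq']
  congr 1
  refine integral_congr_ae (Filter.Eventually.of_forall fun z => ?_)
  simp only [← displacement_vec, displacement_covariance, smul_eq_mul]
  rw [mul_left_comm]
  congr 4
  -- The factor `i` turns the symplectic form into the inner product: `-2π ⟨z, π⁻¹ i w⟩ = 2 Im (w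
  -- z̄)`.
  have hpi := Real.pi_ne_zero
  have : (Real.pi : ℂ)⁻¹ = ((Real.pi⁻¹ : ℝ) : ℂ) := by push_cast; rfl
  simp only [Complex.inner, Complex.mul_im, Complex.mul_re, Complex.star_def, Complex.conj_re,
    Complex.conj_im, this, Complex.ofReal_re, Complex.ofReal_im, Complex.I_re, Complex.I_im]
  field_simp
  ring

/-! ### Matrix elements of displacements are Schwartz functions on phase space -/

/-- The matrix element `⟨φ, D(z) ψ⟩` as an integral. -/
def ambiguity (φ ψ : 𝓢(ℝ, ℂ)) (z : ℂ) : ℂ := ∫ x : ℝ, star (φ x) * displacementFun z ψ x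

theorem inner_displacement_vec (φ ψ : 𝓢(ℝ, ℂ)) (z : ℂ) :
    ⟪vec φ, displacement z (vec ψ)⟫_ℂ = ambiguity φ ψ z := by
  rw [displacement_vec, inner_vec]
  simp only [schwartzDisplacement_apply, ambiguity]

theorem norm_ambiguity_le (φ ψ : 𝓢(ℝ, ℂ)) (z : ℂ) : ‖ambiguity φ ψ z‖ ≤ ‖vec φ‖ * ‖vec ψ‖ := by
  rw [← inner_displacement_vec, ← (displacement z).norm_map (vec ψ)]
  exact norm_inner_le_norm _ _

theorem integrable_star_mul (φ ψ : 𝓢(ℝ, ℂ)) : Integrable fun x : ℝ => star (φ x) * ψ x := by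
  refine ψ.integrable.bdd_mul (c := SchwartzMap.seminorm ℂ 0 0 φ)
    (φ.continuous.star).aestronglyMeasurable (Filter.Eventually.of_forall fun x => ?_)
  rw [norm_star]
  exact norm_le_seminorm ℂ φ x

theorem integrable_star_mul_displacementFun (φ ψ : 𝓢(ℝ, ℂ)) (z : ℂ) :
    Integrable fun x : ℝ => star (φ x) * displacementFun z ψ x := by
  simpa only [schwartzDisplacement_apply] using integrable_star_mul φ (schwartzDisplacement z ψ)

/-- The position operator on Schwartz functions. -/
def schwartzQ (φ : 𝓢(ℝ, ℂ)) : 𝓢(ℝ, ℂ) := smulLeftCLM ℂ (fun x : ℝ => (x : ℂ)) φ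

theorem schwartzQ_apply (φ : 𝓢(ℝ, ℂ)) (x : ℝ) : schwartzQ φ x = x * φ x := by
  rw [schwartzQ, smulLeftCLM_apply_apply Function.Complex.hasTemperateGrowth_ofReal]
  rfl

/-- The commutator `[Q, D(z)] = q D(z)`, from `q = x - (x - q)`. Multiplication by a coordinate thus
stays within matrix elements of Schwartz vectors, which gives decay here and moments of `ϖ(z) ⟨φ,
D(z) ψ⟩` later. -/
theorem position_mul_ambiguity (φ ψ : 𝓢(ℝ, ℂ)) (z : ℂ) :
    (position z : ℂ) * ambiguity φ ψ z
      = ambiguity (schwartzQ φ) ψ z - ambiguity φ (schwartzQ ψ) z := by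
  rw [ambiguity, ambiguity, ambiguity, ← integral_const_mul, ← integral_sub
    (integrable_star_mul_displacementFun _ _ _) (integrable_star_mul_displacementFun _ _ _)]
  refine integral_congr_ae (Filter.Eventually.of_forall fun x => ?_)
  simp only [displacementFun, schwartzQ_apply, star_mul', Complex.star_def, Complex.conj_ofReal]
  push_cast
  ring

theorem hasDerivAt_displacementFun (ψ : 𝓢(ℝ, ℂ)) (z : ℂ) (x : ℝ) :
    HasDerivAt (displacementFun z ψ) (Complex.I * momentum z * displacementFun z ψ x
      + displacementFun z (derivCLM ℂ ℂ ψ) x) x := by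
  have h1 : HasDerivAt (fun x : ℝ => (((momentum z * (x - position z / 2) : ℝ) : ℂ) * Complex.I))
      ((momentum z : ℂ) * Complex.I) x := by
    have := (((hasDerivAt_id x).sub_const (position z / 2)).const_mul (momentum z)).ofReal_comp
    simpa using this.mul_const Complex.I
  have h2 : HasDerivAt (fun x : ℝ => ψ (x - position z)) (deriv ψ (x - position z)) x := by
    exact (ψ.hasDerivAt (x - position z)).comp_sub_const x (position z)
  refine (h1.cexp.mul h2).congr_deriv ?_
  simp only [displacementFun, derivCLM_apply]
  ring

/-- The counterpart `[P, D(z)] = p D(z)`, by integration by parts. -/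
theorem momentum_mul_ambiguity (φ ψ : 𝓢(ℝ, ℂ)) (z : ℂ) :
    (momentum z : ℂ) * ambiguity φ ψ z
      = Complex.I * (ambiguity (derivCLM ℂ ℂ φ) ψ z + ambiguity φ (derivCLM ℂ ℂ ψ) z) := by
  have hu : ∀ x, HasDerivAt (fun x => star (φ x)) (star (derivCLM ℂ ℂ φ x)) x := fun x => by
    rw [derivCLM_apply]
    exact (φ.hasDerivAt x).star
  have i1 := integrable_star_mul_displacementFun φ ψ z
  have i2 := integrable_star_mul_displacementFun φ (derivCLM ℂ ℂ ψ) z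
  have e : (fun x => star (φ x) * (Complex.I * momentum z * displacementFun z ψ x
      + displacementFun z (derivCLM ℂ ℂ ψ) x))
      = fun x => Complex.I * momentum z * (star (φ x) * displacementFun z ψ x)
        + star (φ x) * displacementFun z (derivCLM ℂ ℂ ψ) x := by
    funext x; ring
  have key := integral_mul_deriv_eq_deriv_mul_of_integrable (fun x _ => hu x)
    (fun x _ => hasDerivAt_displacementFun ψ z x)
    (show Integrable (fun x => star (φ x) * (Complex.I * momentum z * displacementFun z ψ x
      + displacementFun z (derivCLM ℂ ℂ ψ) x)) by rw [e]; exact (i1.const_mul _).add i2)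
    (integrable_star_mul_displacementFun _ _ _) i1
  rw [e, integral_add (i1.const_mul _) i2, integral_const_mul] at key
  change _ * ambiguity φ ψ z + ambiguity φ _ z = -ambiguity _ ψ z at key
  linear_combination (-Complex.I) * key + (momentum z * ambiguity φ ψ z) * Complex.I_sq

/-- The coordinate `q` as a continuous linear form. -/
def positionL : ℂ →L[ℝ] ℝ := √2 • Complex.reCLM

/-- The coordinate `p` as a continuous linear form. -/
def momentumL : ℂ →L[ℝ] ℝ := √2 • Complex.imCLM

theorem hasFDerivAt_displacementFun (ψ : 𝓢(ℝ, ℂ)) (x : ℝ) (z : ℂ) :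
    HasFDerivAt (fun z => displacementFun z ψ x)
      (momentumL.smulRight (Complex.I * ((x - position z / 2 : ℝ) : ℂ) * displacementFun z ψ x)
      + positionL.smulRight (-(Complex.I * momentum z / 2) * displacementFun z ψ x
          - displacementFun z (derivCLM ℂ ℂ ψ) x)) z := by
  have hq : HasFDerivAt position positionL z := positionL.hasFDerivAt
  have hp : HasFDerivAt momentum momentumL z := momentumL.hasFDerivAt
  have h1 := (Complex.ofRealCLM.hasFDerivAt.comp z
    (hp.mul ((hq.mul_const (2⁻¹ : ℝ)).const_sub x))).mul_const Complex.I
  have h2 := (ψ.hasDerivAt (x - position z)).hasFDerivAt.comp z (hq.const_sub x)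
  refine (h1.cexp.mul h2).congr_fderiv (ContinuousLinearMap.ext fun v => ?_)
  simp [displacementFun, derivCLM_apply]
  ring_nf

/-- `x - q / 2` is the midpoint of `x`, which acts on `φ`, and `x - q`, which acts on `ψ`. -/
theorem ambiguity_add_half (φ ψ : 𝓢(ℝ, ℂ)) (z : ℂ) :
    ∫ x : ℝ, star (φ x) * (Complex.I * ((x - position z / 2 : ℝ) : ℂ) * displacementFun z ψ x)
      = Complex.I / 2 * (ambiguity (schwartzQ φ) ψ z + ambiguity φ (schwartzQ ψ) z) := by
  rw [ambiguity, ambiguity, ← integral_add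
    (integrable_star_mul_displacementFun _ _ _) (integrable_star_mul_displacementFun _ _ _),
    ← integral_const_mul]
  refine integral_congr_ae (Filter.Eventually.of_forall fun x => ?_)
  simp only [displacementFun, schwartzQ_apply, star_mul', Complex.star_def, Complex.conj_ofReal]
  push_cast
  ring

theorem norm_displacementFun_le (ψ : 𝓢(ℝ, ℂ)) (z : ℂ) (x : ℝ) :
    ‖displacementFun z ψ x‖ ≤ SchwartzMap.seminorm ℂ 0 0 ψ := by
  rw [displacementFun, norm_mul, Complex.norm_exp_ofReal_mul_I, one_mul]
  exact norm_le_seminorm ℂ ψ _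

theorem abs_position_le (z : ℂ) : |position z| ≤ 2 * ‖z‖ := by
  rw [position, abs_mul, abs_of_nonneg (Real.sqrt_nonneg 2)]
  have : √2 ≤ 2 := by rw [Real.sqrt_le_left (by norm_num)]; norm_num
  exact mul_le_mul this (Complex.abs_re_le_norm z) (abs_nonneg _) (by norm_num)

theorem abs_momentum_le (z : ℂ) : |momentum z| ≤ 2 * ‖z‖ := by
  rw [momentum, abs_mul, abs_of_nonneg (Real.sqrt_nonneg 2)]
  have : √2 ≤ 2 := by rw [Real.sqrt_le_left (by norm_num)]; norm_num
  exact mul_le_mul this (Complex.abs_im_le_norm z) (abs_nonneg _) (by norm_num)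

theorem continuous_displacementFun (ψ : 𝓢(ℝ, ℂ)) (z : ℂ) : Continuous (displacementFun z ψ) :=
  continuous_iff_continuousAt.2 fun x => (hasDerivAt_displacementFun ψ z x).continuousAt

theorem norm_positionL_le : ‖positionL‖ ≤ 2 :=
  ContinuousLinearMap.opNorm_le_bound _ (by norm_num) fun z => abs_position_le z

theorem norm_momentumL_le : ‖momentumL‖ ≤ 2 :=
  ContinuousLinearMap.opNorm_le_bound _ (by norm_num) fun z => abs_momentum_le z

/-- The derivative is again a combination of matrix elements of Schwartz vectors, without polynomial
coefficients. Smoothness and decay of all derivatives then follow by induction over all pairs `φ`,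
`ψ`. -/
theorem hasFDerivAt_ambiguity (φ ψ : 𝓢(ℝ, ℂ)) (z : ℂ) :
    HasFDerivAt (ambiguity φ ψ)
      (momentumL.smulRight
        (Complex.I / 2 * (ambiguity (schwartzQ φ) ψ z + ambiguity φ (schwartzQ ψ) z))
      + positionL.smulRight
        (1 / 2 * (ambiguity (derivCLM ℂ ℂ φ) ψ z - ambiguity φ (derivCLM ℂ ℂ ψ) z))) z := by
  set A : ℂ → ℝ → ℂ := fun z x =>
    Complex.I * ((x - position z / 2 : ℝ) : ℂ) * displacementFun z ψ x with hA
  set B : ℂ → ℝ → ℂ := fun z x => -(Complex.I * momentum z / 2) * displacementFun z ψ x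
    - displacementFun z (derivCLM ℂ ℂ ψ) x with hB
  have cA : ∀ z, Continuous (A z) := fun z => by
    have := continuous_displacementFun ψ z
    fun_prop
  have cB : ∀ z, Continuous (B z) := fun z => by
    have := continuous_displacementFun ψ z
    have := continuous_displacementFun (derivCLM ℂ ℂ ψ) z
    fun_prop
  set K := SchwartzMap.seminorm ℂ 0 0 ψ
  set K' := SchwartzMap.seminorm ℂ 0 0 (derivCLM ℂ ℂ ψ)
  have hK : 0 ≤ K := apply_nonneg _ _
  have hK' : 0 ≤ K' := apply_nonneg _ _
  -- A bound for the norm on the unit ball about `z`, where the derivative is dominated.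
  set R := ‖z‖ + 1
  have bA : ∀ y ∈ Metric.ball z 1, ∀ x, ‖A y x‖ ≤ (|x| + R) * K := by
    intro y hy x
    have hy' : ‖y‖ ≤ R := by
      have h1 : ‖y - z‖ < 1 := by simpa [dist_eq_norm] using hy
      have h2 := norm_add_le z (y - z)
      rw [add_sub_cancel] at h2
      linarith
    rw [hA]
    simp only [norm_mul, Complex.norm_I, one_mul, Complex.norm_real, Real.norm_eq_abs]
    refine mul_le_mul ?_ (norm_displacementFun_le ψ y x) (norm_nonneg _)
      (by positivity)
    have h3 := abs_sub x (position y / 2)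
    rw [abs_div, abs_two] at h3
    have := abs_position_le y
    linarith
  have bB : ∀ y ∈ Metric.ball z 1, ∀ x, ‖B y x‖ ≤ R * K + K' := by
    intro y hy x
    have hy' : ‖y‖ ≤ R := by
      have h1 : ‖y - z‖ < 1 := by simpa [dist_eq_norm] using hy
      have h2 := norm_add_le z (y - z)
      rw [add_sub_cancel] at h2
      linarith
    refine (norm_sub_le _ _).trans (add_le_add ?_ (norm_displacementFun_le _ y x))
    rw [norm_mul]
    refine mul_le_mul ?_ (norm_displacementFun_le ψ y x) (norm_nonneg _) (by positivity)
    have := abs_momentum_le y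
    simp
    linarith
  have cφ : Continuous fun x => star (φ x) := φ.continuous.star
  have iA : Integrable fun x => star (φ x) * A z x := by
    have : (fun x => star (φ x) * A z x) = fun x => Complex.I / 2 *
        (star (schwartzQ φ x) * displacementFun z ψ x
          + star (φ x) * displacementFun z (schwartzQ ψ) x) := by
      funext x
      simp only [hA, displacementFun, schwartzQ_apply, star_mul', Complex.star_def,
        Complex.conj_ofReal]
      push_cast
      ring
    rw [this]
    exact ((integrable_star_mul_displacementFun _ _ _).add
      (integrable_star_mul_displacementFun _ _ _)).const_mul _
  have eB : (fun x => star (φ x) * B z x) = fun x =>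
      -(Complex.I * momentum z / 2) * (star (φ x) * displacementFun z ψ x)
        - star (φ x) * displacementFun z (derivCLM ℂ ℂ ψ) x := by
    funext x
    simp only [hB]
    ring
  have iB : Integrable fun x => star (φ x) * B z x := by
    rw [eB]
    exact ((integrable_star_mul_displacementFun _ _ _).const_mul _).sub
      (integrable_star_mul_displacementFun _ _ _)
  -- The coefficient `p` left by the phase is removed with `momentum_mul_ambiguity`, which leaves
  -- the antisymmetric combination.
  have hB' : ∫ x, star (φ x) * B z x
      = 1 / 2 * (ambiguity (derivCLM ℂ ℂ φ) ψ z - ambiguity φ (derivCLM ℂ ℂ ψ) z) := by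
    rw [eB, integral_sub ((integrable_star_mul_displacementFun _ _ _).const_mul _)
      (integrable_star_mul_displacementFun _ _ _), integral_const_mul]
    have := momentum_mul_ambiguity φ ψ z
    simp only [ambiguity] at this ⊢
    linear_combination (-Complex.I / 2) * this - (1 / 2 : ℂ) *
      ((∫ x : ℝ, star (derivCLM ℂ ℂ φ x) * displacementFun z ψ x) +
        ∫ x : ℝ, star (φ x) * displacementFun z (derivCLM ℂ ℂ ψ) x) * Complex.I_sq
  have key := hasFDerivAt_integral_of_dominated_of_fderiv_le (μ := volume)
    (F := fun z x => star (φ x) * displacementFun z ψ x)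
    (F' := fun z x => momentumL.smulRight (star (φ x) * A z x)
      + positionL.smulRight (star (φ x) * B z x))
    (bound := fun x => 2 * (‖φ x‖ * ((|x| + R) * K)) + 2 * (‖φ x‖ * (R * K + K'))) (x₀ := z)
    (Metric.ball_mem_nhds z one_pos)
    (Filter.Eventually.of_forall fun y =>
      (integrable_star_mul_displacementFun φ ψ y).aestronglyMeasurable)
    (integrable_star_mul_displacementFun φ ψ z)
    ?_ ?_ ?_ ?_
  · refine key.congr_fderiv ?_
    rw [integral_add]
    · have e1 := (ContinuousLinearMap.smulRightL ℝ ℂ ℂ momentumL).integral_comp_comm iA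
      have e2 := (ContinuousLinearMap.smulRightL ℝ ℂ ℂ positionL).integral_comp_comm iB
      refine (congrArg₂ (· + ·) e1 e2).trans ?_
      rw [hB', ambiguity_add_half]
      rfl
    · exact (ContinuousLinearMap.smulRightL ℝ ℂ ℂ momentumL).integrable_comp iA
    · exact (ContinuousLinearMap.smulRightL ℝ ℂ ℂ positionL).integrable_comp iB
  · refine Continuous.aestronglyMeasurable ?_
    have h1 := (ContinuousLinearMap.smulRightL ℝ ℂ ℂ momentumL).continuous.comp (cφ.mul (cA z))
    have h2 := (ContinuousLinearMap.smulRightL ℝ ℂ ℂ positionL).continuous.comp (cφ.mul (cB z))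
    exact h1.add h2
  · refine Filter.Eventually.of_forall fun x y hy => ?_
    refine (norm_add_le _ _).trans (add_le_add ?_ ?_)
    · rw [ContinuousLinearMap.norm_smulRight_apply, norm_mul, norm_star]
      gcongr
      · exact norm_momentumL_le
      · exact bA y hy x
    · rw [ContinuousLinearMap.norm_smulRight_apply, norm_mul, norm_star]
      gcongr
      · exact norm_positionL_le
      · exact bB y hy x
  · have h1 : Integrable fun x : ℝ => |x| * ‖φ x‖ := by
      simpa using φ.integrable_pow_mul volume 1
    have h2 : Integrable fun x : ℝ => ‖φ x‖ := φ.integrable.norm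
    have : (fun x => 2 * (‖φ x‖ * ((|x| + R) * K)) + 2 * (‖φ x‖ * (R * K + K')))
        = fun x => 2 * K * (|x| * ‖φ x‖) + (2 * R * K + 2 * (R * K + K')) * ‖φ x‖ := by
      funext x; ring
    rw [this]
    exact (h1.const_mul _).add (h2.const_mul _)
  · refine Filter.Eventually.of_forall fun x y _ => ?_
    refine ((hasFDerivAt_displacementFun ψ x y).const_mul (star (φ x))).congr_fderiv
      (ContinuousLinearMap.ext fun v => ?_)
    simp [hA, hB]
    ring

theorem norm_le_abs_position_add_abs_momentum (z : ℂ) : ‖z‖ ≤ |position z| + |momentum z| := by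
  have h1 : 1 ≤ √2 := Real.one_le_sqrt.2 (by norm_num)
  rw [position, momentum, abs_mul, abs_mul, abs_of_nonneg (Real.sqrt_nonneg 2), ← mul_add]
  have := Complex.norm_le_abs_re_add_abs_im z
  nlinarith [abs_nonneg z.re, abs_nonneg z.im]

/-- Each factor `‖z‖ ≤ |q| + |p|` is absorbed by changing the Schwartz vectors, so the induction
needs all pairs at once. -/
theorem exists_bound_pow_mul_ambiguity (k : ℕ) (φ ψ : 𝓢(ℝ, ℂ)) :
    ∃ C, ∀ z, ‖z‖ ^ k * ‖ambiguity φ ψ z‖ ≤ C := by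
  induction k generalizing φ ψ with
  | zero => exact ⟨‖vec φ‖ * ‖vec ψ‖, fun z => by simpa using norm_ambiguity_le φ ψ z⟩
  | succ k ih =>
    obtain ⟨C1, h1⟩ := ih (schwartzQ φ) ψ
    obtain ⟨C2, h2⟩ := ih φ (schwartzQ ψ)
    obtain ⟨C3, h3⟩ := ih (derivCLM ℂ ℂ φ) ψ
    obtain ⟨C4, h4⟩ := ih φ (derivCLM ℂ ℂ ψ)
    refine ⟨C1 + C2 + (C3 + C4), fun z => ?_⟩
    have e1 : |position z| * ‖ambiguity φ ψ z‖
        ≤ ‖ambiguity (schwartzQ φ) ψ z‖ + ‖ambiguity φ (schwartzQ ψ) z‖ := by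
      rw [← Real.norm_eq_abs, ← Complex.norm_real, ← norm_mul, position_mul_ambiguity]
      exact norm_sub_le _ _
    have e2 : |momentum z| * ‖ambiguity φ ψ z‖
        ≤ ‖ambiguity (derivCLM ℂ ℂ φ) ψ z‖ + ‖ambiguity φ (derivCLM ℂ ℂ ψ) z‖ := by
      rw [← Real.norm_eq_abs, ← Complex.norm_real, ← norm_mul, momentum_mul_ambiguity, norm_mul,
        Complex.norm_I, one_mul]
      exact norm_add_le _ _
    calc ‖z‖ ^ (k + 1) * ‖ambiguity φ ψ z‖ = ‖z‖ ^ k * (‖z‖ * ‖ambiguity φ ψ z‖) := by ring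
      _ ≤ ‖z‖ ^ k * ((|position z| + |momentum z|) * ‖ambiguity φ ψ z‖) := by
        gcongr; exact norm_le_abs_position_add_abs_momentum z
      _ ≤ ‖z‖ ^ k * (‖ambiguity (schwartzQ φ) ψ z‖ + ‖ambiguity φ (schwartzQ ψ) z‖
          + (‖ambiguity (derivCLM ℂ ℂ φ) ψ z‖ + ‖ambiguity φ (derivCLM ℂ ℂ ψ) z‖)) := by
        rw [add_mul]; gcongr
      _ ≤ _ := by
        rw [mul_add, mul_add, mul_add]
        exact add_le_add (add_le_add (h1 z) (h2 z)) (add_le_add (h3 z) (h4 z))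

theorem fderiv_ambiguity (φ ψ : 𝓢(ℝ, ℂ)) :
    fderiv ℝ (ambiguity φ ψ) = fun z =>
      (ContinuousLinearMap.smulRightL ℝ ℂ ℂ momentumL
        (Complex.I / 2 * (ambiguity (schwartzQ φ) ψ z + ambiguity φ (schwartzQ ψ) z))
      + ContinuousLinearMap.smulRightL ℝ ℂ ℂ positionL
        (1 / 2 * (ambiguity (derivCLM ℂ ℂ φ) ψ z - ambiguity φ (derivCLM ℂ ℂ ψ) z))) :=
  funext fun z => (hasFDerivAt_ambiguity φ ψ z).fderiv

theorem contDiff_ambiguity (n : ℕ) (φ ψ : 𝓢(ℝ, ℂ)) : ContDiff ℝ n (ambiguity φ ψ) := by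
  induction n generalizing φ ψ with
  | zero =>
    exact contDiff_zero.2 (continuous_iff_continuousAt.2 fun z =>
      (hasFDerivAt_ambiguity φ ψ z).continuousAt)
  | succ n ih =>
    rw [Nat.cast_succ]
    refine contDiff_succ_iff_fderiv.2 ⟨fun z => (hasFDerivAt_ambiguity φ ψ z).differentiableAt,
      by simp, ?_⟩
    rw [fderiv_ambiguity]
    have h1 := contDiff_const.mul ((ih (schwartzQ φ) ψ).add (ih φ (schwartzQ ψ)))
      (f := fun _ => Complex.I / 2)
    have h2 := contDiff_const.mul ((ih (derivCLM ℂ ℂ φ) ψ).sub (ih φ (derivCLM ℂ ℂ ψ)))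
      (f := fun _ => (1 / 2 : ℂ))
    exact ((ContinuousLinearMap.contDiff _).comp h1).add ((ContinuousLinearMap.contDiff _).comp h2)

theorem exists_bound_iteratedFDeriv_ambiguity (n k : ℕ) (φ ψ : 𝓢(ℝ, ℂ)) :
    ∃ C, ∀ z, ‖z‖ ^ k * ‖iteratedFDeriv ℝ n (ambiguity φ ψ) z‖ ≤ C := by
  induction n generalizing φ ψ with
  | zero =>
    obtain ⟨C, h⟩ := exists_bound_pow_mul_ambiguity k φ ψ
    exact ⟨C, fun z => by rw [norm_iteratedFDeriv_zero]; exact h z⟩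
  | succ n ih =>
    obtain ⟨C1, h1⟩ := ih (schwartzQ φ) ψ
    obtain ⟨C2, h2⟩ := ih φ (schwartzQ ψ)
    obtain ⟨C3, h3⟩ := ih (derivCLM ℂ ℂ φ) ψ
    obtain ⟨C4, h4⟩ := ih φ (derivCLM ℂ ℂ ψ)
    set L1 : ℂ →L[ℝ] (ℂ →L[ℝ] ℂ) := (ContinuousLinearMap.smulRightL ℝ ℂ ℂ momentumL).comp
      (ContinuousLinearMap.mul ℝ ℂ (Complex.I / 2)) with hL1
    set L2 : ℂ →L[ℝ] (ℂ →L[ℝ] ℂ) := (ContinuousLinearMap.smulRightL ℝ ℂ ℂ positionL).comp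
      (ContinuousLinearMap.mul ℝ ℂ (1 / 2)) with hL2
    have e : fderiv ℝ (ambiguity φ ψ) =
        (L1 ∘ ambiguity (schwartzQ φ) ψ + L1 ∘ ambiguity φ (schwartzQ ψ))
        + (L2 ∘ ambiguity (derivCLM ℂ ℂ φ) ψ - L2 ∘ ambiguity φ (derivCLM ℂ ℂ ψ)) := by
      rw [fderiv_ambiguity]
      funext z
      simp only [hL1, hL2, Pi.add_apply, Pi.sub_apply, Function.comp_apply,
        ContinuousLinearMap.comp_apply, ContinuousLinearMap.mul_apply', mul_add, mul_sub, map_add,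
        map_sub]
    have c : ∀ (L : ℂ →L[ℝ] (ℂ →L[ℝ] ℂ)) (φ ψ : 𝓢(ℝ, ℂ)), ContDiff ℝ n (L ∘ ambiguity φ ψ) :=
      fun L φ ψ => L.contDiff.comp (contDiff_ambiguity n φ ψ)
    have b : ∀ (L : ℂ →L[ℝ] (ℂ →L[ℝ] ℂ)) (φ ψ : 𝓢(ℝ, ℂ)) (C : ℝ),
        (∀ z, ‖z‖ ^ k * ‖iteratedFDeriv ℝ n (ambiguity φ ψ) z‖ ≤ C) → ∀ z,
        ‖z‖ ^ k * ‖iteratedFDeriv ℝ n (L ∘ ambiguity φ ψ) z‖ ≤ ‖L‖ * C := by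
      intro L φ ψ C h z
      have := L.norm_iteratedFDeriv_comp_left (contDiff_ambiguity n φ ψ).contDiffAt le_rfl (x := z)
      calc _ ≤ ‖z‖ ^ k * (‖L‖ * ‖iteratedFDeriv ℝ n (ambiguity φ ψ) z‖) := by gcongr
        _ = ‖L‖ * (‖z‖ ^ k * ‖iteratedFDeriv ℝ n (ambiguity φ ψ) z‖) := by ring
        _ ≤ _ := by gcongr; exact h z
    refine ⟨(‖L1‖ * C1 + ‖L1‖ * C2) + (‖L2‖ * C3 + ‖L2‖ * C4), fun z => ?_⟩
    rw [← norm_iteratedFDeriv_fderiv, e, iteratedFDeriv_add_apply, iteratedFDeriv_add_apply,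
      iteratedFDeriv_sub_apply]
    · calc _ ≤ ‖z‖ ^ k * ((_ + _) + (_ + _)) := by
            gcongr
            exact (norm_add_le _ _).trans (add_le_add (norm_add_le _ _) (norm_sub_le _ _))
        _ ≤ _ := by
          rw [mul_add, mul_add, mul_add]
          exact add_le_add (add_le_add (b L1 _ _ _ h1 z) (b L1 _ _ _ h2 z))
            (add_le_add (b L2 _ _ _ h3 z) (b L2 _ _ _ h4 z))
    all_goals first
      | exact (c _ _ _).contDiffAt
      | exact ((c _ _ _).add (c _ _ _)).contDiffAt
      | exact ((c _ _ _).sub (c _ _ _)).contDiffAt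

/-- The matrix element `⟨φ, D(z) ψ⟩` as a Schwartz function on phase space. -/
def schwartzAmbiguity (φ ψ : 𝓢(ℝ, ℂ)) : 𝓢(ℂ, ℂ) where
  toFun := ambiguity φ ψ
  smooth' := contDiff_infty.2 fun n => contDiff_ambiguity n φ ψ
  decay' k n := exists_bound_iteratedFDeriv_ambiguity n k φ ψ

theorem schwartzAmbiguity_apply (φ ψ : 𝓢(ℝ, ℂ)) (z : ℂ) :
    schwartzAmbiguity φ ψ z = ambiguity φ ψ z := rfl

/-! ### Partial Fourier transforms of the matrix elements -/

/-- The pointwise complex conjugate of a Schwartz function. -/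
def schwartzConj (φ : 𝓢(ℝ, ℂ)) : 𝓢(ℝ, ℂ) :=
  φ.postcompCLM (𝕜 := ℝ) (Complex.conjCLE : ℂ →L[ℝ] ℂ)

/-- The product `conj φ · ψ` of Schwartz functions. -/
def conjMul (φ ψ : 𝓢(ℝ, ℂ)) : 𝓢(ℝ, ℂ) :=
  pairing (ContinuousLinearMap.mul ℂ ℂ) (schwartzConj φ) ψ

theorem conjMul_apply (φ ψ : 𝓢(ℝ, ℂ)) (x : ℝ) : conjMul φ ψ x = star (φ x) * ψ x := rfl

/-- Shifting the integration variable by `q / 2 = a / √2` makes the integrand symmetric and reduces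
the phase to `exp (i p u)`. -/
theorem ambiguity_eq_fourierInv (φ ψ : 𝓢(ℝ, ℂ)) (a b : ℝ) :
    ambiguity φ ψ ⟨a, b⟩ = 𝓕⁻ (conjMul (compSubConstCLM ℂ (-(a / √2)) φ)
      (compSubConstCLM ℂ (a / √2) ψ)) (b / (√2 * Real.pi)) := by
  rw [fourierInv_coe, Real.fourierInv_eq', ambiguity, ← integral_add_right_eq_self _ (a / √2)]
  refine integral_congr_ae (Filter.Eventually.of_forall fun u => ?_)
  have h2 : √2 * √2 = (2 : ℝ) := Real.mul_self_sqrt (by norm_num)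
  have h0 : √2 ≠ 0 := by positivity
  have e : √2 * a = a / √2 + a / √2 := by
    field_simp
    linear_combination a * h2
  have hpi := Real.pi_ne_zero
  simp only [displacementFun, conjMul_apply, compSubConstCLM_apply, smul_eq_mul, position,
    momentum, e]
  rw [mul_left_comm, show u + a / √2 - (a / √2 + a / √2) = u - a / √2 by ring,
    show u - -(a / √2) = u + a / √2 by ring]
  congr 4
  have : inner ℝ u (b / (√2 * Real.pi)) = u * (b / (√2 * Real.pi)) := by
    simp [mul_comm]
  rw [this]
  field_simp
  linear_combination (2 * b * u) * h2

/-- Fourier inversion undoes `ambiguity_eq_fourierInv`. The case `a = 0`, where both arguments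
coincide, is the source of `f(Q)`; general `a` serves the exponential weights. -/
theorem fourier_ambiguity_im (φ ψ : 𝓢(ℝ, ℂ)) (a s : ℝ) :
    𝓕 (fun b : ℝ => ambiguity φ ψ ⟨a, b⟩) s = ((√2 * Real.pi : ℝ) : ℂ) *
      (star (φ (√2 * Real.pi * s + a / √2)) * ψ (√2 * Real.pi * s - a / √2)) := by
  set g := conjMul (compSubConstCLM ℂ (-(a / √2)) φ) (compSubConstCLM ℂ (a / √2) ψ) with hg
  have hc : 0 < √2 * Real.pi := by positivity
  have h1 : ∀ b : ℝ, Complex.exp (↑(-2 * Real.pi * (inner ℝ b s)) * Complex.I) •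
      ambiguity φ ψ ⟨a, b⟩ = (fun y : ℝ => Complex.exp (↑(-2 * Real.pi *
        (inner ℝ y (√2 * Real.pi * s))) * Complex.I) • 𝓕⁻ g y) (b / (√2 * Real.pi)) := by
    intro b
    simp only [ambiguity_eq_fourierInv, ← hg]
    congr 4
    simp
    field_simp
  rw [Real.fourier_eq']
  refine (integral_congr_ae (Filter.Eventually.of_forall h1)).trans ?_
  refine (Measure.integral_comp_div (fun y : ℝ => Complex.exp (↑(-2 * Real.pi *
    (inner ℝ y (√2 * Real.pi * s))) * Complex.I) • 𝓕⁻ g y) (√2 * Real.pi)).trans ?_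
  rw [← Real.fourier_eq', ← fourier_coe, FourierInvPair.fourier_fourierInv_eq, abs_of_pos hc, hg,
    conjMul_apply, compSubConstCLM_apply, compSubConstCLM_apply, Complex.real_smul, sub_neg_eq_add]

theorem fourier_compSubConstCLM (ψ : 𝓢(ℝ, ℂ)) (t ξ : ℝ) :
    𝓕 (compSubConstCLM ℂ t ψ) ξ
      = Complex.exp (↑(-2 * Real.pi * (inner ℝ ξ t)) * Complex.I) * 𝓕 ψ ξ := by
  rw [fourier_coe, fourier_coe, Real.fourier_eq', Real.fourier_eq', ← integral_const_mul,
    ← integral_add_right_eq_self _ t]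
  refine integral_congr_ae (Filter.Eventually.of_forall fun u => ?_)
  simp only [compSubConstCLM_apply, add_sub_cancel_right, smul_eq_mul, ← mul_assoc,
    ← Complex.exp_add]
  congr 2
  simp
  ring

/-- On the real axis `D(z)` is a translation, which Plancherel turns into a character multiplying
`conj (𝓕 φ) · 𝓕 ψ`. -/
theorem ambiguity_ofReal (φ ψ : 𝓢(ℝ, ℂ)) (a : ℝ) :
    ambiguity φ ψ ⟨a, 0⟩ = 𝓕 (conjMul (𝓕 φ) (𝓕 ψ)) (√2 * a) := by
  have h1 : ambiguity φ ψ ⟨a, 0⟩ = ∫ x, inner ℂ (φ x) (compSubConstCLM ℂ (√2 * a) ψ x) := by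
    refine integral_congr_ae (Filter.Eventually.of_forall fun u => ?_)
    simp [displacementFun, position, momentum, mul_comm]
  rw [h1, ← integral_inner_fourier_fourier, fourier_coe (conjMul _ _), Real.fourier_eq']
  refine integral_congr_ae (Filter.Eventually.of_forall fun u => ?_)
  simp only [fourier_compSubConstCLM, conjMul_apply, smul_eq_mul, RCLike.inner_apply,
    Complex.star_def]
  ring

theorem fourier_ambiguity_re (φ ψ : 𝓢(ℝ, ℂ)) (s : ℝ) :
    𝓕 (fun a : ℝ => ambiguity φ ψ ⟨a, 0⟩) s = (((√2)⁻¹ : ℝ) : ℂ) *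
      (star (𝓕 φ (-(s / √2))) * 𝓕 ψ (-(s / √2))) := by
  set h := conjMul (𝓕 φ) (𝓕 ψ) with hh
  have hc : 0 < √2 := by positivity
  have h1 : ∀ b : ℝ, Complex.exp (↑(-2 * Real.pi * (inner ℝ b s)) * Complex.I) •
      ambiguity φ ψ ⟨b, 0⟩ = (fun y : ℝ => Complex.exp (↑(2 * Real.pi *
        (inner ℝ y (-(s / √2)))) * Complex.I) • 𝓕 h y) (√2 * b) := by
    intro b
    simp only [ambiguity_ofReal, ← hh]
    congr 4
    simp
    field_simp
  rw [Real.fourier_eq']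
  refine (integral_congr_ae (Filter.Eventually.of_forall h1)).trans ?_
  refine (Measure.integral_comp_mul_left (fun y : ℝ => Complex.exp (↑(2 * Real.pi *
    (inner ℝ y (-(s / √2)))) * Complex.I) • 𝓕 h y) √2).trans ?_
  rw [← Real.fourierInv_eq', ← fourierInv_coe,
    FourierPair.fourierInv_fourier_eq, abs_of_pos (inv_pos.2 hc), hh, conjMul_apply,
    Complex.real_smul]

/-! ### Fourier inversion on a line -/

/-- Used with `y = π c ‖w‖²`, this yields bounds of heat kernels that are uniform in the parameter
`c`. -/
theorem mul_exp_neg_pi_mul_le_one {y : ℝ} : y * Real.exp (-(Real.pi * y)) ≤ 1 := by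
  rcases le_or_gt y 0 with hy | hy
  · exact (mul_nonpos_of_nonpos_of_nonneg hy (Real.exp_nonneg _)).trans zero_le_one
  · rw [Real.exp_neg, ← div_eq_mul_inv, div_le_one (Real.exp_pos _)]
    have h1 := Real.add_one_le_exp (Real.pi * y)
    have h2 := Real.pi_gt_three
    nlinarith

/-- Fourier inversion at `0`, in integrated form, for an integrable function that is continuous
at `0` up to a summand that is small at `0` on average only. -/
theorem integral_fourier_add_eq {G₁ G₂ : ℝ → ℂ} {h : ℝ → ℝ} (i₁ : Integrable G₁)
    (i₂ : Integrable G₂) (hc : ContinuousAt G₁ 0) (ih : Integrable h)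
    (hG : ∀ᵐ a, ‖G₂ a‖ ≤ |a| * h a) (hF : Integrable (𝓕 (G₁ + G₂))) :
    ∫ s, 𝓕 (G₁ + G₂) s = G₁ 0 := by
  have e0 : 𝓕⁻ (𝓕 (G₁ + G₂)) 0 = ∫ s, 𝓕 (G₁ + G₂) s := by
    rw [Real.fourierInv_eq']
    simp
  set K : ℝ → ℝ → ℂ := fun c w =>
    ((Real.pi * c : ℂ) ^ (Module.finrank ℝ ℝ / 2 : ℂ) * Complex.exp (-Real.pi ^ 2 * c * ‖0 - w‖ ^ 2))
    with hK
  -- Gaussian averages of `G₁ + G₂` tend to `𝓕⁻ (𝓕 (G₁ + G₂)) 0` since the transform is integrable;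
  -- those of `G₁` tend to `G₁ 0` by continuity. It remains to see that those of `G₂` tend to `0`.
  have t := Real.tendsto_integral_gaussian_smul (i₁.add i₂) hF 0
  have t1 := Real.tendsto_integral_gaussian_smul' i₁ hc
  have nK : ∀ c, 0 < c → ∀ w, ‖K c w‖
      = (Real.pi * c) ^ (1 / 2 : ℝ) * Real.exp (-(Real.pi * (Real.pi * c * w ^ 2))) := by
    intro c hc w
    simp only [hK, norm_mul]
    congr 1
    · rw [← Complex.ofReal_mul, Complex.norm_cpow_eq_rpow_re_of_pos (by positivity)]
      simp
    · rw [Complex.norm_exp]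
      congr 1
      have : (-(Real.pi : ℂ) ^ 2 * c * ((‖0 - w‖ : ℝ) : ℂ) ^ 2)
          = ((-(Real.pi * (Real.pi * c * w ^ 2)) : ℝ) : ℂ) := by
        rw [zero_sub, norm_neg, Real.norm_eq_abs, ← Complex.ofReal_pow |w| 2, sq_abs]
        push_cast
        ring
      rw [this, Complex.ofReal_re]
  -- With `y = π c w²` this is `√y exp (-π y) ≤ 1`. Together with `‖G₂ a‖ ≤ |a| h a` it gives the
  -- majorant `|h|`, independent of `c`.
  have bK : ∀ c, 0 < c → ∀ w, ‖K c w‖ * |w| ≤ 1 := by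
    intro c hc w
    have h0 : 0 ≤ Real.pi * c * w ^ 2 := by positivity
    have e : (Real.pi * c) ^ (1 / 2 : ℝ) * |w| = √(Real.pi * c * w ^ 2) := by
      rw [← Real.sqrt_eq_rpow, Real.sqrt_mul (by positivity) (w ^ 2), Real.sqrt_sq_eq_abs]
    rw [nK c hc, mul_right_comm, e]
    have h1 : Real.exp (-(Real.pi * (Real.pi * c * w ^ 2))) ≤ 1 :=
      Real.exp_le_one_iff.2 (by have := Real.pi_pos; nlinarith)
    have h2 := @mul_exp_neg_pi_mul_le_one (Real.pi * c * w ^ 2)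
    have h3 := Real.exp_pos (-(Real.pi * (Real.pi * c * w ^ 2)))
    rcases le_or_gt (Real.pi * c * w ^ 2) 1 with h4 | h4
    · exact mul_le_one₀ (Real.sqrt_le_one.2 h4) h3.le h1
    · refine le_trans (mul_le_mul_of_nonneg_right ?_ h3.le) h2
      rw [Real.sqrt_le_left h0]
      nlinarith
  have t2 : Filter.Tendsto (fun c : ℝ => ∫ w, K c w • G₂ w) Filter.atTop (nhds (∫ _ : ℝ, (0 : ℂ))) := by
    refine tendsto_integral_filter_of_dominated_convergence (fun a => ‖h a‖) ?_ ?_ ih.norm ?_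
    · refine Filter.Eventually.of_forall fun c =>
        AEStronglyMeasurable.smul (f := K c) ?_ i₂.1
      exact Continuous.aestronglyMeasurable (by fun_prop)
    · filter_upwards [Filter.Ioi_mem_atTop 0] with c (hc : 0 < c)
      filter_upwards [hG] with a ha
      rw [norm_smul]
      have hh : |a| * h a ≤ |a| * ‖h a‖ :=
        mul_le_mul_of_nonneg_left (le_abs_self _) (abs_nonneg a)
      calc ‖K c a‖ * ‖G₂ a‖ ≤ ‖K c a‖ * (|a| * ‖h a‖) := by
            gcongr; exact ha.trans hh
        _ = (‖K c a‖ * |a|) * ‖h a‖ := by ring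
        _ ≤ 1 * ‖h a‖ := by gcongr; exact bK c hc a
        _ = _ := one_mul _
    -- Away from the null set `{0}` the kernel tends to `0` pointwise as `c → ∞`.
    · have hne : ∀ᵐ a : ℝ, a ≠ 0 := by simp [ae_iff]
      filter_upwards [hne] with a ha
      have h1 : Filter.Tendsto (fun c : ℝ => ‖K c a‖) Filter.atTop (nhds 0) := by
        have h2 := tendsto_rpow_mul_exp_neg_mul_atTop_nhds_zero (1 / 2) (Real.pi * a ^ 2)
          (by positivity)
        have h3 := h2.comp (Filter.tendsto_id.const_mul_atTop Real.pi_pos)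
        refine h3.congr' ?_
        filter_upwards [Filter.Ioi_mem_atTop 0] with c (hc : 0 < c)
        rw [nK c hc]
        simp only [Function.comp_apply, id]
        congr 2
        ring
      have h4 := (tendsto_zero_iff_norm_tendsto_zero.2 h1).smul_const (G₂ a)
      rwa [zero_smul] at h4
  rw [integral_zero] at t2
  have t3 : Filter.Tendsto (fun c : ℝ => ∫ w, K c w • (G₁ + G₂) w) Filter.atTop
      (nhds (G₁ 0 + 0)) := by
    refine (t1.add t2).congr' ?_
    filter_upwards [Filter.Ioi_mem_atTop 0] with c (hc : 0 < c)
    have ik : ∀ G : ℝ → ℂ, Integrable G → Integrable (fun w => K c w • G w) := by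
      intro G hG
      refine hG.bdd_mul (c := (Real.pi * c) ^ (1 / 2 : ℝ))
        (Continuous.aestronglyMeasurable (by fun_prop)) (Filter.Eventually.of_forall fun w => ?_)
      rw [nK c hc]
      refine mul_le_of_le_one_right (by positivity) (Real.exp_le_one_iff.2 ?_)
      have : 0 ≤ Real.pi * (Real.pi * c * w ^ 2) := by positivity
      linarith
    rw [← integral_add (ik _ i₁) (ik _ i₂)]
    refine integral_congr_ae (Filter.Eventually.of_forall fun w => ?_)
    exact (smul_add _ _ _).symm
  rw [add_zero] at t3
  rw [← e0]
  exact tendsto_nhds_unique t t3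

theorem integrable_complex_iff_prod {E : Type*} [NormedAddCommGroup E] {F : ℂ → E} :
    Integrable F ↔ Integrable (fun p : ℝ × ℝ => F ⟨p.1, p.2⟩) (volume.prod volume) := by
  have h := Complex.volume_preserving_equiv_real_prod.symm
  exact (h.integrable_comp_emb (MeasurableEquiv.measurableEmbedding _)).symm

theorem integral_complex_eq_prod {F : ℂ → ℂ} :
    ∫ z, F z = ∫ p : ℝ × ℝ, F ⟨p.1, p.2⟩ ∂(volume.prod volume) := by
  have h := Complex.volume_preserving_equiv_real_prod.symm
  exact (h.integral_comp (MeasurableEquiv.measurableEmbedding _) F).symm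

theorem integrable_fourier_slice {W : ℂ → ℂ} (hW : Integrable W) (s : ℝ) :
    Integrable (fun p : ℝ × ℝ => Complex.exp (↑(-2 * Real.pi * (inner ℝ p.2 s)) * Complex.I) •
      W ⟨p.1, p.2⟩) (volume.prod volume) := by
  refine (integrable_complex_iff_prod.1 hW).bdd_mul (c := 1)
    (Continuous.aestronglyMeasurable (by fun_prop)) (Filter.Eventually.of_forall fun p => ?_)
  rw [Complex.norm_exp_ofReal_mul_I]

theorem integrable_slice_fourier {W : ℂ → ℂ} (hW : Integrable W) (s : ℝ) :
    Integrable (fun a : ℝ => 𝓕 (fun b : ℝ => W ⟨a, b⟩) s) := by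
  simpa only [Real.fourier_eq'] using (integrable_fourier_slice hW s).integral_prod_left

theorem fourier_slice_fourier {W : ℂ → ℂ} (hW : Integrable W) (r s : ℝ) :
    𝓕 (fun a : ℝ => 𝓕 (fun b : ℝ => W ⟨a, b⟩) s) r = 𝓕 W ⟨r, s⟩ := by
  rw [Real.fourier_eq', Real.fourier_eq', integral_complex_eq_prod, integral_prod]
  · refine integral_congr_ae (Filter.Eventually.of_forall fun a => ?_)
    simp only [Real.fourier_eq', smul_eq_mul, ← integral_const_mul, ← mul_assoc,
      ← Complex.exp_add]
    refine integral_congr_ae (Filter.Eventually.of_forall fun b => ?_)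
    simp only
    congr 2
    rw [← add_mul, ← Complex.ofReal_add]
    congr 2
    simp [Complex.inner]
    ring
  · have cmk : Continuous fun p : ℝ × ℝ => (⟨p.1, p.2⟩ : ℂ) :=
      Complex.equivRealProdCLM.symm.continuous
    refine (integrable_complex_iff_prod.1 hW).bdd_mul (c := 1)
      (Continuous.aestronglyMeasurable (by fun_prop)) (Filter.Eventually.of_forall fun p => ?_)
    rw [Complex.norm_exp_ofReal_mul_I]

theorem fourier_add_apply {V : Type*} [NormedAddCommGroup V] [InnerProductSpace ℝ V]
    [MeasurableSpace V] [BorelSpace V] [FiniteDimensional ℝ V] {F G : V → ℂ} (hF : Integrable F)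
    (hG : Integrable G) (x : V) : 𝓕 (F + G) x = 𝓕 F x + 𝓕 G x := by
  simp only [Real.fourier_eq, Pi.add_apply, smul_add]
  exact integral_add ((Real.fourierIntegral_convergent_iff x).2 hF)
    ((Real.fourierIntegral_convergent_iff x).2 hG)

/-- Integration of a function of the second variable against a two-dimensional Fourier transform
that need not be integrable. -/
theorem integral_comp_im_mul_fourier {W₁ W₂ : ℂ → ℂ} {H : ℂ → ℝ} {B : ℝ → ℝ}
    (i₁ : Integrable W₁) (i₂ : Integrable W₂) (iH : Integrable H) (iB : Integrable B)
    (hB : ∀ a b, ‖W₁ ⟨a, b⟩‖ ≤ B b) (hm : ∀ a : ℝ, Measurable fun b : ℝ => W₁ ⟨a, b⟩)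
    (hc : ∀ b : ℝ, ContinuousAt (fun a : ℝ => W₁ ⟨a, b⟩) 0)
    (hH : ∀ z, ‖W₂ z‖ ≤ |z.re| * H z) {f : ℝ → ℂ}
    (hf : Integrable fun ξ : ℂ => f ξ.im * 𝓕 (W₁ + W₂) ξ) :
    Integrable (fun s => f s * 𝓕 (fun b : ℝ => W₁ ⟨0, b⟩) s) ∧
      ∫ ξ : ℂ, f ξ.im * 𝓕 (W₁ + W₂) ξ = ∫ s, f s * 𝓕 (fun b : ℝ => W₁ ⟨0, b⟩) s := by
  have hf' := integrable_complex_iff_prod.1 hf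
  have key : ∀ᵐ s : ℝ, ∫ r : ℝ, f s * 𝓕 (W₁ + W₂) ⟨r, s⟩
      = f s * 𝓕 (fun b : ℝ => W₁ ⟨0, b⟩) s := by
    filter_upwards [hf'.prod_left_ae] with s hs
    -- Where `f s ≠ 0`, dividing by it makes the slice of the transform integrable, as inversion
    -- requires; where `f s = 0` both sides vanish.
    rcases eq_or_ne (f s) 0 with h0 | h0
    · simp [h0]
    have hs' : Integrable fun r : ℝ => 𝓕 (W₁ + W₂) ⟨r, s⟩ := by
      have := hs.const_mul (f s)⁻¹
      simpa [h0] using this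
    rw [integral_const_mul]
    congr 1
    -- For fixed `s` the slice is the transform in `a` of the partial transforms in `b`, so its
    -- integral over `r` is a value at `a = 0`.
    have e : (fun r : ℝ => 𝓕 (W₁ + W₂) ⟨r, s⟩)
        = 𝓕 ((fun a : ℝ => 𝓕 (fun b : ℝ => W₁ ⟨a, b⟩) s)
          + (fun a : ℝ => 𝓕 (fun b : ℝ => W₂ ⟨a, b⟩) s)) := by
      funext r
      rw [fourier_add_apply i₁ i₂, fourier_add_apply (integrable_slice_fourier i₁ s)
        (integrable_slice_fourier i₂ s), fourier_slice_fourier i₁, fourier_slice_fourier i₂]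
    rw [e] at hs' ⊢
    refine integral_fourier_add_eq (h := fun a => ∫ b, H ⟨a, b⟩) (integrable_slice_fourier i₁ s)
      (integrable_slice_fourier i₂ s) ?_ (integrable_complex_iff_prod.1 iH).integral_prod_left ?_ hs'
    · simp only [Real.fourier_eq']
      refine continuousAt_of_dominated (bound := B) ?_ ?_ iB ?_
      · refine Filter.Eventually.of_forall fun a => ?_
        have h1 : Continuous fun b : ℝ =>
          Complex.exp (↑(-2 * Real.pi * (inner ℝ b s)) * Complex.I) := by fun_prop
        exact h1.aestronglyMeasurable.smul (hm a).aestronglyMeasurable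
      · refine Filter.Eventually.of_forall fun a => Filter.Eventually.of_forall fun b => ?_
        rw [norm_smul, Complex.norm_exp_ofReal_mul_I, one_mul]
        exact hB a b
      · exact Filter.Eventually.of_forall fun b => (hc b).const_smul
          (Complex.exp (↑(-2 * Real.pi * (inner ℝ b s)) * Complex.I))
    · filter_upwards [(integrable_complex_iff_prod.1 iH).prod_right_ae] with a ha
      rw [Real.fourier_eq', ← integral_const_mul]
      refine norm_integral_le_of_norm_le (ha.const_mul _) (Filter.Eventually.of_forall fun b => ?_)
      rw [norm_smul, Complex.norm_exp_ofReal_mul_I, one_mul]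
      exact hH ⟨a, b⟩
  refine ⟨hf'.integral_prod_right.congr key, ?_⟩
  rw [integral_complex_eq_prod, integral_prod_symm _ hf']
  exact integral_congr_ae key

/-! ### Hyperbolic weights: splitting near the coordinate axes -/

/-- A sharp cutoff at `|s| = δ` is enough, since `m₁` needs continuity at `0` only. The bound `2`
comes from choosing `δ` with `|m - 1| < 1` inside. -/
theorem exists_split {m : ℝ → ℝ} (hm : Measurable m) (hc : ContinuousAt m 0) (h0 : m 0 = 1) :
    ∃ (δ : ℝ) (m₁ m₂ : ℝ → ℝ), 0 < δ ∧ Measurable m₁ ∧ ContinuousAt m₁ 0 ∧ m₁ 0 = 1 ∧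
      (∀ s, |m₁ s| ≤ 2) ∧ (∀ s, m₁ s + m₂ s = m s) ∧ (∀ s, |m₁ s| ≤ |m s|) ∧ (∀ s, |m₂ s| ≤ |m s|) ∧
      Measurable m₂ ∧ ∀ s, |s| < δ → m₂ s = 0 := by
  obtain ⟨δ, hδ, h⟩ := Metric.continuousAt_iff.1 hc 1 one_pos
  have hmeas : Measurable fun s => if |s| < δ then m s else 0 :=
    Measurable.ite (measurableSet_lt measurable_norm measurable_const) hm measurable_const
  have hmeas' : Measurable fun s => if |s| < δ then 0 else m s :=
    Measurable.ite (measurableSet_lt measurable_norm measurable_const) measurable_const hm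
  refine ⟨δ, fun s => if |s| < δ then m s else 0, fun s => if |s| < δ then 0 else m s, hδ, hmeas,
    ?_, by simp [hδ, h0], fun s => ?_, fun s => ?_, fun s => ?_, fun s => ?_, hmeas', fun s hs => ?_⟩
  · refine hc.congr ?_
    filter_upwards [Metric.ball_mem_nhds (0 : ℝ) hδ] with s hs
    rw [Metric.mem_ball, Real.dist_eq, sub_zero] at hs
    simp [hs]
  · dsimp only
    split_ifs with hs
    · have h1 := h (show dist s 0 < δ by rwa [Real.dist_eq, sub_zero])
      rw [h0, Real.dist_eq] at h1
      have h2 := abs_add_le (m s - 1) 1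
      rw [sub_add_cancel, abs_one] at h2
      linarith
    · simp
  all_goals
    dsimp only
    split_ifs <;> simp_all

/-- Supplies an integrable majorant in `Im z`, uniform in `Re z`, for dominated convergence as `Re z
→ 0`. -/
theorem exists_decay (V : 𝓢(ℂ, ℂ)) : ∃ C, 0 ≤ C ∧ ∀ z : ℂ, ‖V z‖ ≤ C * (1 + z.im ^ 2)⁻¹ := by
  refine ⟨SchwartzMap.seminorm ℂ 0 0 V + SchwartzMap.seminorm ℂ 2 0 V,
    add_nonneg (apply_nonneg _ _) (apply_nonneg _ _), fun z => ?_⟩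
  have h1 := norm_le_seminorm ℂ V z
  have h2 := norm_pow_mul_le_seminorm ℂ V 2 z
  have h3 : z.im ^ 2 ≤ ‖z‖ ^ 2 := by
    rw [← sq_abs z.im]
    exact pow_le_pow_left₀ (abs_nonneg _) (Complex.abs_im_le_norm z) 2
  rw [← div_eq_mul_inv, le_div_iff₀ (by positivity)]
  nlinarith [norm_nonneg (V z)]

theorem im_sq_mk (a b : ℝ) : ((⟨a, b⟩ : ℂ) ^ 2).im = 2 * a * b := by
  rw [sq, Complex.mul_im]
  ring

theorem im_sq (z : ℂ) : (z ^ 2).im = 2 * z.re * z.im := im_sq_mk z.re z.im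

/-- The weight drops out because `Im z² = 0` on `Re z = 0`. Where the `m₂` part is not zero, `δ ≤ 2
|Re z| |Im z|`, so `1 ≤ |Re z| (2 / δ) |Im z|`, and `hW1` makes the resulting majorant `H`
integrable. -/
theorem integral_comp_im_mul_fourier_hyperbolicWeight {m : ℝ → ℝ} (hm : Measurable m)
    (hc : ContinuousAt m 0) (h0 : m 0 = 1) (V : 𝓢(ℂ, ℂ))
    (hW : Integrable fun z => hyperbolicWeight m z * V z)
    (hW1 : Integrable fun z => (z.im : ℂ) * (hyperbolicWeight m z * V z)) {f : ℝ → ℂ}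
    (hf : Integrable fun ξ : ℂ => f ξ.im * 𝓕 (fun z => hyperbolicWeight m z * V z) ξ) :
    Integrable (fun s => f s * 𝓕 (fun b : ℝ => V ⟨0, b⟩) s) ∧
      ∫ ξ : ℂ, f ξ.im * 𝓕 (fun z => hyperbolicWeight m z * V z) ξ
        = ∫ s, f s * 𝓕 (fun b : ℝ => V ⟨0, b⟩) s := by
  obtain ⟨δ, m₁, m₂, hδ, hm₁, hc₁, h₁, hb₁, hadd, hle₁, hle₂, hm₂, hz⟩ := exists_split hm hc h0
  obtain ⟨C, hC, hV⟩ := exists_decay V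
  have meas : ∀ n : ℝ → ℝ, Measurable n → Measurable (hyperbolicWeight n) := fun n hn =>
    Complex.measurable_ofReal.comp (hn.comp (Complex.measurable_im.comp (measurable_id.pow_const 2)))
  have hle : ∀ n : ℝ → ℝ, Measurable n → (∀ s, |n s| ≤ |m s|) →
      Integrable fun z => hyperbolicWeight n z * V z := fun n hn h => by
    refine hW.mono ((meas n hn).mul V.continuous.measurable).aestronglyMeasurable
      (Filter.Eventually.of_forall fun z => ?_)
    rw [norm_mul, norm_mul]
    refine mul_le_mul_of_nonneg_right ?_ (norm_nonneg _)
    simpa [hyperbolicWeight] using h _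
  have i₁ := hle m₁ hm₁ hle₁
  have i₂ := hle m₂ hm₂ hle₂
  have e : (fun z => hyperbolicWeight m z * V z)
      = (fun z => hyperbolicWeight m₁ z * V z) + fun z => hyperbolicWeight m₂ z * V z := by
    funext z
    simp only [Pi.add_apply, hyperbolicWeight, ← hadd]
    push_cast
    ring
  have e0 : (fun b : ℝ => V ⟨0, b⟩) = fun b : ℝ => hyperbolicWeight m₁ ⟨0, b⟩ * V ⟨0, b⟩ := by
    funext b
    simp [hyperbolicWeight, im_sq_mk, h₁]
  rw [e] at hf ⊢
  rw [e0]
  have cmk : Continuous fun p : ℝ × ℝ => (⟨p.1, p.2⟩ : ℂ) :=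
    Complex.equivRealProdCLM.symm.continuous
  refine integral_comp_im_mul_fourier (W₁ := fun z => hyperbolicWeight m₁ z * V z)
    (H := fun z => 2 / δ * ‖(z.im : ℂ) * (hyperbolicWeight m z * V z)‖)
    (B := fun b => 2 * C * (1 + b ^ 2)⁻¹) i₁ i₂ (hW1.norm.const_mul _)
    (integrable_inv_one_add_sq.const_mul _) (fun a b => ?_) (fun a => ?_) (fun b => ?_)
    (fun z => ?_) hf
  · rw [norm_mul, mul_assoc]
    refine mul_le_mul ?_ (hV ⟨a, b⟩) (norm_nonneg _) (by norm_num)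
    simpa [hyperbolicWeight] using hb₁ _
  · have : Measurable fun b : ℝ => (⟨a, b⟩ : ℂ) :=
      (cmk.comp (Continuous.prodMk_right a)).measurable
    exact ((meas m₁ hm₁).comp this).mul (V.continuous.measurable.comp this)
  · have c1 : Continuous fun a : ℝ => (⟨a, b⟩ : ℂ) := cmk.comp (Continuous.prodMk_left b)
    refine ContinuousAt.mul ?_ (V.continuous.comp c1).continuousAt
    simp only [hyperbolicWeight, im_sq_mk]
    refine Complex.continuous_ofReal.continuousAt.comp ?_
    refine ContinuousAt.comp (g := m₁) (f := fun a => 2 * a * b) ?_ (by fun_prop)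
    simpa using hc₁
  · simp only [norm_mul]
    rcases lt_or_ge |(z ^ 2).im| δ with h | h
    · simp only [hyperbolicWeight, hz _ h]
      simp only [Complex.ofReal_zero, norm_zero, zero_mul]
      positivity
    · rw [im_sq, abs_mul, abs_mul, abs_two] at h
      have h1 : 1 ≤ |z.re| * (2 / δ * |z.im|) := by
        rw [show |z.re| * (2 / δ * |z.im|) = 2 * |z.re| * |z.im| / δ by ring, le_div_iff₀ hδ]
        linarith
      have h2 : ‖hyperbolicWeight m₂ z‖ ≤ ‖hyperbolicWeight m z‖ := by
        simpa [hyperbolicWeight] using hle₂ _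
      rw [Complex.norm_real, Real.norm_eq_abs]
      calc ‖hyperbolicWeight m₂ z‖ * ‖V z‖ ≤ ‖hyperbolicWeight m z‖ * ‖V z‖ := by gcongr
        _ ≤ (|z.re| * (2 / δ * |z.im|)) * (‖hyperbolicWeight m z‖ * ‖V z‖) :=
          le_mul_of_one_le_left (by positivity) h1
        _ = _ := by ring

/-- The exchange of the real and the imaginary part. -/
def reImSwap : ℂ ≃ₗᵢ[ℝ] ℂ where
  toFun z := ⟨z.im, z.re⟩
  invFun z := ⟨z.im, z.re⟩
  left_inv _ := rfl
  right_inv _ := rfl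
  map_add' _ _ := rfl
  map_smul' c z := by apply Complex.ext <;> simp
  norm_map' z := by
    change ‖(⟨z.im, z.re⟩ : ℂ)‖ = ‖z‖
    rw [Complex.norm_def, Complex.norm_def, Complex.normSq_apply, Complex.normSq_apply, add_comm]

theorem reImSwap_apply (z : ℂ) : reImSwap z = ⟨z.im, z.re⟩ := rfl

/-- `Im z²` is invariant under exchange of real and imaginary part, which reduces this to the other
axis. -/
theorem integral_comp_re_mul_fourier_hyperbolicWeight {m : ℝ → ℝ} (hm : Measurable m)
    (hc : ContinuousAt m 0) (h0 : m 0 = 1) (V : 𝓢(ℂ, ℂ))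
    (hW : Integrable fun z => hyperbolicWeight m z * V z)
    (hW1 : Integrable fun z => (z.re : ℂ) * (hyperbolicWeight m z * V z)) {f : ℝ → ℂ}
    (hf : Integrable fun ξ : ℂ => f ξ.re * 𝓕 (fun z => hyperbolicWeight m z * V z) ξ) :
    Integrable (fun s => f s * 𝓕 (fun a : ℝ => V ⟨a, 0⟩) s) ∧
      ∫ ξ : ℂ, f ξ.re * 𝓕 (fun z => hyperbolicWeight m z * V z) ξ
        = ∫ s, f s * 𝓕 (fun a : ℝ => V ⟨a, 0⟩) s := by
  have mp := reImSwap.measurePreserving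
  have me := reImSwap.toHomeomorph.measurableEmbedding
  have ew : ∀ z, hyperbolicWeight m (reImSwap z) = hyperbolicWeight m z := fun z => by
    rw [hyperbolicWeight, hyperbolicWeight, im_sq, im_sq, reImSwap_apply]
    congr 2
    ring
  have eF : ∀ ξ, 𝓕 (fun z => hyperbolicWeight m z * V (reImSwap z)) ξ
      = 𝓕 (fun z => hyperbolicWeight m z * V z) (reImSwap ξ) := fun ξ => by
    rw [← Real.fourier_comp_linearIsometry]
    simp only [Function.comp_def, ew]
  have key := integral_comp_im_mul_fourier_hyperbolicWeight hm hc h0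
    (compCLMOfContinuousLinearEquiv ℂ reImSwap.toContinuousLinearEquiv V) (f := f) ?_ ?_ ?_
  · refine ⟨key.1, Eq.trans ?_ key.2⟩
    rw [← mp.integral_comp me]
    refine integral_congr_ae (Filter.Eventually.of_forall fun ξ => ?_)
    exact congrArg (f ξ.im * ·) (eF ξ).symm
  · refine ((mp.integrable_comp_emb me).2 hW).congr (Filter.Eventually.of_forall fun z => ?_)
    simp only [Function.comp_apply, ew]
    rfl
  · refine ((mp.integrable_comp_emb me).2 hW1).congr (Filter.Eventually.of_forall fun z => ?_)
    simp only [Function.comp_apply, ew]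
    rfl
  · refine ((mp.integrable_comp_emb me).2 hf).congr (Filter.Eventually.of_forall fun ξ => ?_)
    exact congrArg (f ξ.im * ·) (eF ξ).symm

/-! ### Gaussian summation and heat kernel averages -/

/-- The heat kernel on the phase space, of total mass one. -/
def heatKernel (c : ℝ) (z : ℂ) : ℂ :=
  (Real.pi * c : ℂ) ^ (Module.finrank ℝ ℂ / 2 : ℂ) * Complex.exp (-Real.pi ^ 2 * c * ‖z‖ ^ 2)

theorem norm_heatKernel {c : ℝ} (hc : 0 < c) (z : ℂ) :
    ‖heatKernel c z‖ = Real.pi * c * Real.exp (-(Real.pi ^ 2 * c) * ‖z‖ ^ 2) := by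
  rw [heatKernel, norm_mul]
  congr 1
  · rw [← Complex.ofReal_mul, Complex.norm_cpow_eq_rpow_re_of_pos (by positivity),
      Complex.finrank_real_complex]
    simp
  · rw [Complex.norm_exp]
    congr 1
    have : (-(Real.pi : ℂ) ^ 2 * c * ((‖z‖ : ℝ) : ℂ) ^ 2)
        = ((-(Real.pi ^ 2 * c) * ‖z‖ ^ 2 : ℝ) : ℂ) := by
      push_cast
      ring
    rw [this, Complex.ofReal_re]

theorem continuous_heatKernel (c : ℝ) : Continuous (heatKernel c) := by
  unfold heatKernel
  fun_prop

theorem norm_heatKernel_mul_sq_le {c : ℝ} (hc : 0 < c) (z : ℂ) :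
    ‖heatKernel c z‖ * ‖z‖ ^ 2 ≤ 1 := by
  rw [norm_heatKernel hc]
  convert mul_exp_neg_pi_mul_le_one (y := Real.pi * c * ‖z‖ ^ 2) using 1
  rw [show -(Real.pi ^ 2 * c) * ‖z‖ ^ 2 = -(Real.pi * (Real.pi * c * ‖z‖ ^ 2)) by ring]
  ring

theorem integrable_rexp_neg_mul_sq_norm {b : ℝ} (hb : 0 < b) :
    Integrable fun z : ℂ => Real.exp (-b * ‖z‖ ^ 2) := by
  have h := (GaussianFourier.integrable_cexp_neg_mul_sq_norm_add (V := ℂ)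
    (show 0 < (b : ℂ).re from hb) 0 0).norm
  refine h.congr (Filter.Eventually.of_forall fun z => ?_)
  simp only [Complex.norm_exp, zero_mul, add_zero]
  rw [show (-(b : ℂ) * (‖z‖ : ℂ) ^ 2) = ((-b * ‖z‖ ^ 2 : ℝ) : ℂ) by push_cast; ring,
    Complex.ofReal_re]

theorem integral_norm_heatKernel {c : ℝ} (hc : 0 < c) : ∫ z, ‖heatKernel c z‖ = 1 := by
  simp_rw [norm_heatKernel hc]
  rw [integral_const_mul, GaussianFourier.integral_rexp_neg_mul_sq_norm (by positivity),
    Complex.finrank_real_complex]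
  have := Real.pi_ne_zero
  simp
  field_simp

theorem integrable_norm_heatKernel {c : ℝ} (hc : 0 < c) :
    Integrable fun z => ‖heatKernel c z‖ := by
  simp_rw [norm_heatKernel hc]
  exact (integrable_rexp_neg_mul_sq_norm (by positivity)).const_mul _

/-- The transform is moved from `W` onto the modulated Gaussian, whose transform is the heat kernel
centred at `v`. -/
theorem integral_gaussian_mul_fourier {W : ℂ → ℂ} (hW : Integrable W) {c : ℝ} (hc : 0 < c) (v : ℂ) :
    ∫ w : ℂ, Complex.exp (-c⁻¹ * ‖w‖ ^ 2 + 2 * Real.pi * Complex.I * (inner ℝ v w : ℝ)) • 𝓕 W w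
      = ∫ w : ℂ, heatKernel c (v - w) • W w := by
  have J : Integrable (fun w : ℂ =>
      Complex.exp (-c⁻¹ * ‖w‖ ^ 2 + 2 * Real.pi * Complex.I * (inner ℝ v w : ℝ))) :=
    GaussianFourier.integrable_cexp_neg_mul_sq_norm_add (by simpa) _ _
  have h := VectorFourier.integral_fourierIntegral_smul_eq_flip (L := innerₗ ℂ)
      Real.continuous_fourierChar continuous_inner J hW
  have h' : ∫ w : ℂ, 𝓕 (fun w : ℂ => Complex.exp (-c⁻¹ * ‖w‖ ^ 2
      + 2 * Real.pi * Complex.I * (inner ℝ v w : ℝ))) w • W w = ∫ w : ℂ, Complex.exp (-c⁻¹ * ‖w‖ ^ 2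
      + 2 * Real.pi * Complex.I * (inner ℝ v w : ℝ)) • 𝓕 W w := by simpa using! h
  rw [← h']
  refine integral_congr_ae (Filter.Eventually.of_forall fun w => ?_)
  simp only
  have e := fourier_gaussian_innerProductSpace' (V := ℂ) (b := (c : ℂ)⁻¹) (by simpa) v w
  rw [← Complex.ofReal_inv] at e
  rw [e, heatKernel]
  congr 2
  · simp
  · congr 1
    simp
    ring

theorem norm_fourier_le {V : Type*} [NormedAddCommGroup V] [InnerProductSpace ℝ V]
    [MeasurableSpace V] [BorelSpace V] [FiniteDimensional ℝ V] (F : V → ℂ) (x : V) :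
    ‖𝓕 F x‖ ≤ ∫ v, ‖F v‖ := by
  rw [Real.fourier_eq]
  refine (norm_integral_le_integral_norm _).trans (le_of_eq ?_)
  simp_rw [Circle.norm_smul]

theorem continuous_fourier_of_integrable {V : Type*} [NormedAddCommGroup V] [InnerProductSpace ℝ V]
    [MeasurableSpace V] [BorelSpace V] [FiniteDimensional ℝ V] {F : V → ℂ} (hF : Integrable F) :
    Continuous (𝓕 F) := by
  have e : 𝓕 F = fun x => ∫ v, Complex.exp (↑(-2 * Real.pi * (inner ℝ v x : ℝ)) * Complex.I) • F v :=
    funext fun x => Real.fourier_eq' F x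
  rw [e]
  refine continuous_of_dominated (bound := fun v => ‖F v‖) (fun x => ?_) (fun x => ?_) hF.norm ?_
  · have h1 : Continuous fun v : V =>
      Complex.exp (↑(-2 * Real.pi * (inner ℝ v x : ℝ)) * Complex.I) := by fun_prop
    exact h1.aestronglyMeasurable.smul hF.1
  · refine Filter.Eventually.of_forall fun v => ?_
    rw [norm_smul, Complex.norm_exp_ofReal_mul_I, one_mul]
  · exact Filter.Eventually.of_forall fun v => by fun_prop

/-- The convolutions of `ϖ V` with the heat kernels are bounded on the coordinate axes. -/
theorem exists_bound_heatKernel_smul {m : ℝ → ℝ} (hm : Measurable m) (hc : ContinuousAt m 0)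
    (h0 : m 0 = 1) (V : 𝓢(ℂ, ℂ))
    (hW2 : Integrable fun z => ‖z‖ ^ 2 * ‖hyperbolicWeight m z * V z‖) :
    ∃ K, ∀ (v : ℂ) (c : ℝ), (v ^ 2).im = 0 → 0 < c →
      ‖∫ w : ℂ, heatKernel c (v - w) • (hyperbolicWeight m w * V w)‖ ≤ K := by
  obtain ⟨δ, m₁, m₂, hδ, hm₁, -, -, hb₁, hadd, -, hle₂, -, hz⟩ := exists_split hm hc h0
  set S := SchwartzMap.seminorm ℂ 0 0 V
  have hS : 0 ≤ S := apply_nonneg _ _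
  set J := ∫ z, ‖z‖ ^ 2 * ‖hyperbolicWeight m z * V z‖
  -- The first term bounds the `m₁` part through the unit mass of the kernel, the second the `m₂`
  -- part through the second moment `J`.
  refine ⟨2 * S * 1 + (2 / δ) ^ 2 * J, fun v c hv hc => ?_⟩
  have i0 : Integrable fun w => ‖heatKernel c (v - w)‖ := (integrable_norm_heatKernel hc).comp_sub_left v
  have e0 : ∫ w, ‖heatKernel c (v - w)‖ = 1 := by
    rw [integral_sub_left_eq_self (fun w => ‖heatKernel c w‖), integral_norm_heatKernel hc]
  have i1 : Integrable fun w => 2 * S * ‖heatKernel c (v - w)‖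
      + (2 / δ) ^ 2 * (‖w‖ ^ 2 * ‖hyperbolicWeight m w * V w‖) :=
    (i0.const_mul _).add (hW2.const_mul _)
  refine (norm_integral_le_of_norm_le i1 (Filter.Eventually.of_forall fun w => ?_)).trans_eq ?_
  · have n : ∀ n : ℝ → ℝ, ‖hyperbolicWeight n w‖ = |n (w ^ 2).im| := fun n => by
      simp [hyperbolicWeight]
    have hVS : ‖V w‖ ≤ S := norm_le_seminorm ℂ V w
    rw [norm_smul, norm_mul, n]
    have h1 : ‖heatKernel c (v - w)‖ * (|m₁ (w ^ 2).im| * ‖V w‖)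
        ≤ 2 * S * ‖heatKernel c (v - w)‖ := by
      rw [mul_comm]
      refine mul_le_mul_of_nonneg_right ?_ (norm_nonneg _)
      exact mul_le_mul (hb₁ _) hVS (norm_nonneg _) (by norm_num)
    have h2 : ‖heatKernel c (v - w)‖ * (|m₂ (w ^ 2).im| * ‖V w‖)
        ≤ (2 / δ) ^ 2 * (‖w‖ ^ 2 * (|m (w ^ 2).im| * ‖V w‖)) := by
      rcases lt_or_ge |(w ^ 2).im| δ with h | h
      · rw [hz _ h]
        simp only [abs_zero, zero_mul, mul_zero]
        positivity
      have h3 : δ ^ 2 ≤ (2 * |w.re| * |w.im|) ^ 2 := by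
        rw [im_sq, abs_mul, abs_mul, abs_two] at h
        exact pow_le_pow_left₀ hδ.le h 2
      -- One coordinate of `v` is zero, so `‖v - w‖` dominates that coordinate of `w`, and `‖w‖`
      -- dominates the other. Hence `‖v - w‖ ‖w‖ ≥ |Re w Im w| ≥ δ / 2`.
      have h4 : w.re ^ 2 ≤ ‖v - w‖ ^ 2 ∨ w.im ^ 2 ≤ ‖v - w‖ ^ 2 := by
        rw [im_sq] at hv
        have h5 := Complex.sq_norm_sub_sq_re (v - w)
        rw [Complex.sub_re, Complex.sub_im] at h5
        rcases mul_eq_zero.1 hv with h | h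
        · have h6 : v.re = 0 := by linarith
          left
          rw [h6] at h5
          nlinarith [sq_nonneg (v.im - w.im)]
        · right
          rw [h] at h5
          nlinarith [sq_nonneg (v.re - w.re)]
      have h5 : ‖w‖ ^ 2 = w.re ^ 2 + w.im ^ 2 := by
        rw [Complex.sq_norm, Complex.normSq_apply]; ring
      have h6 : 1 ≤ ‖v - w‖ ^ 2 * ((2 / δ) ^ 2 * ‖w‖ ^ 2) := by
        rw [div_pow, show ‖v - w‖ ^ 2 * (2 ^ 2 / δ ^ 2 * ‖w‖ ^ 2)
          = 4 * (‖v - w‖ ^ 2 * ‖w‖ ^ 2) / δ ^ 2 by ring, le_div_iff₀ (by positivity), one_mul]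
        rw [mul_pow, mul_pow, sq_abs, sq_abs] at h3
        have h7 : w.re ^ 2 * w.im ^ 2 ≤ ‖v - w‖ ^ 2 * ‖w‖ ^ 2 := by
          rcases h4 with h | h
          · exact mul_le_mul h (by nlinarith [sq_nonneg w.re]) (sq_nonneg _) (sq_nonneg _)
          · rw [mul_comm]
            exact mul_le_mul h (by nlinarith [sq_nonneg w.im]) (sq_nonneg _) (sq_nonneg _)
        linarith
      have h7 := norm_heatKernel_mul_sq_le hc (v - w)
      -- The bound of the kernel by `‖v - w‖⁻²` is traded for a factor `‖w‖²`, free of `v` and `c`.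
      have h8 : ‖heatKernel c (v - w)‖ ≤ (2 / δ) ^ 2 * ‖w‖ ^ 2 := by
        calc ‖heatKernel c (v - w)‖
            ≤ ‖heatKernel c (v - w)‖ * (‖v - w‖ ^ 2 * ((2 / δ) ^ 2 * ‖w‖ ^ 2)) :=
              le_mul_of_one_le_right (norm_nonneg _) h6
          _ = (‖heatKernel c (v - w)‖ * ‖v - w‖ ^ 2) * ((2 / δ) ^ 2 * ‖w‖ ^ 2) := by ring
          _ ≤ 1 * ((2 / δ) ^ 2 * ‖w‖ ^ 2) := mul_le_mul_of_nonneg_right h7 (by positivity)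
          _ = _ := one_mul _
      rw [← mul_assoc ((2 / δ) ^ 2)]
      exact mul_le_mul h8 (mul_le_mul_of_nonneg_right (hle₂ _) (norm_nonneg _)) (by positivity)
        (by positivity)
    have h3 : |m (w ^ 2).im| ≤ |m₁ (w ^ 2).im| + |m₂ (w ^ 2).im| := by
      rw [← hadd]; exact abs_add_le _ _
    calc _ ≤ ‖heatKernel c (v - w)‖ * ((|m₁ (w ^ 2).im| + |m₂ (w ^ 2).im|) * ‖V w‖) := by gcongr
      _ = ‖heatKernel c (v - w)‖ * (|m₁ (w ^ 2).im| * ‖V w‖)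
        + ‖heatKernel c (v - w)‖ * (|m₂ (w ^ 2).im| * ‖V w‖) := by ring
      _ ≤ _ := add_le_add h1 h2
  · rw [integral_add (i0.const_mul _) (hW2.const_mul _), integral_const_mul, integral_const_mul, e0]

/-- By Fubini the Gaussian mean is a superposition over `t` of heat kernel averages of `W` about `ζ
t`. Each converges by continuity of `W` at `ζ t`, and the uniform bound `K` lets the limit pass
under `μ`. -/
theorem tendsto_integral_gaussian_fourierStieltjes {W : ℂ → ℂ} (hW : Integrable W) {ζ : ℝ → ℂ}
    (hζ : Continuous ζ) (hc : ∀ t, ContinuousAt W (ζ t)) {K : ℝ}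
    (hK : ∀ t c, 0 < c → ‖∫ w : ℂ, heatKernel c (ζ t - w) • W w‖ ≤ K) {μ : Measure ℝ}
    [IsFiniteMeasure μ] {g : ℝ → ℂ} (hg : Integrable g μ) :
    Filter.Tendsto (fun c : ℝ => ∫ ξ : ℂ, (Real.exp (-c⁻¹ * ‖ξ‖ ^ 2) : ℂ) *
      ((∫ t, Complex.exp (2 * Real.pi * Complex.I * (inner ℝ (ζ t) ξ : ℝ)) * g t ∂μ) * 𝓕 W ξ))
      Filter.atTop (nhds (∫ t, g t * W (ζ t) ∂μ)) := by
  have cF := continuous_fourier_of_integrable hW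
  have e : ∀ c : ℝ, 0 < c → ∫ ξ : ℂ, (Real.exp (-c⁻¹ * ‖ξ‖ ^ 2) : ℂ) *
      ((∫ t, Complex.exp (2 * Real.pi * Complex.I * (inner ℝ (ζ t) ξ : ℝ)) * g t ∂μ) * 𝓕 W ξ)
      = ∫ t, g t * (∫ w : ℂ, heatKernel c (ζ t - w) • W w) ∂μ := by
    intro c hc
    have iG : Integrable fun ξ : ℂ => (Real.exp (-c⁻¹ * ‖ξ‖ ^ 2) : ℂ) * 𝓕 W ξ :=
      (integrable_rexp_neg_mul_sq_norm (inv_pos.2 hc)).ofReal.mul_bdd (c := ∫ v, ‖W v‖)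
        cF.aestronglyMeasurable (Filter.Eventually.of_forall fun ξ => norm_fourier_le W ξ)
    have ip : Integrable (fun p : ℂ × ℝ =>
        Complex.exp (2 * Real.pi * Complex.I * (inner ℝ (ζ p.2) p.1 : ℝ)) *
        (((Real.exp (-c⁻¹ * ‖p.1‖ ^ 2) : ℂ) * 𝓕 W p.1) * g p.2)) (volume.prod μ) := by
      refine (iG.mul_prod hg).bdd_mul (c := 1) (Continuous.aestronglyMeasurable (by fun_prop))
        (Filter.Eventually.of_forall fun p => ?_)
      rw [show (2 * Real.pi * Complex.I * (inner ℝ (ζ p.2) p.1 : ℝ) : ℂ)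
        = ((2 * Real.pi * (inner ℝ (ζ p.2) p.1 : ℝ) : ℝ) : ℂ) * Complex.I by push_cast; ring,
        Complex.norm_exp_ofReal_mul_I]
    have h1 : ∀ ξ : ℂ, (Real.exp (-c⁻¹ * ‖ξ‖ ^ 2) : ℂ) *
        ((∫ t, Complex.exp (2 * Real.pi * Complex.I * (inner ℝ (ζ t) ξ : ℝ)) * g t ∂μ) * 𝓕 W ξ)
        = ∫ t, Complex.exp (2 * Real.pi * Complex.I * (inner ℝ (ζ t) ξ : ℝ)) *
        (((Real.exp (-c⁻¹ * ‖ξ‖ ^ 2) : ℂ) * 𝓕 W ξ) * g t) ∂μ := by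
      intro ξ
      rw [mul_left_comm, ← integral_mul_const]
      refine integral_congr_ae (Filter.Eventually.of_forall fun t => ?_)
      ring
    simp_rw [h1]
    rw [integral_integral_swap ip]
    refine integral_congr_ae (Filter.Eventually.of_forall fun t => ?_)
    simp only
    rw [← integral_gaussian_mul_fourier hW hc, ← integral_const_mul]
    refine integral_congr_ae (Filter.Eventually.of_forall fun ξ => ?_)
    simp only [smul_eq_mul]
    rw [Complex.exp_add, Complex.ofReal_exp]
    push_cast
    ring
  have t : Filter.Tendsto (fun c : ℝ => ∫ t, g t * (∫ w : ℂ, heatKernel c (ζ t - w) • W w) ∂μ)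
      Filter.atTop (nhds (∫ t, g t * W (ζ t) ∂μ)) := by
    refine tendsto_integral_filter_of_dominated_convergence (fun t => ‖g t‖ * K) ?_ ?_
      (hg.norm.mul_const K) ?_
    · filter_upwards [Filter.Ioi_mem_atTop 0] with c (hc : 0 < c)
      refine hg.1.mul ?_
      have h2 : Continuous fun v : ℂ => ∫ w : ℂ, heatKernel c (v - w) • W w := by
        refine continuous_of_dominated (bound := fun w => Real.pi * c * ‖W w‖) (fun v => ?_)
          (fun v => Filter.Eventually.of_forall fun w => ?_) (hW.norm.const_mul _)
          (Filter.Eventually.of_forall fun w => ?_)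
        · have := (continuous_heatKernel c).comp (continuous_const.sub continuous_id : Continuous fun w => v - w)
          exact this.aestronglyMeasurable.smul hW.1
        · rw [norm_smul, norm_heatKernel hc]
          refine mul_le_mul_of_nonneg_right ?_ (norm_nonneg _)
          refine mul_le_of_le_one_right (by positivity) (Real.exp_le_one_iff.2 ?_)
          have : 0 ≤ Real.pi ^ 2 * c * ‖v - w‖ ^ 2 := by positivity
          linarith
        · exact ((continuous_heatKernel c).comp (continuous_id.sub continuous_const)).smul
            continuous_const
      exact (h2.comp hζ).aestronglyMeasurable
    · filter_upwards [Filter.Ioi_mem_atTop 0] with c (hc : 0 < c)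
      refine Filter.Eventually.of_forall fun t => ?_
      rw [norm_mul]
      exact mul_le_mul_of_nonneg_left (hK t c hc) (norm_nonneg _)
    · exact Filter.Eventually.of_forall fun t =>
        (Real.tendsto_integral_gaussian_smul' hW (hc t)).const_mul (g t)
  refine t.congr' ?_
  filter_upwards [Filter.Ioi_mem_atTop 0] with c (hc : 0 < c)
  exact (e c hc).symm

/-! ### Moments of the weighted matrix elements, and the forms of `f(q)` and `f(p)` -/

theorem re_eq_position (z : ℂ) : z.re = (√2)⁻¹ * position z := by
  have : √2 ≠ 0 := by positivity
  rw [position]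
  field_simp

theorem im_eq_momentum (z : ℂ) : z.im = (√2)⁻¹ * momentum z := by
  have : √2 ≠ 0 := by positivity
  rw [momentum]
  field_simp

section Weight

variable {ϖ : ℂ → ℂ} {M : StateSpace →L[ℂ] StateSpace}

theorem integrable_weight_mul_ambiguity (hM : IsOperatorOfWeight ϖ M) (φ ψ : 𝓢(ℝ, ℂ)) :
    Integrable fun z => ϖ z * ambiguity φ ψ z := by
  simpa only [inner_displacement_vec] using (hM φ ψ).1

/-- The hypothesis on `ϖ` concerns all pairs of Schwartz vectors, in particular those produced by
`position_mul_ambiguity`. No growth bound on `ϖ` is involved. -/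
theorem integrable_position_mul (hM : IsOperatorOfWeight ϖ M) (φ ψ : 𝓢(ℝ, ℂ)) :
    Integrable fun z => (position z : ℂ) * (ϖ z * ambiguity φ ψ z) := by
  refine ((integrable_weight_mul_ambiguity hM (schwartzQ φ) ψ).sub
    (integrable_weight_mul_ambiguity hM φ (schwartzQ ψ))).congr
    (Filter.Eventually.of_forall fun z => ?_)
  simp only [Pi.sub_apply, ← mul_sub]
  rw [← position_mul_ambiguity]
  ring

theorem integrable_momentum_mul (hM : IsOperatorOfWeight ϖ M) (φ ψ : 𝓢(ℝ, ℂ)) :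
    Integrable fun z => (momentum z : ℂ) * (ϖ z * ambiguity φ ψ z) := by
  refine (((integrable_weight_mul_ambiguity hM (derivCLM ℂ ℂ φ) ψ).add
    (integrable_weight_mul_ambiguity hM φ (derivCLM ℂ ℂ ψ))).const_mul Complex.I).congr
    (Filter.Eventually.of_forall fun z => ?_)
  simp only [Pi.add_apply]
  rw [mul_left_comm (momentum z : ℂ), momentum_mul_ambiguity]
  ring

theorem integrable_re_mul (hM : IsOperatorOfWeight ϖ M) (φ ψ : 𝓢(ℝ, ℂ)) :
    Integrable fun z : ℂ => (z.re : ℂ) * (ϖ z * ambiguity φ ψ z) := by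
  refine ((integrable_position_mul hM φ ψ).const_mul (((√2)⁻¹ : ℝ) : ℂ)).congr
    (Filter.Eventually.of_forall fun z => ?_)
  simp only [re_eq_position z]
  push_cast
  ring

theorem integrable_im_mul (hM : IsOperatorOfWeight ϖ M) (φ ψ : 𝓢(ℝ, ℂ)) :
    Integrable fun z : ℂ => (z.im : ℂ) * (ϖ z * ambiguity φ ψ z) := by
  refine ((integrable_momentum_mul hM φ ψ).const_mul (((√2)⁻¹ : ℝ) : ℂ)).congr
    (Filter.Eventually.of_forall fun z => ?_)
  simp only [im_eq_momentum z]
  push_cast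
  ring

theorem integrable_sq_norm_mul (hM : IsOperatorOfWeight ϖ M) (φ ψ : 𝓢(ℝ, ℂ)) :
    Integrable fun z : ℂ => ‖z‖ ^ 2 * ‖ϖ z * ambiguity φ ψ z‖ := by
  have h1 : Integrable fun z => (position z : ℂ) * ((position z : ℂ) * (ϖ z * ambiguity φ ψ z)) := by
    refine ((integrable_position_mul hM (schwartzQ φ) ψ).sub
      (integrable_position_mul hM φ (schwartzQ ψ))).congr (Filter.Eventually.of_forall fun z => ?_)
    simp only [Pi.sub_apply, ← mul_sub]
    rw [← position_mul_ambiguity]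
    ring
  have h2 : Integrable fun z => (momentum z : ℂ) * ((momentum z : ℂ) * (ϖ z * ambiguity φ ψ z)) := by
    refine (((integrable_momentum_mul hM (derivCLM ℂ ℂ φ) ψ).add
      (integrable_momentum_mul hM φ (derivCLM ℂ ℂ ψ))).const_mul Complex.I).congr
      (Filter.Eventually.of_forall fun z => ?_)
    simp only [Pi.add_apply]
    linear_combination (-(momentum z * ϖ z)) * momentum_mul_ambiguity φ ψ z
  refine ((h1.norm.add h2.norm).const_mul (1 / 2)).congr (Filter.Eventually.of_forall fun z => ?_)
  have h : √2 ^ 2 = (2 : ℝ) := Real.sq_sqrt (by norm_num)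
  have e : ‖z‖ ^ 2 = 1 / 2 * (|position z| ^ 2 + |momentum z| ^ 2) := by
    rw [Complex.sq_norm, Complex.normSq_apply, sq_abs, sq_abs, position, momentum, mul_pow, mul_pow,
      h]
    ring
  simp only [Pi.add_apply, norm_mul _ (_ * (ϖ z * _)), norm_mul _ (ϖ z * _), Complex.norm_real,
    Real.norm_eq_abs]
  rw [e]
  ring

theorem inner_displaced_vec (hM : IsOperatorOfWeight ϖ M) (φ ψ : 𝓢(ℝ, ℂ)) (w : ℂ) :
    ⟪vec φ, displaced M w (vec ψ)⟫_ℂ = (Real.pi : ℂ)⁻¹ *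
      𝓕 (fun z : ℂ => ϖ z * ambiguity φ ψ z) ((Real.pi : ℂ)⁻¹ * Complex.I * w) := by
  rw [inner_displaced_eq_fourier hM]
  simp only [inner_displacement_vec]

end Weight

/-- Multiplication by `-i`. -/
def negIMul : ℂ ≃ₗᵢ[ℝ] ℂ where
  toFun z := -Complex.I * z
  invFun z := Complex.I * z
  left_inv z := by linear_combination -z * Complex.I_sq
  right_inv z := by linear_combination -z * Complex.I_sq
  map_add' z w := mul_add _ _ _
  map_smul' c z := by simp only [Complex.real_smul, RingHom.id_apply]; ring
  norm_map' z := by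
    change ‖-Complex.I * z‖ = ‖z‖
    simp

/-- The frequency variable of the Fourier transform as a phase space point. -/
def phasePoint (ξ : ℂ) : ℂ := Real.pi • negIMul ξ

theorem phasePoint_apply (ξ : ℂ) : phasePoint ξ = ⟨Real.pi * ξ.im, -(Real.pi * ξ.re)⟩ := by
  change Real.pi • (-Complex.I * ξ) = _
  apply Complex.ext <;> simp

theorem norm_phasePoint (ξ : ℂ) : ‖phasePoint ξ‖ = Real.pi * ‖ξ‖ := by
  rw [phasePoint, norm_smul, negIMul.norm_map, Real.norm_of_nonneg Real.pi_nonneg]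

theorem position_phasePoint (ξ : ℂ) : position (phasePoint ξ) = √2 * Real.pi * ξ.im := by
  rw [position, phasePoint_apply]
  ring

theorem momentum_phasePoint (ξ : ℂ) : momentum (phasePoint ξ) = -(√2 * Real.pi) * ξ.re := by
  rw [momentum, phasePoint_apply]
  ring

/-- `phasePoint` inverts the substitution in `inner_displaced_vec`, and it makes `q` a multiple of
`Im ξ` and `p` one of `Re ξ`. -/
theorem inv_pi_mul_I_mul_phasePoint (ξ : ℂ) :
    (Real.pi : ℂ)⁻¹ * Complex.I * phasePoint ξ = ξ := by
  have := Complex.ofReal_ne_zero.2 Real.pi_ne_zero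
  change (Real.pi : ℂ)⁻¹ * Complex.I * (Real.pi • (-Complex.I * ξ)) = ξ
  rw [Complex.real_smul]
  field_simp
  linear_combination -ξ * Complex.I_sq

theorem integrable_comp_phasePoint_iff {F : ℂ → ℂ} :
    Integrable (fun ξ => F (phasePoint ξ)) ↔ Integrable F := by
  have h1 := negIMul.measurePreserving.integrable_comp_emb negIMul.toHomeomorph.measurableEmbedding
    (g := fun w => F (Real.pi • w))
  rw [← integrable_comp_smul_iff volume F Real.pi_ne_zero, ← h1]
  rfl

theorem integral_comp_phasePoint (F : ℂ → ℂ) :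
    ∫ w, F w = (Real.pi : ℂ) ^ 2 * ∫ ξ, F (phasePoint ξ) := by
  have h1 := negIMul.measurePreserving.integral_comp negIMul.toHomeomorph.measurableEmbedding
    (fun w => F (Real.pi • w))
  have h2 := Measure.integral_comp_smul volume F Real.pi
  rw [Complex.finrank_real_complex] at h2
  have h3 : ∫ ξ, F (phasePoint ξ) = ∫ w : ℂ, F (Real.pi • w) := h1
  have := Complex.ofReal_ne_zero.2 Real.pi_ne_zero
  rw [h3, h2, abs_of_pos (by positivity), Complex.real_smul]
  push_cast
  field_simp

section Hyperbolic

variable {m : ℝ → ℝ} {M : StateSpace →L[ℂ] StateSpace}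

theorem quantForm_position (hm : Measurable m) (hc : ContinuousAt m 0) (h0 : m 0 = 1)
    (hM : IsOperatorOfWeight (hyperbolicWeight m) M) (f : ℝ → ℂ) (φ ψ : 𝓢(ℝ, ℂ))
    (hf : Integrable (formIntegrand M (fun z => f (position z)) (vec φ) (vec ψ))) :
    Integrable (fun x : ℝ => star (φ x) * f x * ψ x) ∧
      quantForm M (fun z => f (position z)) (vec φ) (vec ψ) = ∫ x : ℝ, star (φ x) * f x * ψ x := by
  have hpi := Complex.ofReal_ne_zero.2 Real.pi_ne_zero
  have hs : 0 < √2 * Real.pi := by positivity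
  have e : ∀ ξ, formIntegrand M (fun z => f (position z)) (vec φ) (vec ψ) (phasePoint ξ)
      = (Real.pi : ℂ)⁻¹ * (f (√2 * Real.pi * ξ.im) *
        𝓕 (fun z => hyperbolicWeight m z * schwartzAmbiguity φ ψ z) ξ) := by
    intro ξ
    rw [formIntegrand, inner_displaced_vec hM, inv_pi_mul_I_mul_phasePoint, position_phasePoint,
      mul_left_comm]
    rfl
  have hf' := integrable_comp_phasePoint_iff.2 hf
  simp_rw [e] at hf'
  have hf2 := hf'.const_mul (Real.pi : ℂ)
  simp only [mul_inv_cancel_left₀ hpi] at hf2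
  obtain ⟨i1, e1⟩ := integral_comp_im_mul_fourier_hyperbolicWeight hm hc h0 (schwartzAmbiguity φ ψ)
    (integrable_weight_mul_ambiguity hM φ ψ) (integrable_im_mul hM φ ψ)
    (f := fun s => f (√2 * Real.pi * s)) hf2
  have e2 : (fun s => f (√2 * Real.pi * s) * 𝓕 (fun b : ℝ => schwartzAmbiguity φ ψ ⟨0, b⟩) s)
      = fun s => ((√2 * Real.pi : ℝ) : ℂ) * (fun x => star (φ x) * f x * ψ x) (√2 * Real.pi * s) := by
    funext s
    simp only [schwartzAmbiguity_apply, fourier_ambiguity_im, zero_div, add_zero, sub_zero]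
    ring
  rw [e2] at i1 e1
  have i2 := i1.const_mul (((√2 * Real.pi : ℝ) : ℂ)⁻¹)
  simp only [inv_mul_cancel_left₀ (Complex.ofReal_ne_zero.2 hs.ne')] at i2
  refine ⟨(integrable_comp_mul_left_iff _ hs.ne').1 i2, ?_⟩
  -- The Jacobian `π²` cancels the factors `π⁻¹` of the form and of `inner_displaced_vec`; rescaling
  -- to `x = √2 π s` cancels the factor of `fourier_ambiguity_im`.
  rw [quantForm, integral_comp_phasePoint]
  simp_rw [e]
  rw [integral_const_mul, e1, integral_const_mul,
    Measure.integral_comp_mul_left (fun x => star (φ x) * f x * ψ x) (√2 * Real.pi),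
    abs_of_pos (by positivity), Complex.real_smul]
  have h2 : (√2 : ℂ) ≠ 0 := Complex.ofReal_ne_zero.2 (by positivity)
  push_cast
  field_simp

theorem quantForm_momentum (hm : Measurable m) (hc : ContinuousAt m 0) (h0 : m 0 = 1)
    (hM : IsOperatorOfWeight (hyperbolicWeight m) M) (f : ℝ → ℂ) (φ ψ : 𝓢(ℝ, ℂ))
    (hf : Integrable (formIntegrand M (fun z => f (momentum z)) (vec φ) (vec ψ))) :
    Integrable (fun ξ : ℝ => star (𝓕 φ ξ) * f (2 * Real.pi * ξ) * 𝓕 ψ ξ) ∧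
      quantForm M (fun z => f (momentum z)) (vec φ) (vec ψ)
        = ∫ ξ : ℝ, star (𝓕 φ ξ) * f (2 * Real.pi * ξ) * 𝓕 ψ ξ := by
  have hpi := Complex.ofReal_ne_zero.2 Real.pi_ne_zero
  have hs : 0 < √2 := by positivity
  have e : ∀ ξ, formIntegrand M (fun z => f (momentum z)) (vec φ) (vec ψ) (phasePoint ξ)
      = (Real.pi : ℂ)⁻¹ * (f (-(√2 * Real.pi) * ξ.re) *
        𝓕 (fun z => hyperbolicWeight m z * schwartzAmbiguity φ ψ z) ξ) := by
    intro ξ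
    rw [formIntegrand, inner_displaced_vec hM, inv_pi_mul_I_mul_phasePoint, momentum_phasePoint,
      mul_left_comm]
    rfl
  have hf' := integrable_comp_phasePoint_iff.2 hf
  simp_rw [e] at hf'
  have hf2 := hf'.const_mul (Real.pi : ℂ)
  simp only [mul_inv_cancel_left₀ hpi] at hf2
  obtain ⟨i1, e1⟩ := integral_comp_re_mul_fourier_hyperbolicWeight hm hc h0 (schwartzAmbiguity φ ψ)
    (integrable_weight_mul_ambiguity hM φ ψ) (integrable_re_mul hM φ ψ)
    (f := fun s => f (-(√2 * Real.pi) * s)) hf2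
  have e2 : (fun s => f (-(√2 * Real.pi) * s) * 𝓕 (fun a : ℝ => schwartzAmbiguity φ ψ ⟨a, 0⟩) s)
      = fun s => (((√2)⁻¹ : ℝ) : ℂ) *
        (fun ξ => star (𝓕 φ ξ) * f (2 * Real.pi * ξ) * 𝓕 ψ ξ) (-(√2)⁻¹ * s) := by
    funext s
    have h2 : √2 * √2 = (2 : ℝ) := Real.mul_self_sqrt (by norm_num)
    -- With `ξ = -s / √2` the argument of `f` becomes `2πξ`, the spectral variable of `P`.
    have h3 : -(√2 * Real.pi) * s = 2 * Real.pi * (-(√2)⁻¹ * s) := by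
      field_simp
      linear_combination (-s) * h2
    simp only [schwartzAmbiguity_apply, fourier_ambiguity_re]
    rw [h3, show -(s / √2) = -(√2)⁻¹ * s by ring]
    ring
  rw [e2] at i1 e1
  have hs' : (√2)⁻¹ ≠ 0 := inv_ne_zero hs.ne'
  have i2 := i1.const_mul ((((√2)⁻¹ : ℝ) : ℂ)⁻¹)
  simp only [inv_mul_cancel_left₀ (Complex.ofReal_ne_zero.2 hs')] at i2
  refine ⟨(integrable_comp_mul_left_iff _ (neg_ne_zero.2 hs')).1 i2, ?_⟩
  rw [quantForm, integral_comp_phasePoint]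
  simp_rw [e]
  rw [integral_const_mul, e1, integral_const_mul, Measure.integral_comp_mul_left
    (fun ξ => star (𝓕 φ ξ) * f (2 * Real.pi * ξ) * 𝓕 ψ ξ) (-(√2)⁻¹), inv_neg, inv_inv, abs_neg, abs_of_pos hs, Complex.real_smul]
  have h2 : (√2 : ℂ) ≠ 0 := Complex.ofReal_ne_zero.2 (by positivity)
  push_cast
  field_simp

end Hyperbolic

/-! ### Symbols that are Fourier transforms of measures -/

theorem IsFourierStieltjes.continuous {f : ℝ → ℂ} (hf : IsFourierStieltjes f) : Continuous f := by
  obtain ⟨μ, g, _, hg, e⟩ := hf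
  rw [funext e]
  refine continuous_of_dominated (bound := fun t => ‖g t‖) (fun x => ?_) (fun x => ?_) hg.norm ?_
  · exact (Continuous.aestronglyMeasurable (by fun_prop)).mul hg.1
  · refine Filter.Eventually.of_forall fun t => ?_
    rw [norm_mul, Complex.norm_exp_ofReal_mul_I, one_mul]
  · exact Filter.Eventually.of_forall fun t => by fun_prop

theorem IsFourierStieltjes.bounded {f : ℝ → ℂ} (hf : IsFourierStieltjes f) :
    ∃ C, ∀ x, ‖f x‖ ≤ C := by
  obtain ⟨μ, g, _, hg, e⟩ := hf
  refine ⟨∫ t, ‖g t‖ ∂μ, fun x => ?_⟩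
  rw [e]
  refine norm_integral_le_of_norm_le hg.norm (Filter.Eventually.of_forall fun t => ?_)
  rw [norm_mul, Complex.norm_exp_ofReal_mul_I, one_mul]

theorem integral_fourierStieltjes_mul {μ : Measure ℝ} [IsFiniteMeasure μ] {g : ℝ → ℂ}
    (hg : Integrable g μ) {h : ℝ → ℂ} (hh : Integrable h) (k : ℝ) :
    ∫ t, g t * (∫ x, Complex.exp (((t * (k * x) : ℝ) : ℂ) * Complex.I) * h x) ∂μ
      = ∫ x, (∫ t, Complex.exp (((t * (k * x) : ℝ) : ℂ) * Complex.I) * g t ∂μ) * h x := by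
  have ip : Integrable (fun p : ℝ × ℝ => Complex.exp (((p.1 * (k * p.2) : ℝ) : ℂ) * Complex.I)
      * (g p.1 * h p.2)) (μ.prod volume) := by
    refine (hg.mul_prod hh).bdd_mul (c := 1) (Continuous.aestronglyMeasurable (by fun_prop))
      (Filter.Eventually.of_forall fun p => ?_)
    rw [Complex.norm_exp_ofReal_mul_I]
  have e1 : ∀ t, g t * (∫ x, Complex.exp (((t * (k * x) : ℝ) : ℂ) * Complex.I) * h x)
      = ∫ x, Complex.exp (((t * (k * x) : ℝ) : ℂ) * Complex.I) * (g t * h x) := fun t => by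
    rw [← integral_const_mul]
    exact integral_congr_ae (Filter.Eventually.of_forall fun x => by ring)
  have e2 : ∀ x, (∫ t, Complex.exp (((t * (k * x) : ℝ) : ℂ) * Complex.I) * g t ∂μ) * h x
      = ∫ t, Complex.exp (((t * (k * x) : ℝ) : ℂ) * Complex.I) * (g t * h x) ∂μ := fun x => by
    rw [← integral_mul_const]
    exact integral_congr_ae (Filter.Eventually.of_forall fun x => by ring)
  simp_rw [e1, e2]
  exact integral_integral_swap ip

section Hyperbolic

variable {m : ℝ → ℝ} {M : StateSpace →L[ℂ] StateSpace}

/-- Common to position and momentum: the points `ζ t` lie on the coordinate axes, where the weight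
equals `1`, is continuous, and has bounded heat kernel averages. -/
theorem quantFormTendsto_of_characters (hm : Measurable m) (hc : ContinuousAt m 0) (h0 : m 0 = 1)
    (hM : IsOperatorOfWeight (hyperbolicWeight m) M) (φ ψ : 𝓢(ℝ, ℂ)) {ζ : ℝ → ℂ}
    (hζ : Continuous ζ) (hζ0 : ∀ t, (ζ t ^ 2).im = 0) {μ : Measure ℝ} [IsFiniteMeasure μ]
    {g : ℝ → ℂ} (hg : Integrable g μ) {F : ℂ → ℂ} (cF : Continuous F) {C : ℝ}
    (hC : ∀ z, ‖F z‖ ≤ C)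
    (hF : ∀ ξ, F (phasePoint ξ)
      = ∫ t, Complex.exp (2 * Real.pi * Complex.I * (inner ℝ (ζ t) ξ : ℝ)) * g t ∂μ) :
    QuantFormTendsto M F (vec φ) (vec ψ) (∫ t, g t * ambiguity φ ψ (ζ t) ∂μ) := by
  have hW := integrable_weight_mul_ambiguity hM φ ψ
  set W := fun z => hyperbolicWeight m z * ambiguity φ ψ z with hWdef
  have hpi := Complex.ofReal_ne_zero.2 Real.pi_ne_zero
  have cW := continuous_fourier_of_integrable hW
  obtain ⟨K, hK⟩ := exists_bound_heatKernel_smul hm hc h0 (schwartzAmbiguity φ ψ)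
    (integrable_sq_norm_mul hM φ ψ)
  have e : ∀ w, formIntegrand M F (vec φ) (vec ψ) w
      = F w * ((Real.pi : ℂ)⁻¹ * 𝓕 W ((Real.pi : ℂ)⁻¹ * Complex.I * w)) := fun w => by
    rw [formIntegrand, inner_displaced_vec hM]
  refine ⟨fun ε hε => ?_, ?_⟩
  · refine (integrable_rexp_neg_mul_sq_norm hε).ofReal.mul_bdd
      (c := C * (‖(Real.pi : ℂ)⁻¹‖ * ∫ v, ‖W v‖)) ?_ (Filter.Eventually.of_forall fun w => ?_)
    · rw [funext e]
      exact Continuous.aestronglyMeasurable (by fun_prop)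
    · rw [e, norm_mul, norm_mul]
      have := norm_fourier_le W ((Real.pi : ℂ)⁻¹ * Complex.I * w)
      gcongr
      · exact (norm_nonneg _).trans (hC 0)
      · exact hC w
  · have t := tendsto_integral_gaussian_fourierStieltjes hW hζ (fun t => ?_) (K := K)
      (fun t c hc => hK (ζ t) c (hζ0 t) hc) hg
    · have hW0 : ∀ t, W (ζ t) = ambiguity φ ψ (ζ t) := fun t => by
        simp [hWdef, hyperbolicWeight, hζ0, h0]
      have hI : ∫ t, g t * ambiguity φ ψ (ζ t) ∂μ = ∫ t, g t * W (ζ t) ∂μ :=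
        integral_congr_ae (Filter.Eventually.of_forall fun t => by simp only [hW0])
      rw [hI]
      -- `c = (π² ε)⁻¹` matches `exp (-ε ‖phasePoint ξ‖²)` with `exp (-c⁻¹ ‖ξ‖²)`.
      have t0 : Filter.Tendsto (fun ε : ℝ => (Real.pi ^ 2)⁻¹ * ε⁻¹) (nhdsWithin 0 (Set.Ioi 0))
          Filter.atTop := tendsto_inv_nhdsGT_zero.const_mul_atTop (by positivity)
      refine (t.comp t0).congr' ?_
      filter_upwards [self_mem_nhdsWithin] with ε (hε : 0 < ε)
      rw [Function.comp_apply, integral_comp_phasePoint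
        (fun z => (Real.exp (-ε * ‖z‖ ^ 2) : ℂ) * formIntegrand M F (vec φ) (vec ψ) z)]
      have e5 : ∀ ξ, formIntegrand M F (vec φ) (vec ψ) (phasePoint ξ) = _ := fun ξ => e _
      simp only [e5, inv_pi_mul_I_mul_phasePoint, norm_phasePoint, hF]
      rw [← mul_assoc, ← integral_const_mul]
      refine integral_congr_ae (Filter.Eventually.of_forall fun ξ => ?_)
      simp only
      rw [show -ε * (Real.pi * ‖ξ‖) ^ 2 = -((Real.pi ^ 2)⁻¹ * ε⁻¹)⁻¹ * ‖ξ‖ ^ 2 by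
        rw [mul_inv, inv_inv, inv_inv]; ring]
      field_simp
    · refine ContinuousAt.mul ?_ (schwartzAmbiguity φ ψ).continuous.continuousAt
      refine Complex.continuous_ofReal.continuousAt.comp ?_
      refine ContinuousAt.comp (g := m) (f := fun z : ℂ => (z ^ 2).im) ?_ (by fun_prop)
      rw [hζ0]
      exact hc

theorem quantFormTendsto_position (hm : Measurable m) (hc : ContinuousAt m 0) (h0 : m 0 = 1)
    (hM : IsOperatorOfWeight (hyperbolicWeight m) M) {f : ℝ → ℂ} (hf : IsFourierStieltjes f)
    (φ ψ : 𝓢(ℝ, ℂ)) :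
    QuantFormTendsto M (fun z => f (position z)) (vec φ) (vec ψ)
      (∫ x : ℝ, star (φ x) * f x * ψ x) := by
  have cf := hf.continuous
  obtain ⟨C, hC⟩ := hf.bounded
  obtain ⟨μ, g, _, hg, e⟩ := hf
  have h2 : √2 * √2 = (2 : ℝ) := Real.mul_self_sqrt (by norm_num)
  have hs : √2 ≠ 0 := by positivity
  have cp : Continuous position := positionL.continuous
  -- At this point `p = t` and `q = 0`, so `D(ζ t)` is multiplication by `exp (i t x)`.
  have key := quantFormTendsto_of_characters hm hc h0 hM φ ψ (ζ := fun t => ⟨0, t / √2⟩)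
    (Complex.equivRealProdCLM.symm.continuous.comp (by fun_prop : Continuous fun t : ℝ => ((0 : ℝ), t / √2)))
    (fun t => by rw [im_sq_mk]; ring) hg (F := fun z => f (position z)) (cf.comp cp)
    (fun z => hC _) (fun ξ => ?_)
  · convert key using 1
    have ea : ∀ t, ambiguity φ ψ ⟨0, t / √2⟩ = ∫ x : ℝ,
        Complex.exp (((t * (1 * x) : ℝ) : ℂ) * Complex.I) * (star (φ x) * ψ x) := fun t => by
      refine integral_congr_ae (Filter.Eventually.of_forall fun x => ?_)
      simp only [displacementFun, position, momentum, mul_zero, zero_div, sub_zero, one_mul]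
      rw [mul_div_cancel₀ _ hs]
      ring
    simp_rw [ea]
    rw [integral_fourierStieltjes_mul hg (integrable_star_mul φ ψ)]
    refine integral_congr_ae (Filter.Eventually.of_forall fun x => ?_)
    simp only [one_mul, ← e]
    ring
  · simp only [e, position_phasePoint]
    refine integral_congr_ae (Filter.Eventually.of_forall fun t => ?_)
    simp only
    congr 2
    have : (inner ℝ (⟨0, t / √2⟩ : ℂ) ξ : ℝ) = t / √2 * ξ.im := by
      simp [Complex.inner, mul_comm]
    rw [this, show t / √2 * ξ.im = 2⁻¹ * (√2 * t * ξ.im) by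
      field_simp; linear_combination (-t * ξ.im) * h2]
    push_cast
    ring

theorem quantFormTendsto_momentum (hm : Measurable m) (hc : ContinuousAt m 0) (h0 : m 0 = 1)
    (hM : IsOperatorOfWeight (hyperbolicWeight m) M) {f : ℝ → ℂ} (hf : IsFourierStieltjes f)
    (φ ψ : 𝓢(ℝ, ℂ)) :
    QuantFormTendsto M (fun z => f (momentum z)) (vec φ) (vec ψ)
      (∫ ξ : ℝ, star (𝓕 φ ξ) * f (2 * Real.pi * ξ) * 𝓕 ψ ξ) := by
  have cf := hf.continuous
  obtain ⟨C, hC⟩ := hf.bounded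
  obtain ⟨μ, g, _, hg, e⟩ := hf
  have h2 : √2 * √2 = (2 : ℝ) := Real.mul_self_sqrt (by norm_num)
  have hs : √2 ≠ 0 := by positivity
  have cp : Continuous momentum := momentumL.continuous
  -- At this point `q = -t` and `p = 0`, so `D(ζ t)` is the translation `exp (i t P)`.
  have key := quantFormTendsto_of_characters hm hc h0 hM φ ψ (ζ := fun t => ⟨-(t / √2), 0⟩)
    (Complex.equivRealProdCLM.symm.continuous.comp (by fun_prop : Continuous fun t : ℝ => (-(t / √2), (0 : ℝ))))
    (fun t => by rw [im_sq_mk]; ring) hg (F := fun z => f (momentum z)) (cf.comp cp)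
    (fun z => hC _) (fun ξ => ?_)
  · convert key using 1
    have ea : ∀ t, ambiguity φ ψ ⟨-(t / √2), 0⟩ = ∫ x : ℝ,
        Complex.exp (((t * (2 * Real.pi * x) : ℝ) : ℂ) * Complex.I) * (star (𝓕 φ x) * 𝓕 ψ x) := by
      intro t
      rw [ambiguity_ofReal, fourier_coe (conjMul _ _), Real.fourier_eq']
      refine integral_congr_ae (Filter.Eventually.of_forall fun x => ?_)
      simp only [smul_eq_mul, conjMul_apply]
      congr 4
      rw [mul_neg, mul_div_cancel₀ _ hs]
      simp
      ring
    simp_rw [ea]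
    rw [integral_fourierStieltjes_mul hg (integrable_star_mul (𝓕 φ) (𝓕 ψ))]
    refine integral_congr_ae (Filter.Eventually.of_forall fun x => ?_)
    simp only [← e]
    ring
  · simp only [e, momentum_phasePoint]
    refine integral_congr_ae (Filter.Eventually.of_forall fun t => ?_)
    simp only
    congr 2
    have : (inner ℝ (⟨-(t / √2), 0⟩ : ℂ) ξ : ℝ) = -(t / √2) * ξ.re := by
      simp [Complex.inner, mul_comm]
    rw [this, show -(t / √2) * ξ.re = -(2⁻¹ * (√2 * t * ξ.re)) by
      field_simp; linear_combination (t * ξ.re) * h2]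
    push_cast
    ring

end Hyperbolic

/-! ### From forms to operators: inclusions and closures -/

/-- A Schwartz function that is `1` on the ball of radius `R` about `0`. -/
theorem exists_schwartz_eq_one (R : ℝ) :
    ∃ χ : 𝓢(ℝ, ℂ), ∀ x ∈ Metric.closedBall (0 : ℝ) R, χ x = 1 := by
  let b : ContDiffBump (0 : ℝ) := ⟨max R 1, max R 1 + 1, by positivity, by linarith⟩
  have h1 : HasCompactSupport fun x => ((b x : ℝ) : ℂ) :=
    b.hasCompactSupport.comp_left (g := fun t : ℝ => (t : ℂ)) Complex.ofReal_zero
  refine ⟨h1.toSchwartzMap (Complex.ofRealCLM.contDiff.comp b.contDiff), fun x hx => ?_⟩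
  have : b x = 1 :=
    b.one_of_mem_closedBall (Metric.closedBall_subset_closedBall (le_max_left R 1) hx)
  change ((b x : ℝ) : ℂ) = 1
  rw [this, Complex.ofReal_one]

theorem locallyIntegrable_of_forall_exists {h : ℝ → ℂ}
    (H : ∀ R, ∃ g : ℝ → ℂ, LocallyIntegrable g ∧
      ∀ᵐ x, x ∈ Metric.closedBall (0 : ℝ) R → h x = g x) : LocallyIntegrable h := by
  refine locallyIntegrable_iff.2 fun k hk => ?_
  obtain ⟨R, hR⟩ := hk.isBounded.subset_closedBall 0
  obtain ⟨g, hg, e⟩ := H R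
  refine (hg.integrableOn_isCompact (isCompact_closedBall (0 : ℝ) R)).mono_set hR |>.congr ?_
  refine (ae_restrict_iff' hk.measurableSet).2 ?_
  filter_upwards [e] with x hx hxk
  exact (hx (hR hxk)).symm

theorem locallyIntegrable_of_integrable_star_mul {h : ℝ → ℂ}
    (H : ∀ φ : 𝓢(ℝ, ℂ), Integrable fun x => star (φ x) * h x) : LocallyIntegrable h := by
  refine locallyIntegrable_of_forall_exists fun R => ?_
  obtain ⟨χ, hχ⟩ := exists_schwartz_eq_one R
  refine ⟨_, (H χ).locallyIntegrable, Filter.Eventually.of_forall fun x hx => ?_⟩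
  rw [hχ x hx, star_one, one_mul]

theorem ae_eq_zero_of_integral_star_mul {h : ℝ → ℂ} (hl : LocallyIntegrable h)
    (H : ∀ φ : 𝓢(ℝ, ℂ), HasCompactSupport φ → ∫ x, star (φ x) * h x = 0) : h =ᵐ[volume] 0 := by
  refine ae_eq_zero_of_integral_contDiff_smul_eq_zero hl fun g hg hc => ?_
  have h1 : HasCompactSupport fun x => ((g x : ℝ) : ℂ) :=
    hc.comp_left (g := fun t : ℝ => (t : ℂ)) Complex.ofReal_zero
  rw [← H (h1.toSchwartzMap (Complex.ofRealCLM.contDiff.comp hg)) h1]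
  refine integral_congr_ae (Filter.Eventually.of_forall fun x => ?_)
  change g x • h x = star ((g x : ℝ) : ℂ) * h x
  simp

theorem locallyIntegrable_coeFn (η : StateSpace) : LocallyIntegrable (η : ℝ → ℂ) :=
  (Lp.memLp η).locallyIntegrable one_le_two

theorem integrable_star_mul_coeFn (η ζ : StateSpace) :
    Integrable fun x => star (η x) * ζ x := by
  refine (L2.integrable_inner (𝕜 := ℂ) η ζ).congr (Filter.Eventually.of_forall fun x => ?_)
  simp [mul_comm]

theorem inner_eq_integral (η ζ : StateSpace) : ⟪η, ζ⟫_ℂ = ∫ x, star (η x) * ζ x := by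
  rw [L2.inner_def]
  refine integral_congr_ae (Filter.Eventually.of_forall fun x => ?_)
  simp [mul_comm]

theorem inner_vec_left (φ : 𝓢(ℝ, ℂ)) (η : StateSpace) :
    ⟪vec φ, η⟫_ℂ = ∫ x, star (φ x) * η x := by
  rw [inner_eq_integral]
  refine integral_congr_ae ?_
  filter_upwards [coeFn_vec φ] with x hx
  rw [hx]

theorem integrable_star_mul_vec (φ : 𝓢(ℝ, ℂ)) (η : StateSpace) :
    Integrable fun x => star (φ x) * η x := by
  refine (integrable_star_mul_coeFn (vec φ) η).congr ?_
  filter_upwards [coeFn_vec φ] with x hx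
  rw [hx]

/-- Square integrability of `h` is a conclusion: testing gives local integrability, and a locally
integrable function orthogonal to all test functions vanishes. -/
theorem ae_eq_of_inner_eq {h : ℝ → ℂ} {η : StateSpace}
    (hi : ∀ φ : 𝓢(ℝ, ℂ), Integrable fun x => star (φ x) * h x)
    (he : ∀ φ : 𝓢(ℝ, ℂ), ⟪vec φ, η⟫_ℂ = ∫ x, star (φ x) * h x) : (η : ℝ → ℂ) =ᵐ[volume] h := by
  have := ae_eq_zero_of_integral_star_mul
    ((locallyIntegrable_coeFn η).sub (locallyIntegrable_of_integrable_star_mul hi)) fun φ _ => by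
      simp only [Pi.sub_apply, mul_sub]
      rw [integral_sub (integrable_star_mul_vec φ η) (hi φ), ← he, inner_vec_left, sub_self]
  filter_upwards [this] with x hx
  exact sub_eq_zero.1 hx

theorem vec_mem_schwartzDomain (φ : 𝓢(ℝ, ℂ)) : vec φ ∈ schwartzDomain := ⟨φ, rfl⟩

theorem exists_vec_eq {ψ : StateSpace} (h : ψ ∈ schwartzDomain) : ∃ φ, vec φ = ψ := h

theorem fourier_vec (φ : 𝓢(ℝ, ℂ)) : (𝓕 (vec φ) : StateSpace) = vec (𝓕 φ) :=
  SchwartzMap.toLp_fourier_eq φ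

theorem mem_multiplicationGraph {g : ℝ → ℂ} {x : StateSpace × StateSpace} :
    x ∈ multiplicationGraph g ↔ (x.2 : ℝ → ℂ) =ᵐ[volume] fun t => g t * x.1 t := Iff.rfl

/-- Convergence in `L²` gives almost everywhere convergence along a subsequence, extracted for one
component and then the other. -/
theorem isClosed_multiplicationGraph (g : ℝ → ℂ) :
    IsClosed (multiplicationGraph g : Set (StateSpace × StateSpace)) := by
  refine IsSeqClosed.isClosed fun u x hu hx => ?_
  obtain ⟨ns, hns, h1⟩ := (tendstoInMeasure_of_tendsto_Lp
    ((continuous_fst.tendsto x).comp hx)).exists_seq_tendsto_ae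
  obtain ⟨ms, hms, h2⟩ := (tendstoInMeasure_of_tendsto_Lp
    (((continuous_snd.tendsto x).comp hx).comp hns.tendsto_atTop)).exists_seq_tendsto_ae
  have h3 : ∀ᵐ t, ∀ n, (u n).2 t = g t * (u n).1 t := ae_all_iff.2 fun n => hu n
  refine mem_multiplicationGraph.2 ?_
  filter_upwards [h1, h2, h3] with t t1 t2 t3
  refine tendsto_nhds_unique t2 ?_
  simp only [Function.comp_apply, t3]
  exact (t1.comp hms.tendsto_atTop).const_mul _

theorem eq_zero_of_forall_re_lt {E : Type*} [AddCommGroup E] [Module ℂ E] (G : Submodule ℂ E)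
    (L : E →ₗ[ℂ] ℂ) (u : ℝ) (h : ∀ x ∈ G, (L x).re < u) : ∀ x ∈ G, L x = 0 := by
  intro x hx
  by_contra h0
  -- On this multiple of `x` the functional takes the value `u` itself, against the strict bound.
  have := h _ (G.smul_mem (u * (L x)⁻¹) hx)
  rw [map_smul, smul_eq_mul, mul_assoc, inv_mul_cancel₀ h0, mul_one, Complex.ofReal_re] at this
  exact this.false

/-- By Hahn–Banach it suffices that a functional `(a, b)` vanishing on `G` vanishes on the whole
graph. There it integrates `conj a + conj b · g` against the first component; vanishing on Schwartz
vectors makes this function zero almost everywhere. -/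
theorem topologicalClosure_eq_multiplicationGraph {g : ℝ → ℂ}
    {G : Submodule ℂ (StateSpace × StateSpace)} (hle : G ≤ multiplicationGraph g)
    (hG : ∀ φ : 𝓢(ℝ, ℂ), ∃ η, (vec φ, η) ∈ G) :
    G.topologicalClosure = multiplicationGraph g := by
  refine le_antisymm (G.topologicalClosure_minimal hle (isClosed_multiplicationGraph g))
    fun x hx => ?_
  by_contra hn
  obtain ⟨L, u, hu, hx0⟩ := RCLike.geometric_hahn_banach_closed_point (𝕜 := ℂ)
    (G.topologicalClosure.restrictScalars ℝ).convex G.isClosed_topologicalClosure hn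
  have hL := eq_zero_of_forall_re_lt G.topologicalClosure L.toLinearMap u hu
  have hu0 : 0 < u := by simpa using hu 0 (Submodule.zero_mem _)
  set a := (InnerProductSpace.toDual ℂ StateSpace).symm
    (L.comp (ContinuousLinearMap.inl ℂ StateSpace StateSpace)) with ha
  set b := (InnerProductSpace.toDual ℂ StateSpace).symm
    (L.comp (ContinuousLinearMap.inr ℂ StateSpace StateSpace)) with hb
  have hab : ∀ y, L y = ⟪a, y.1⟫_ℂ + ⟪b, y.2⟫_ℂ := by
    intro y
    rw [ha, hb, InnerProductSpace.toDual_symm_apply, InnerProductSpace.toDual_symm_apply]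
    simp [← map_add]
  have hint : ∀ y ∈ multiplicationGraph g,
      L y = ∫ t, (star (a t) + star (b t) * g t) * y.1 t := by
    intro y hy
    rw [hab, inner_eq_integral, inner_eq_integral,
      ← integral_add (integrable_star_mul_coeFn _ _) (integrable_star_mul_coeFn _ _)]
    refine integral_congr_ae ?_
    filter_upwards [mem_multiplicationGraph.1 hy] with t ht
    rw [ht]
    ring
  have hstar : ∀ η : StateSpace, LocallyIntegrable fun t => star (η t) := fun η =>
    (MemLp.star (Lp.memLp η)).locallyIntegrable one_le_two
  have hloc : LocallyIntegrable fun t => star (a t) + star (b t) * g t := by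
    refine (hstar a).add (locallyIntegrable_of_forall_exists fun R => ?_)
    -- `g` is not known to be locally integrable. On the ball it agrees with `g χ`, which is in `L²`
    -- because `χ` has an image under `G`.
    obtain ⟨χ, hχ⟩ := exists_schwartz_eq_one R
    obtain ⟨η, hη⟩ := hG χ
    refine ⟨_, (integrable_star_mul_coeFn b η).locallyIntegrable, ?_⟩
    filter_upwards [mem_multiplicationGraph.1 (hle hη), coeFn_vec χ] with t h1 h2 ht
    rw [h1, h2, hχ t ht, mul_one]
  have hzero := ae_eq_zero_of_integral_star_mul hloc fun φ _ => by
    obtain ⟨η, hη⟩ := hG (schwartzConj φ)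
    rw [← hL _ (G.le_topologicalClosure hη)]
    change _ = L _
    rw [hint _ (hle hη)]
    refine integral_congr_ae ?_
    filter_upwards [coeFn_vec (schwartzConj φ)] with t ht
    rw [ht, mul_comm]
    rfl
  have : L x = 0 := by
    rw [hint x hx, ← integral_zero ℝ ℂ]
    refine integral_congr_ae ?_
    filter_upwards [hzero] with t ht
    rw [ht]
    simp
  rw [this] at hx0
  simp only [map_zero] at hx0
  exact hx0.not_gt hu0

theorem closure_eq_of_topologicalClosure_eq {S T : StateSpace →ₗ.[ℂ] StateSpace}
    (h : S.graph.topologicalClosure = T.graph) : S.closure = T := by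
  have hS : S.IsClosable := ⟨T, h⟩
  exact LinearPMap.eq_of_eq_graph (hS.graph_closure_eq_closure_graph.symm.trans h)

theorem closure_eq_functionOfQ {S : StateSpace →ₗ.[ℂ] StateSpace} {f : ℝ → ℂ}
    (hle : S ≤ functionOfQ f) (hS : S.domain = schwartzDomain) : S.closure = functionOfQ f := by
  refine closure_eq_of_topologicalClosure_eq ?_
  have e : (functionOfQ f).graph = multiplicationGraph f :=
    Submodule.toLinearPMap_graph_eq _ (multiplicationGraph_functional f)
  rw [e]
  refine topologicalClosure_eq_multiplicationGraph (e ▸ LinearPMap.le_graph_of_le hle) fun φ => ?_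
  exact LinearPMap.mem_domain_iff.1 (hS ▸ vec_mem_schwartzDomain φ)

/-- The Fourier transform of pairs of vectors. -/
def fourierPair : (StateSpace × StateSpace) ≃L[ℂ] (StateSpace × StateSpace) :=
  (Lp.fourierTransformₗᵢ ℝ ℂ).toContinuousLinearEquiv.prodCongr
    (Lp.fourierTransformₗᵢ ℝ ℂ).toContinuousLinearEquiv

theorem fourierPair_apply (x : StateSpace × StateSpace) : fourierPair x = (𝓕 x.1, 𝓕 x.2) := rfl

theorem mem_graph_functionOfP_iff_fourierPair (f : ℝ → ℂ) (x : StateSpace × StateSpace) :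
    x ∈ (functionOfP f).graph ↔
      fourierPair x ∈ multiplicationGraph fun ξ => f (2 * Real.pi * ξ) := by
  rw [fourierPair_apply, mem_multiplicationGraph]
  exact mem_graph_functionOfP f x.1 x.2

theorem mem_topologicalClosure_iff_map {E : Type*} [NormedAddCommGroup E] [NormedSpace ℂ E]
    (e : E ≃L[ℂ] E) (S : Submodule ℂ E) (x : E) :
    x ∈ S.topologicalClosure ↔ e x ∈ (S.map (e : E →ₗ[ℂ] E)).topologicalClosure := by
  rw [← SetLike.mem_coe, ← SetLike.mem_coe, Submodule.topologicalClosure_coe,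
    Submodule.topologicalClosure_coe, Submodule.map_coe]
  change _ ↔ e x ∈ closure (e '' S)
  rw [← e.image_closure, e.injective.mem_set_image]

/-- Conjugation by the Fourier transform commutes with closure, preserves Schwartz vectors and
carries the graph of `f(P)` to a multiplication graph. -/
theorem closure_eq_functionOfP {S : StateSpace →ₗ.[ℂ] StateSpace} {f : ℝ → ℂ}
    (hle : S ≤ functionOfP f) (hS : S.domain = schwartzDomain) : S.closure = functionOfP f := by
  refine closure_eq_of_topologicalClosure_eq ?_
  ext x : 1
  rw [mem_graph_functionOfP_iff_fourierPair, mem_topologicalClosure_iff_map fourierPair]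
  rw [topologicalClosure_eq_multiplicationGraph (g := fun ξ => f (2 * Real.pi * ξ)) ?_ fun φ => ?_]
  · rintro _ ⟨y, hy, rfl⟩
    exact (mem_graph_functionOfP_iff_fourierPair f y).1 (LinearPMap.le_graph_of_le hle hy)
  · obtain ⟨η, hη⟩ := LinearPMap.mem_domain_iff.1
      (show vec (𝓕⁻ φ) ∈ S.domain from hS ▸ vec_mem_schwartzDomain _)
    refine ⟨𝓕 η, (vec (𝓕⁻ φ), η), hη, ?_⟩
    change fourierPair _ = _
    rw [fourierPair_apply, fourier_vec, FourierInvPair.fourier_fourierInv_eq]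

section Hyperbolic

variable {m : ℝ → ℝ} {M : StateSpace →L[ℂ] StateSpace}

theorem quantize_position_le (hm : Measurable m) (hc : ContinuousAt m 0) (h0 : m 0 = 1)
    (hM : IsOperatorOfWeight (hyperbolicWeight m) M) (f : ℝ → ℂ) :
    (quantize M fun z => f (position z)) ≤ functionOfQ f := by
  refine LinearPMap.le_of_le_graph ?_
  rw [graph_quantize]
  rintro ⟨_, η⟩ ⟨h1, h2⟩
  obtain ⟨ψ, rfl⟩ := exists_vec_eq h1
  rw [mem_graph_functionOfQ]
  have key := fun φ => quantForm_position hm hc h0 hM f φ ψ (h2 _ (vec_mem_schwartzDomain φ)).1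
  have : (η : ℝ → ℂ) =ᵐ[volume] fun x => f x * ψ x := by
    refine ae_eq_of_inner_eq (fun φ => ?_) fun φ => ?_
    · simpa only [mul_assoc] using (key φ).1
    · rw [← (h2 _ (vec_mem_schwartzDomain φ)).2, (key φ).2]
      simp only [mul_assoc]
  filter_upwards [this, coeFn_vec ψ] with x hx hv
  rw [hx, hv]

theorem quantize_momentum_le (hm : Measurable m) (hc : ContinuousAt m 0) (h0 : m 0 = 1)
    (hM : IsOperatorOfWeight (hyperbolicWeight m) M) (f : ℝ → ℂ) :
    (quantize M fun z => f (momentum z)) ≤ functionOfP f := by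
  refine LinearPMap.le_of_le_graph ?_
  rw [graph_quantize]
  rintro ⟨_, η⟩ ⟨h1, h2⟩
  obtain ⟨ψ, rfl⟩ := exists_vec_eq h1
  rw [mem_graph_functionOfP]
  have key := fun φ => quantForm_momentum hm hc h0 hM f φ ψ (h2 _ (vec_mem_schwartzDomain φ)).1
  have : ((𝓕 η : StateSpace) : ℝ → ℂ) =ᵐ[volume] fun ξ => f (2 * Real.pi * ξ) * 𝓕 ψ ξ := by
    refine ae_eq_of_inner_eq (fun φ => ?_) fun φ => ?_
    -- Testing with `𝓕⁻ φ` lets an arbitrary Schwartz function appear on the Fourier side.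
    · have := (key (𝓕⁻ φ)).1
      rw [FourierInvPair.fourier_fourierInv_eq] at this
      simpa only [mul_assoc] using this
    · have e : vec φ = 𝓕 (vec (𝓕⁻ φ)) := by
        rw [fourier_vec, FourierInvPair.fourier_fourierInv_eq]
      rw [e, Lp.inner_fourier_eq, ← (h2 _ (vec_mem_schwartzDomain _)).2, (key _).2,
        FourierInvPair.fourier_fourierInv_eq]
      simp only [mul_assoc]
  rw [fourier_vec]
  filter_upwards [this, coeFn_vec (𝓕 ψ)] with x hx hv
  rw [hx, hv]

end Hyperbolic

/-! ### Weights of temperate growth -/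

/-- `(1 + ‖x‖)^k` is replaced by the smooth `(1 + ‖x‖²)^k`, at the cost of `2^k`, so that its
product with `Ψ` is again Schwartz. The exponents `1` and `2` are used. -/
theorem memLp_mul_schwartz {E : Type*} [NormedAddCommGroup E] [InnerProductSpace ℝ E]
    [MeasurableSpace E] [BorelSpace E] [SecondCountableTopology E] {μ : Measure E}
    [μ.HasTemperateGrowth] {F : E → ℂ} (hF : AEStronglyMeasurable F μ) {C : ℝ} {k : ℕ}
    (hC : ∀ x, ‖F x‖ ≤ C * (1 + ‖x‖) ^ k) (Ψ : 𝓢(E, ℂ)) (p : ENNReal) :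
    MemLp (fun x => F x * Ψ x) p μ := by
  have ht : (fun x : E => (1 + ‖x‖ ^ 2) ^ k).HasTemperateGrowth :=
    ((Function.HasTemperateGrowth.const (1 : ℝ)).add (Function.hasTemperateGrowth_norm_sq E)).pow k
  have hC0 : 0 ≤ C := by
    have := (norm_nonneg _).trans (hC 0)
    simpa using this
  refine MemLp.of_le_mul (c := C * 2 ^ k)
    ((smulLeftCLM ℂ (fun x : E => (1 + ‖x‖ ^ 2) ^ k) Ψ).memLp p μ)
    (hF.mul Ψ.continuous.aestronglyMeasurable) (Filter.Eventually.of_forall fun x => ?_)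
  rw [smulLeftCLM_apply_apply ht, norm_smul, norm_mul, Real.norm_of_nonneg (by positivity),
    ← mul_assoc, mul_assoc C, ← mul_pow]
  have : 1 + ‖x‖ ≤ 2 * (1 + ‖x‖ ^ 2) := by nlinarith [sq_nonneg (‖x‖ - 1), sq_nonneg ‖x‖]
  exact mul_le_mul_of_nonneg_right ((hC x).trans (by gcongr)) (norm_nonneg _)

theorem IsSlowlyIncreasing.exists_bound_comp {f : ℝ → ℂ} (hf : IsSlowlyIncreasing f) {E : Type*}
    [NormedAddCommGroup E] {u : E → ℝ} {c : ℝ} (hu : ∀ x, |u x| ≤ c * ‖x‖) (hc : 0 ≤ c) :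
    ∃ (C : ℝ) (k : ℕ), ∀ x, ‖f (u x)‖ ≤ C * (1 + ‖x‖) ^ k := by
  obtain ⟨-, C, k, hC⟩ := hf
  have hC0 : 0 ≤ C := by
    have := (norm_nonneg _).trans (hC 0)
    simpa using this
  refine ⟨C * (1 + c) ^ k, k, fun x => (hC _).trans ?_⟩
  rw [mul_assoc, ← mul_pow]
  have : 1 + |u x| ≤ (1 + c) * (1 + ‖x‖) := by nlinarith [hu x, norm_nonneg x]
  gcongr

theorem hasTemperateGrowth_hyperbolicWeight {m : ℝ → ℝ} (hm : m.HasTemperateGrowth) :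
    (hyperbolicWeight m).HasTemperateGrowth := by
  have h1 : (fun z : ℂ => z ^ 2).HasTemperateGrowth := Function.HasTemperateGrowth.id.pow 2
  have h2 : (fun z : ℂ => (z ^ 2).im).HasTemperateGrowth :=
    Complex.imCLM.hasTemperateGrowth.comp h1
  exact Function.Complex.hasTemperateGrowth_ofReal.comp (hm.comp h2)

theorem exists_schwartz_eq_weight_mul {ϖ : ℂ → ℂ} (hϖ : ϖ.HasTemperateGrowth) (φ ψ : 𝓢(ℝ, ℂ)) :
    ∃ W : 𝓢(ℂ, ℂ), (fun z => ϖ z * ambiguity φ ψ z) = W := by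
  refine ⟨smulLeftCLM ℂ ϖ (schwartzAmbiguity φ ψ), funext fun z => ?_⟩
  rw [smulLeftCLM_apply_apply hϖ]
  rfl

theorem domain_quantize_le (M : StateSpace →L[ℂ] StateSpace) (F : ℂ → ℂ) :
    (quantize M F).domain ≤ schwartzDomain := by
  intro ψ hψ
  obtain ⟨η, hη⟩ := LinearPMap.mem_domain_iff.1 hψ
  rw [graph_quantize] at hη
  exact hη.1

theorem domain_quantize_eq {M : StateSpace →L[ℂ] StateSpace} {F : ℂ → ℂ}
    (h : ∀ ψ : 𝓢(ℝ, ℂ), ∃ η : StateSpace, ∀ φ : 𝓢(ℝ, ℂ),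
      Integrable (formIntegrand M F (vec φ) (vec ψ)) ∧
        quantForm M F (vec φ) (vec ψ) = ⟪vec φ, η⟫_ℂ) :
    (quantize M F).domain = schwartzDomain := by
  refine le_antisymm (domain_quantize_le M F) fun _ hψ => ?_
  obtain ⟨ψ, rfl⟩ := exists_vec_eq hψ
  obtain ⟨η, hη⟩ := h ψ
  refine LinearPMap.mem_domain_iff.2 ⟨η, ?_⟩
  rw [graph_quantize]
  refine ⟨hψ, fun _ hφ => ?_⟩
  obtain ⟨φ, rfl⟩ := exists_vec_eq hφ
  exact hη φ

/-- For temperate `ϖ` the product `ϖ(z) ⟨φ, D(z) ψ⟩` is Schwartz, hence so is its transform, which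
beats the growth of `F`. -/
theorem integrable_formIntegrand {ϖ : ℂ → ℂ} (hϖ : ϖ.HasTemperateGrowth)
    {M : StateSpace →L[ℂ] StateSpace} (hM : IsOperatorOfWeight ϖ M) {F : ℂ → ℂ}
    (hF : Measurable F) {C : ℝ} {k : ℕ} (hC : ∀ w, ‖F w‖ ≤ C * (1 + ‖w‖) ^ k) (φ ψ : 𝓢(ℝ, ℂ)) :
    Integrable (formIntegrand M F (vec φ) (vec ψ)) := by
  obtain ⟨W, hW⟩ := exists_schwartz_eq_weight_mul hϖ φ ψ
  have hC0 : 0 ≤ C := by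
    have := (norm_nonneg _).trans (hC 0)
    simpa using this
  have h4 := Real.pi_le_four
  have hm : Measurable phasePoint :=
    (negIMul.continuous.const_smul Real.pi).measurable
  have h1 := (memLp_mul_schwartz (μ := volume) (F := fun ξ => F (phasePoint ξ)) (C := C * 4 ^ k)
    (k := k) (hF.comp hm).aestronglyMeasurable (fun ξ => (hC _).trans ?_) (𝓕 W) 1)
  · rw [memLp_one_iff_integrable] at h1
    refine integrable_comp_phasePoint_iff.1 ((h1.const_mul (Real.pi : ℂ)⁻¹).congr
      (Filter.Eventually.of_forall fun ξ => ?_))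
    simp only [formIntegrand]
    rw [inner_displaced_vec hM, inv_pi_mul_I_mul_phasePoint, hW, fourier_coe, mul_left_comm]
  · rw [mul_assoc, ← mul_pow, norm_phasePoint]
    have : 1 + Real.pi * ‖ξ‖ ≤ 4 * (1 + ‖ξ‖) := by nlinarith [norm_nonneg ξ]
    gcongr

section Hyperbolic

variable {m : ℝ → ℝ} {M : StateSpace →L[ℂ] StateSpace}

theorem domain_quantize_position (hm : m.HasTemperateGrowth) (h0 : m 0 = 1)
    (hM : IsOperatorOfWeight (hyperbolicWeight m) M) {f : ℝ → ℂ} (hf : IsSlowlyIncreasing f) :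
    (quantize M fun z => f (position z)).domain = schwartzDomain := by
  have cm : Continuous m := hm.1.continuous
  obtain ⟨C, k, hC⟩ := hf.exists_bound_comp abs_position_le (by norm_num)
  obtain ⟨C', k', hC'⟩ := hf.exists_bound_comp (u := fun x : ℝ => x) (c := 1)
    (fun x => by rw [one_mul, Real.norm_eq_abs]) zero_le_one
  refine domain_quantize_eq fun ψ => ?_
  have hL := memLp_mul_schwartz (μ := volume) hf.1.aestronglyMeasurable hC' ψ 2
  refine ⟨hL.toLp _, fun φ => ?_⟩
  have hi := integrable_formIntegrand (hasTemperateGrowth_hyperbolicWeight hm) hM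
    (hf.1.comp positionL.continuous.measurable) hC φ ψ
  refine ⟨hi, (quantForm_position cm.measurable cm.continuousAt h0 hM f φ ψ hi).2.trans ?_⟩
  rw [inner_vec_left]
  refine integral_congr_ae ?_
  filter_upwards [hL.coeFn_toLp] with x hx
  rw [hx, mul_assoc]

theorem domain_quantize_momentum (hm : m.HasTemperateGrowth) (h0 : m 0 = 1)
    (hM : IsOperatorOfWeight (hyperbolicWeight m) M) {f : ℝ → ℂ} (hf : IsSlowlyIncreasing f) :
    (quantize M fun z => f (momentum z)).domain = schwartzDomain := by
  have cm : Continuous m := hm.1.continuous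
  obtain ⟨C, k, hC⟩ := hf.exists_bound_comp abs_momentum_le (by norm_num)
  obtain ⟨C', k', hC'⟩ := hf.exists_bound_comp (u := fun x : ℝ => 2 * Real.pi * x)
    (c := 2 * Real.pi) (fun x => by
      rw [abs_mul, abs_of_pos (by positivity), Real.norm_eq_abs]) (by positivity)
  refine domain_quantize_eq fun ψ => ?_
  have hL := memLp_mul_schwartz (μ := volume) (F := fun x : ℝ => f (2 * Real.pi * x))
    (hf.1.comp (measurable_const_mul (2 * Real.pi))).aestronglyMeasurable hC' (𝓕 ψ) 2
  refine ⟨𝓕⁻ (hL.toLp _ : StateSpace), fun φ => ?_⟩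
  have hi := integrable_formIntegrand (hasTemperateGrowth_hyperbolicWeight hm) hM
    (hf.1.comp momentumL.continuous.measurable) hC φ ψ
  refine ⟨hi, (quantForm_momentum cm.measurable cm.continuousAt h0 hM f φ ψ hi).2.trans ?_⟩
  rw [← Lp.inner_fourier_eq, FourierInvPair.fourier_fourierInv_eq, fourier_vec, inner_vec_left]
  refine integral_congr_ae ?_
  filter_upwards [hL.coeFn_toLp] with x hx
  rw [hx, mul_assoc]

theorem isCanonicalOnQAndP (hm : m.HasTemperateGrowth) (h0 : m 0 = 1)
    (hM : IsOperatorOfWeight (hyperbolicWeight m) M) : IsCanonicalOnQAndP M := by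
  intro f hf
  have cm : Continuous m := hm.1.continuous
  have h1 := domain_quantize_position hm h0 hM hf
  have h2 := domain_quantize_momentum hm h0 hM hf
  exact ⟨⟨h1, closure_eq_functionOfQ
    (quantize_position_le cm.measurable cm.continuousAt h0 hM f) h1⟩, h2,
    closure_eq_functionOfP (quantize_momentum_le cm.measurable cm.continuousAt h0 hM f) h2⟩

end Hyperbolic

/-! ### Exponential weights and the parity operator -/

/-- The weight `exp (i λ Im z²)`. -/
def expWeight (l : ℝ) (z : ℂ) : ℂ := Complex.exp (((l * (z ^ 2).im : ℝ) : ℂ) * Complex.I)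

theorem integrable_expWeight_mul_ambiguity (l : ℝ) (φ ψ : 𝓢(ℝ, ℂ)) :
    Integrable fun z => expWeight l z * ambiguity φ ψ z := by
  refine (schwartzAmbiguity φ ψ).integrable.bdd_mul (c := 1)
    (Continuous.aestronglyMeasurable ?_) (Filter.Eventually.of_forall fun z => ?_)
  · unfold expWeight
    fun_prop
  · rw [expWeight, Complex.norm_exp_ofReal_mul_I]

/-- For fixed `a = Re z` the weight is the character `exp (2 i l a b)` of `b = Im z`, so the inner
integral is a value of `fourier_ambiguity_im`; then `q = √2 a`. -/
theorem integral_expWeight_mul_ambiguity (l : ℝ) (φ ψ : 𝓢(ℝ, ℂ)) :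
    (Real.pi : ℂ)⁻¹ * ∫ z, expWeight l z * ambiguity φ ψ z
      = ∫ q : ℝ, star (φ ((1 / 2 - l) * q)) * ψ (-(1 / 2 + l) * q) := by
  have hi := integrable_expWeight_mul_ambiguity l φ ψ
  rw [integral_complex_eq_prod, integral_prod _ (integrable_complex_iff_prod.1 hi)]
  have h2 : √2 * √2 = (2 : ℝ) := Real.mul_self_sqrt (by norm_num)
  have hs : √2 ≠ 0 := by positivity
  have hpi := Real.pi_ne_zero
  have e : ∀ a : ℝ, ∫ b : ℝ, expWeight l ⟨a, b⟩ * ambiguity φ ψ ⟨a, b⟩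
      = ((√2 * Real.pi : ℝ) : ℂ) * (fun q : ℝ => star (φ ((1 / 2 - l) * q)) *
        ψ (-(1 / 2 + l) * q)) (√2 * a) := by
    intro a
    -- The frequency solves `-2π b s = 2 l a b`.
    have h := fourier_ambiguity_im φ ψ a (-(l * a / Real.pi))
    have e1 : √2 * Real.pi * -(l * a / Real.pi) + a / √2 = (1 / 2 - l) * (√2 * a) := by
      field_simp
      linear_combination (-a) * h2
    have e2 : √2 * Real.pi * -(l * a / Real.pi) - a / √2 = -(1 / 2 + l) * (√2 * a) := by
      field_simp
      linear_combination a * h2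
    rw [e1, e2] at h
    rw [← h, Real.fourier_eq']
    refine integral_congr_ae (Filter.Eventually.of_forall fun b => ?_)
    simp only [smul_eq_mul, expWeight, im_sq_mk]
    congr 4
    simp
    field_simp
  simp_rw [e]
  rw [integral_const_mul, Measure.integral_comp_mul_left (fun q : ℝ =>
    star (φ ((1 / 2 - l) * q)) * ψ (-(1 / 2 + l) * q)) (√2), abs_of_pos (by positivity),
    Complex.real_smul]
  have h3 : (√2 : ℂ) ≠ 0 := Complex.ofReal_ne_zero.2 hs
  have h4 : (Real.pi : ℂ) ≠ 0 := Complex.ofReal_ne_zero.2 hpi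
  generalize (∫ q : ℝ, star (φ ((1 / 2 - l) * q)) * ψ (-(1 / 2 + l) * q)) = I
  push_cast
  field_simp

theorem isOperatorOfWeight_weylWigner :
    IsOperatorOfWeight (hyperbolicWeight fun _ => 1) weylWigner := by
  intro φ ψ
  have e : ∀ z, hyperbolicWeight (fun _ => 1) z * ⟪vec φ, displacement z (vec ψ)⟫_ℂ
      = expWeight 0 z * ambiguity φ ψ z := fun z => by
    rw [inner_displacement_vec]
    simp [hyperbolicWeight, expWeight]
  simp_rw [e]
  refine ⟨integrable_expWeight_mul_ambiguity 0 φ ψ, ?_⟩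
  rw [integral_expWeight_mul_ambiguity]
  have h1 : (weylWigner (vec ψ) : ℝ → ℂ) =ᵐ[volume] fun x => 2 * ψ (-x) := by
    have hp := Lp.coeFn_compMeasurePreserving (vec ψ) (Measure.measurePreserving_neg (volume : Measure ℝ))
    filter_upwards [Lp.coeFn_smul (2 : ℂ) (parity (vec ψ)), hp,
      (Measure.measurePreserving_neg (volume : Measure ℝ)).quasiMeasurePreserving.ae_eq_comp
        (coeFn_vec ψ)] with x h1 h2 h3
    exact h1.trans (congrArg (fun y => (2 : ℂ) * y) (h2.trans h3))
  have h2 : ⟪vec φ, weylWigner (vec ψ)⟫_ℂ = 2 * ∫ x, star (φ x) * ψ (-x) := by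
    rw [inner_vec_left, ← integral_const_mul]
    refine integral_congr_ae ?_
    filter_upwards [h1] with x hx
    rw [hx]
    ring
  have h3 : (fun q : ℝ => star (φ ((1 / 2 - 0) * q)) * ψ (-(1 / 2 + 0) * q))
      = fun q => (fun x => star (φ x) * ψ (-x)) (1 / 2 * q) := by
    funext q
    simp only [sub_zero, add_zero, neg_mul]
  rw [h2, h3, Measure.integral_comp_mul_left (fun x => star (φ x) * ψ (-x)), Complex.real_smul]
  norm_num

/-! ### Dilations -/

/-- The image measure is half of Lebesgue measure, so `ψ ↦ ψ(2x)` does not increase the `L²` norm.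
-/
theorem map_two_mul_le : Measure.map (fun x : ℝ => 2 * x) volume ≤ volume := by
  rw [Real.map_volume_mul_left (by norm_num)]
  refine Measure.le_iff'.2 fun s => ?_
  rw [Measure.smul_apply, smul_eq_mul]
  refine mul_le_of_le_one_left zero_le ?_
  rw [ENNReal.ofReal_le_one]
  norm_num [abs_le]

theorem memLp_comp_two_mul {φ : ℝ → ℂ} (hφ : MemLp φ 2 (volume : Measure ℝ)) :
    MemLp (fun x => φ (2 * x)) 2 (volume : Measure ℝ) :=
  (hφ.mono_measure map_two_mul_le).comp_of_map (measurable_const_mul 2).aemeasurable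

theorem ae_eq_comp_two_mul {φ ψ : ℝ → ℂ} (h : φ =ᵐ[volume] ψ) :
    (fun x => φ (2 * x)) =ᵐ[volume] fun x => ψ (2 * x) :=
  ae_of_ae_map (measurable_const_mul 2).aemeasurable
    (h.filter_mono (Measure.absolutelyContinuous_of_le map_two_mul_le).ae_le)

theorem eLpNorm_comp_two_mul_le {φ : ℝ → ℂ} (hφ : MemLp φ 2 (volume : Measure ℝ)) :
    eLpNorm (fun x => φ (2 * x)) 2 volume ≤ eLpNorm φ 2 volume := by
  have h := eLpNorm_map_measure (p := 2) (hφ.mono_measure map_two_mul_le).1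
    (measurable_const_mul (2 : ℝ)).aemeasurable
  exact h.symm.le.trans (eLpNorm_mono_measure φ map_two_mul_le)

/-- The dilation `ψ ↦ ψ(2x)`. -/
def dilation : StateSpace →L[ℂ] StateSpace :=
  LinearMap.mkContinuous
    { toFun := fun φ => (memLp_comp_two_mul (Lp.memLp φ)).toLp (fun x => φ (2 * x))
      map_add' := fun φ ψ => by
        rw [← MemLp.toLp_add]
        exact MemLp.toLp_congr _ _ (ae_eq_comp_two_mul (Lp.coeFn_add φ ψ))
      map_smul' := fun c φ => by
        rw [RingHom.id_apply, ← MemLp.toLp_const_smul]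
        exact MemLp.toLp_congr _ _ (ae_eq_comp_two_mul (Lp.coeFn_smul c φ)) } 1 fun φ => by
    change ‖(memLp_comp_two_mul (Lp.memLp φ)).toLp (fun x => φ (2 * x))‖ ≤ _
    rw [one_mul, Lp.norm_toLp, Lp.norm_def]
    exact ENNReal.toReal_mono (Lp.memLp φ).2.ne (eLpNorm_comp_two_mul_le (Lp.memLp φ))

theorem coeFn_dilation_vec (ψ : 𝓢(ℝ, ℂ)) :
    (dilation (vec ψ) : ℝ → ℂ) =ᵐ[volume] fun x => ψ (2 * x) :=
  (MemLp.coeFn_toLp (memLp_comp_two_mul (Lp.memLp (vec ψ)))).trans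
    (ae_eq_comp_two_mul (coeFn_vec ψ))

theorem inner_dilation_vec (φ ψ : 𝓢(ℝ, ℂ)) :
    ⟪vec φ, dilation (vec ψ)⟫_ℂ = ∫ x, star (φ x) * ψ (2 * x) := by
  rw [inner_vec_left]
  refine integral_congr_ae ?_
  filter_upwards [coeFn_dilation_vec ψ] with x hx
  rw [hx]

theorem inner_adjoint_dilation_vec (φ ψ : 𝓢(ℝ, ℂ)) :
    ⟪vec φ, dilation.adjoint (vec ψ)⟫_ℂ = ∫ x, star (φ (2 * x)) * ψ x := by
  rw [ContinuousLinearMap.adjoint_inner_right, inner_eq_integral]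
  refine integral_congr_ae ?_
  filter_upwards [coeFn_dilation_vec φ, coeFn_vec ψ] with x hx h2
  rw [hx, h2]

/-- The weight function `cos (3 s / 2)`. -/
def cosWeight (s : ℝ) : ℝ := Real.cos (3 / 2 * s)

theorem hasTemperateGrowth_cosWeight : cosWeight.HasTemperateGrowth := by
  have h := Complex.reCLM.hasTemperateGrowth.comp
    (hasTemperateGrowth_cexp_ofReal_mul_I.comp (f := fun s : ℝ => 3 / 2 * s) (by fun_prop))
  convert h using 1
  funext s
  exact (Complex.exp_ofReal_mul_I_re _).symm

/-- The operator of the weight `cos (3 Im z² / 2)`. -/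
def dilationMean : StateSpace →L[ℂ] StateSpace :=
  (1 / 2 : ℂ) • (dilation + dilation.adjoint)

/-- The cosine is the mean of the exponential weights with `l = ±3/2`. For these the arguments of
`φ` and `ψ` are `-q, -2q` and `2q, q`, the forms of the dilation and its adjoint. -/
theorem isOperatorOfWeight_dilationMean :
    IsOperatorOfWeight (hyperbolicWeight cosWeight) dilationMean := by
  intro φ ψ
  have e : ∀ z, hyperbolicWeight cosWeight z * ⟪vec φ, displacement z (vec ψ)⟫_ℂ
      = (1 / 2 : ℂ) * (expWeight (3 / 2) z * ambiguity φ ψ z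
        + expWeight (-(3 / 2)) z * ambiguity φ ψ z) := fun z => by
    rw [inner_displacement_vec, hyperbolicWeight, cosWeight, Complex.ofReal_cos, Complex.cos,
      expWeight, expWeight, neg_mul (3 / 2 : ℝ), Complex.ofReal_neg]
    ring_nf
  have i1 := integrable_expWeight_mul_ambiguity (3 / 2) φ ψ
  have i2 := integrable_expWeight_mul_ambiguity (-(3 / 2)) φ ψ
  simp_rw [e]
  refine ⟨(i1.add i2).const_mul _, ?_⟩
  rw [integral_const_mul, integral_add i1 i2, mul_left_comm, mul_add,
    integral_expWeight_mul_ambiguity, integral_expWeight_mul_ambiguity]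
  change ⟪vec φ, (1 / 2 : ℂ) • (dilation (vec ψ) + dilation.adjoint (vec ψ))⟫_ℂ = _
  rw [inner_smul_right, inner_add_right, inner_dilation_vec, inner_adjoint_dilation_vec,
    ← integral_neg_eq_self fun x => star (φ x) * ψ (2 * x)]
  congr 2
  · refine integral_congr_ae (Filter.Eventually.of_forall fun x => ?_)
    simp only
    rw [show (1 / 2 - 3 / 2) * x = -x by ring, show -(1 / 2 + 3 / 2) * x = 2 * -x by ring]
  · refine integral_congr_ae (Filter.Eventually.of_forall fun x => ?_)
    simp only
    rw [show (1 / 2 - -(3 / 2)) * x = 2 * x by ring, show -(1 / 2 + -(3 / 2)) * x = x by ring]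

/-! ### Quantization of characters -/

/-- The character of the phase space whose quantization is a multiple of `D(z)`. -/
def phaseCharacter (z w : ℂ) : ℂ :=
  Complex.exp (((2 * Real.pi * inner ℝ ((Real.pi : ℂ)⁻¹ * Complex.I * w) z : ℝ) : ℂ) * Complex.I)

theorem continuous_phaseCharacter (z : ℂ) : Continuous (phaseCharacter z) := by
  unfold phaseCharacter
  fun_prop

theorem norm_phaseCharacter (z w : ℂ) : ‖phaseCharacter z w‖ = 1 := by
  rw [phaseCharacter, Complex.norm_exp_ofReal_mul_I]

section Character

variable {ϖ : ℂ → ℂ} {M : StateSpace →L[ℂ] StateSpace}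

theorem integrable_formIntegrand_phaseCharacter (hϖ : ϖ.HasTemperateGrowth)
    (hM : IsOperatorOfWeight ϖ M) (z : ℂ) (φ ψ : 𝓢(ℝ, ℂ)) :
    Integrable (formIntegrand M (phaseCharacter z) (vec φ) (vec ψ)) :=
  integrable_formIntegrand hϖ hM (continuous_phaseCharacter z).measurable (C := 1) (k := 0)
    (fun w => by rw [norm_phaseCharacter, pow_zero, mul_one]) φ ψ

/-- Fourier inversion at `z`. Quantizing characters recovers the weight pointwise, so different
weights give different quantizations. -/
theorem quantForm_phaseCharacter (hϖ : ϖ.HasTemperateGrowth)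
    (hM : IsOperatorOfWeight ϖ M) (z : ℂ) (φ ψ : 𝓢(ℝ, ℂ)) :
    quantForm M (phaseCharacter z) (vec φ) (vec ψ) = ⟪vec φ, ϖ z • displacement z (vec ψ)⟫_ℂ := by
  obtain ⟨W, hW⟩ := exists_schwartz_eq_weight_mul hϖ φ ψ
  have hpi := Complex.ofReal_ne_zero.2 Real.pi_ne_zero
  have e : ∀ ξ, formIntegrand M (phaseCharacter z) (vec φ) (vec ψ) (phasePoint ξ)
      = (Real.pi : ℂ)⁻¹ * (Complex.exp (((2 * Real.pi * inner ℝ ξ z : ℝ) : ℂ) * Complex.I) •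
        𝓕 W ξ) := fun ξ => by
    rw [formIntegrand, inner_displaced_vec hM, phaseCharacter, inv_pi_mul_I_mul_phasePoint, hW,
      fourier_coe, mul_left_comm, smul_eq_mul]
  rw [inner_smul_right, inner_displacement_vec]
  rw [show ϖ z * ambiguity φ ψ z = W z from congrFun hW z, quantForm, integral_comp_phasePoint]
  simp_rw [e]
  rw [integral_const_mul, ← Real.fourierInv_eq', ← fourierInv_coe,
    FourierPair.fourierInv_fourier_eq]
  field_simp

theorem mem_graph_quantize_phaseCharacter (hϖ : ϖ.HasTemperateGrowth)
    (hM : IsOperatorOfWeight ϖ M) (z : ℂ) (ψ : 𝓢(ℝ, ℂ)) :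
    (vec ψ, ϖ z • displacement z (vec ψ)) ∈ (quantize M (phaseCharacter z)).graph := by
  rw [graph_quantize]
  refine ⟨vec_mem_schwartzDomain ψ, fun _ hφ => ?_⟩
  obtain ⟨φ, rfl⟩ := exists_vec_eq hφ
  exact ⟨integrable_formIntegrand_phaseCharacter hϖ hM z φ ψ, quantForm_phaseCharacter hϖ hM z φ ψ⟩

theorem domain_quantize_phaseCharacter (hϖ : ϖ.HasTemperateGrowth)
    (hM : IsOperatorOfWeight ϖ M) (z : ℂ) :
    (quantize M (phaseCharacter z)).domain = schwartzDomain :=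
  domain_quantize_eq fun ψ => ⟨ϖ z • displacement z (vec ψ), fun φ =>
    ⟨integrable_formIntegrand_phaseCharacter hϖ hM z φ ψ, quantForm_phaseCharacter hϖ hM z φ ψ⟩⟩

end Character

theorem exists_vec_ne_zero : ∃ χ : 𝓢(ℝ, ℂ), vec χ ≠ 0 := by
  obtain ⟨χ, hχ⟩ := exists_schwartz_eq_one 1
  refine ⟨χ, fun h => ?_⟩
  have h1 : (χ : ℝ → ℂ) =ᵐ[volume] fun _ => 0 := by
    have := coeFn_vec χ
    rw [h] at this
    exact this.symm.trans (Lp.coeFn_zero ℂ 2 volume)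
  have h2 := (Continuous.ae_eq_iff_eq volume χ.continuous continuous_const).1 h1
  have h3 := hχ 0 (by simp)
  rw [h2] at h3
  exact zero_ne_one h3

theorem quantize_ne_of_weight_ne {ϖ₁ ϖ₂ : ℂ → ℂ} {M₁ M₂ : StateSpace →L[ℂ] StateSpace}
    (h₁ : ϖ₁.HasTemperateGrowth) (hM₁ : IsOperatorOfWeight ϖ₁ M₁)
    (h₂ : ϖ₂.HasTemperateGrowth) (hM₂ : IsOperatorOfWeight ϖ₂ M₂) {z : ℂ} (hz : ϖ₁ z ≠ ϖ₂ z) :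
    quantize M₁ (phaseCharacter z) ≠ quantize M₂ (phaseCharacter z) := by
  intro h
  obtain ⟨χ, hχ⟩ := exists_vec_ne_zero
  have m1 := mem_graph_quantize_phaseCharacter h₁ hM₁ z χ
  rw [h] at m1
  have e := LinearPMap.mem_graph_snd_inj _ m1 (mem_graph_quantize_phaseCharacter h₂ hM₂ z χ) rfl
  rw [← sub_eq_zero, ← sub_smul, smul_eq_zero, sub_eq_zero] at e
  refine e.elim hz fun e0 => hχ ?_
  rw [← norm_eq_zero, ← (displacement z).norm_map, e0, norm_zero]

theorem exists_hyperbolicWeight_cosWeight_ne :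
    ∃ z, hyperbolicWeight cosWeight z ≠ hyperbolicWeight (fun _ => 1) z := by
  -- Here `Im z² = 2π / 3`, so the cosine is `cos π = -1`.
  refine ⟨⟨Real.pi, 1 / 3⟩, ?_⟩
  rw [hyperbolicWeight, hyperbolicWeight, im_sq_mk, cosWeight,
    show 3 / 2 * (2 * Real.pi * (1 / 3)) = Real.pi by ring, Real.cos_pi]
  norm_num

end WeylHeisenberg

end

open WeylHeisenberg in
theorem mainTheorem7 :
    (∀ (m : ℝ → ℝ) (M : StateSpace →L[ℂ] StateSpace),
      Measurable m → ContinuousAt m 0 → m 0 = 1 →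
      IsOperatorOfWeight (hyperbolicWeight m) M →
      (∀ f : ℝ → ℂ, Measurable f →
        -- equality of the sesquilinear forms, wherever the form of `A_f` is defined
        (∀ φ ψ : 𝓢(ℝ, ℂ),
          Integrable (formIntegrand M (fun z => f (position z)) (vec φ) (vec ψ)) →
          Integrable (fun x : ℝ => star (φ x) * f x * ψ x) ∧
          quantForm M (fun z => f (position z)) (vec φ) (vec ψ)
            = ∫ x : ℝ, star (φ x) * f x * ψ x) ∧
        (∀ φ ψ : 𝓢(ℝ, ℂ),
          Integrable (formIntegrand M (fun z => f (momentum z)) (vec φ) (vec ψ)) →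
          Integrable (fun ξ : ℝ => star (𝓕 φ ξ) * f (2 * Real.pi * ξ) * 𝓕 ψ ξ) ∧
          quantForm M (fun z => f (momentum z)) (vec φ) (vec ψ)
            = ∫ ξ : ℝ, star (𝓕 φ ξ) * f (2 * Real.pi * ξ) * 𝓕 ψ ξ) ∧
        -- equality of the operators
        (quantize M fun z => f (position z)) ≤ functionOfQ f ∧
        (quantize M fun z => f (momentum z)) ≤ functionOfP f ∧
        ((quantize M fun z => f (position z)).domain = schwartzDomain →
          (quantize M fun z => f (position z)).closure = functionOfQ f) ∧
        ((quantize M fun z => f (momentum z)).domain = schwartzDomain →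
          (quantize M fun z => f (momentum z)).closure = functionOfP f)) ∧
      -- the same, with no convergence assumption, for Gaussian summable integrals
      (∀ f : ℝ → ℂ, IsFourierStieltjes f → ∀ φ ψ : 𝓢(ℝ, ℂ),
        QuantFormTendsto M (fun z => f (position z)) (vec φ) (vec ψ)
          (∫ x : ℝ, star (φ x) * f x * ψ x) ∧
        QuantFormTendsto M (fun z => f (momentum z)) (vec φ) (vec ψ)
          (∫ ξ : ℝ, star (𝓕 φ ξ) * f (2 * Real.pi * ξ) * 𝓕 ψ ξ)) ∧
      -- no convergence assumption is needed for smooth `m` of temperate growth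
      (m.HasTemperateGrowth → IsCanonicalOnQAndP M)) ∧
    -- Weyl–Wigner quantization is the case `m = 1` and has the property
    (IsOperatorOfWeight (hyperbolicWeight fun _ => 1) weylWigner ∧
      IsCanonicalOnQAndP weylWigner) ∧
    -- it is not the only one
    (∃ (m : ℝ → ℝ) (M : StateSpace →L[ℂ] StateSpace),
      m.HasTemperateGrowth ∧ m 0 = 1 ∧ IsOperatorOfWeight (hyperbolicWeight m) M ∧
      IsCanonicalOnQAndP M ∧
      ∃ F : ℂ → ℂ, (quantize M F).domain = schwartzDomain ∧
        (quantize weylWigner F).domain = schwartzDomain ∧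
        quantize M F ≠ quantize weylWigner F) := by
  have h1 : (fun _ : ℝ => (1 : ℝ)).HasTemperateGrowth := Function.HasTemperateGrowth.const 1
  refine ⟨fun m M hm hc h0 hM => ⟨fun f _ => ⟨quantForm_position hm hc h0 hM f,
      quantForm_momentum hm hc h0 hM f, quantize_position_le hm hc h0 hM f,
      quantize_momentum_le hm hc h0 hM f,
      closure_eq_functionOfQ (quantize_position_le hm hc h0 hM f),
      closure_eq_functionOfP (quantize_momentum_le hm hc h0 hM f)⟩,
    fun f hf φ ψ => ⟨quantFormTendsto_position hm hc h0 hM hf φ ψ,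
      quantFormTendsto_momentum hm hc h0 hM hf φ ψ⟩,
    fun ht => isCanonicalOnQAndP ht h0 hM⟩, ⟨isOperatorOfWeight_weylWigner,
    isCanonicalOnQAndP h1 rfl isOperatorOfWeight_weylWigner⟩, ?_⟩
  have h0 : cosWeight 0 = 1 := by simp [cosWeight]
  have t1 := hasTemperateGrowth_hyperbolicWeight hasTemperateGrowth_cosWeight
  have t2 := hasTemperateGrowth_hyperbolicWeight h1
  obtain ⟨z, hz⟩ := exists_hyperbolicWeight_cosWeight_ne
  exact ⟨cosWeight, dilationMean, hasTemperateGrowth_cosWeight, h0,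
    isOperatorOfWeight_dilationMean,
    isCanonicalOnQAndP hasTemperateGrowth_cosWeight h0 isOperatorOfWeight_dilationMean,
    phaseCharacter z, domain_quantize_phaseCharacter t1 isOperatorOfWeight_dilationMean z,
    domain_quantize_phaseCharacter t2 isOperatorOfWeight_weylWigner z,
    quantize_ne_of_weight_ne t1 isOperatorOfWeight_dilationMean t2 isOperatorOfWeight_weylWigner hz⟩
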